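/- Let $k$ be a field and let $A$ and $B$ be finite-dimensional $k$-algebras. Write $\otimes=\otimes_k$ and $\Lambda=A\otimes B$; modules are finitely generated left modules unless stated otherwise. Assume that $B$ is triangular, i.e. its Ext-quiver (whose vertices are the isomorphism classes of simple $B$-modules, with an arrow from $S$ to $T$ whenever $\mathrm{Ext}^1_B(S,T)\neq 0$) has no oriented cycles (in particular no loops), and that $k$ is a splitting field for $B$, i.e. $\mathrm{End}_B(S)=k$ for every simple $B$-module $S$. For an algebra $\Gamma$, let $\Gamma\text{-}\mathsf{Gproj}$ be the full subcategory of $\Gamma\text{-mod}$ of Gorenstein projective modules: those $G$ with $G\cong\operatorname{Ker} d^1$ for some exact complex $(P^i,d^i)_{i\in\mathbb Z}$ of finitely generated projective $\Gamma$-modules such that $\operatorname{Hom}_\Gamma(P^\bullet,\Gamma)$ is also exact. Let $\mathrm{D}=\operatorname{Hom}_k(-,k)$, and let $\mathsf{Mon}(B,A\text{-}\mathsf{Gproj})$ be the full subcategory of $\Lambda\text{-mod}$ of all $X$ such that $\mathrm{Tor}_i^{\Lambda}(A\otimes \mathrm{D}(S),X)=0$ for all $i\ge 1$ and all simple left $B$-modules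 $S$, and $(A\otimes V)\otimes_{\Lambda}X\in A\text{-}\mathsf{Gproj}$ for all finitely generated right $B$-modules $V$. Let $\mathsf{filt}(A\text{-}\mathsf{Gproj}\otimes B\text{-}\mathsf{Gproj})$ be the full subcategory of $\Lambda\text{-mod}$ of all $X$ that admit a finite filtration $0=X_0\subseteq X_1\subseteq\cdots\subseteq X_m=X$ by $\Lambda$-submodules in which every factor $X_i/X_{i-1}$ is isomorphic to $M\otimes N$ for some $M\in A\text{-}\mathsf{Gproj}$ and $N\in B\text{-}\mathsf{Gproj}$. Then $$\mathsf{Mon}(B,A\text{-}\mathsf{Gproj})=\Lambda\text{-}\mathsf{Gproj}=\mathsf{filt}(A\text{-}\mathsf{Gproj}\otimes B\text{-}\mathsf{Gproj}).$$ -/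

import Mathlib

open scoped TensorProduct MulOpposite
open CategoryTheory

universe u

noncomputable section

/-! ### External tensor products of modules -/

section OuterTensor

variable (k : Type u) [Field k]

/-- `X ⊗_k Y`, regarded as a left module over `A ⊗_k B` for `X` a left `A`-module and `Y` a
left `B`-module (a type synonym that carries only this action). -/
def OuterTensor (X Y : Type u) [AddCommGroup X] [Module k X] [AddCommGroup Y] [Module k Y] :
    Type u := X ⊗[k] Y

variable (X Y : Type u) [AddCommGroup X] [Module k X] [AddCommGroup Y] [Module k Y]

instance OuterTensor.instAddCommGroup : AddCommGroup (OuterTensor k X Y) :=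
  inferInstanceAs (AddCommGroup (X ⊗[k] Y))

variable (A B : Type u) [Ring A] [Algebra k A] [Ring B] [Algebra k B]
  [Module A X] [IsScalarTower k A X] [Module B Y] [IsScalarTower k B Y]

/-- The algebra map `A ⊗ B → End_k (X ⊗ Y)`, `a ⊗ b ↦ (x ⊗ y ↦ ax ⊗ by)`. -/
def outerAction : A ⊗[k] B →ₐ[k] Module.End k (X ⊗[k] Y) :=
  (Module.endTensorEndAlgHom (R := k) (S := k) (A := k) (M := X) (N := Y)).comp
    (Algebra.TensorProduct.map (Algebra.lsmul k k X : A →ₐ[k] Module.End k X)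
      (Algebra.lsmul k k Y : B →ₐ[k] Module.End k Y))

instance OuterTensor.instModule : Module (A ⊗[k] B) (OuterTensor k X Y) :=
  Module.compHom (X ⊗[k] Y) (outerAction k X Y A B).toRingHom

theorem OuterTensor.smul_def (r : A ⊗[k] B) (z : OuterTensor k X Y) :
    r • z = outerAction k X Y A B r z := rfl

theorem OuterTensor.tmul_smul_tmul (a : A) (b : B) (x : X) (y : Y) :
    (a ⊗ₜ[k] b) • (show OuterTensor k X Y from x ⊗ₜ[k] y) =
      (show OuterTensor k X Y from (a • x) ⊗ₜ[k] (b • y)) := rfl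

end OuterTensor

/-! ### The `A`-`(A ⊗ B)`-bimodule `A ⊗ V` of a right `B`-module `V`

Right modules over a ring `R` are modules over `Rᵐᵒᵖ`. -/

section BimoduleTensor

variable (k : Type u) [Field k]

/-- `A ⊗_k V` as an `A`-`(A ⊗_k B)`-bimodule, for `V` a right `B`-module. -/
def BimoduleTensor (A V : Type u) [Ring A] [Algebra k A] [AddCommGroup V] [Module k V] :
    Type u := A ⊗[k] V

variable (A B V : Type u) [Ring A] [Algebra k A] [Ring B] [Algebra k B]
  [AddCommGroup V] [Module k V] [Module Bᵐᵒᵖ V] [IsScalarTower k Bᵐᵒᵖ V]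

instance BimoduleTensor.instAddCommGroup : AddCommGroup (BimoduleTensor k A V) :=
  inferInstanceAs (AddCommGroup (A ⊗[k] V))

/-- `A` acts on the left of the first factor. -/
instance BimoduleTensor.instModuleLeft : Module A (BimoduleTensor k A V) :=
  inferInstanceAs (Module A (A ⊗[k] V))

/-- The right action `(a ⊗ v) (a' ⊗ b) = aa' ⊗ vb` of `A ⊗ B`. -/
instance BimoduleTensor.instModuleRight : Module (A ⊗[k] B)ᵐᵒᵖ (BimoduleTensor k A V) :=
  Module.compHom (A ⊗[k] V)
    ((outerAction k A V Aᵐᵒᵖ Bᵐᵒᵖ).comp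
      (Algebra.TensorProduct.opAlgEquiv k k A B).symm.toAlgHom).toRingHom

theorem BimoduleTensor.smul_tmul (a a' : A) (v : V) :
    a' • (show BimoduleTensor k A V from a ⊗ₜ[k] v) =
      (show BimoduleTensor k A V from (a' * a) ⊗ₜ[k] v) := rfl

theorem BimoduleTensor.op_smul_tmul (a a' : A) (b : B) (v : V) :
    MulOpposite.op (a' ⊗ₜ[k] b) • (show BimoduleTensor k A V from a ⊗ₜ[k] v) =
      (show BimoduleTensor k A V from (a * a') ⊗ₜ[k] (MulOpposite.op b • v)) := rfl

instance BimoduleTensor.instSMulCommClass :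
    SMulCommClass A (A ⊗[k] B)ᵐᵒᵖ (BimoduleTensor k A V) where
  smul_comm a r z := by
    induction r using MulOpposite.rec' with
    | h r =>
    induction r using TensorProduct.induction_on with
    | zero => simp
    | add r s hr hs => simp only [MulOpposite.op_add, add_smul, smul_add, hr, hs]
    | tmul a' b =>
      have hzero : a • MulOpposite.op (a' ⊗ₜ[k] b) • (0 : BimoduleTensor k A V) =
          MulOpposite.op (a' ⊗ₜ[k] b) • a • (0 : BimoduleTensor k A V) := by
        simp only [smul_zero]
      have hadd : ∀ x y : BimoduleTensor k A V,
          a • MulOpposite.op (a' ⊗ₜ[k] b) • x = MulOpposite.op (a' ⊗ₜ[k] b) • a • x →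
          a • MulOpposite.op (a' ⊗ₜ[k] b) • y = MulOpposite.op (a' ⊗ₜ[k] b) • a • y →
          a • MulOpposite.op (a' ⊗ₜ[k] b) • (x + y) =
            MulOpposite.op (a' ⊗ₜ[k] b) • a • (x + y) := by
        intro x y hx hy
        simp only [smul_add, hx, hy]
      exact TensorProduct.induction_on
        (motive := fun z : A ⊗[k] V =>
          a • MulOpposite.op (a' ⊗ₜ[k] b) • (show BimoduleTensor k A V from z) =
            MulOpposite.op (a' ⊗ₜ[k] b) • a • (show BimoduleTensor k A V from z))
        z hzero
        (fun x v => congrArg (fun c => (c ⊗ₜ[k] (MulOpposite.op b • v) : A ⊗[k] V))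
          (mul_assoc a x a').symm)
        hadd

end BimoduleTensor

/-! ### The dual of a left module as a right module -/

section RightDual

variable (k : Type u) [Field k]

/-- The `k`-dual `D(S) = Hom_k(S, k)` of a left `B`-module, with its right `B`-action
`(f b)(s) = f (b s)`. -/
def RightDual (S : Type u) [AddCommGroup S] [Module k S] : Type u := S →ₗ[k] k

variable (B S : Type u) [Ring B] [Algebra k B] [AddCommGroup S] [Module k S]

instance RightDual.instAddCommGroup : AddCommGroup (RightDual k S) :=
  inferInstanceAs (AddCommGroup (S →ₗ[k] k))

instance RightDual.instModule : Module k (RightDual k S) :=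
  inferInstanceAs (Module k (S →ₗ[k] k))

/-- An element of `D(S)` as a linear form. -/
def RightDual.eval (f : RightDual k S) : S →ₗ[k] k := f

variable [Module B S] [IsScalarTower k B S]

/-- Right multiplication by `b` on `D(S)`. -/
def RightDual.act (b : B) (f : RightDual k S) : RightDual k S :=
  LinearMap.comp (f.eval k S) (Algebra.lsmul k k S b)

instance RightDual.instModuleRight : Module Bᵐᵒᵖ (RightDual k S) where
  smul b f := RightDual.act k B S b.unop f
  one_smul f := LinearMap.ext fun s => congrArg (f.eval k S) (one_smul B s)
  mul_smul a b f := LinearMap.ext fun s =>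
    congrArg (f.eval k S) (mul_smul b.unop a.unop s)
  smul_zero _ := rfl
  smul_add _ _ _ := rfl
  add_smul a b f := LinearMap.ext fun s =>
    (congrArg (f.eval k S) (add_smul a.unop b.unop s)).trans (map_add (f.eval k S) _ _)
  zero_smul f := LinearMap.ext fun s =>
    (congrArg (f.eval k S) (zero_smul B s)).trans (map_zero (f.eval k S))

theorem RightDual.op_smul_apply (b : B) (f : RightDual k S) (s : S) :
    RightDual.eval k S (MulOpposite.op b • f) s = f.eval k S (b • s) := rfl

instance RightDual.instIsScalarTower : IsScalarTower k Bᵐᵒᵖ (RightDual k S) where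
  smul_assoc c b f := LinearMap.ext fun s =>
    (congrArg (f.eval k S) (smul_assoc c b.unop s)).trans (map_smul (f.eval k S) c _)

end RightDual

/-! ### Tensor product and Tor over a noncommutative ring -/

section BalancedTensor

variable (R L : Type u) [Ring R] [Ring L]
  (M : Type u) [AddCommGroup M] [Module R M] [Module Lᵐᵒᵖ M] [SMulCommClass R Lᵐᵒᵖ M]

/-- The `R`-submodule of `M ⊗_ℤ X` generated by the elements `ml ⊗ x - m ⊗ lx`. -/
def balancedRelations (X : Type u) [AddCommGroup X] [Module L X] : Submodule R (M ⊗[ℤ] X) :=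
  Submodule.span R {z | ∃ (m : M) (l : L) (x : X),
    z = (MulOpposite.op l • m) ⊗ₜ[ℤ] x - m ⊗ₜ[ℤ] (l • x)}

/-- The left `R`-module `M ⊗_L X`, for an `R`-`L`-bimodule `M` and a left `L`-module `X`. -/
abbrev BalancedTensor (X : Type u) [AddCommGroup X] [Module L X] : Type u :=
  (M ⊗[ℤ] X) ⧸ balancedRelations R L M X

/-- The map `M ⊗_L X → M ⊗_L Y` induced by `f : X → Y`. -/
def balancedMap {X Y : Type u} [AddCommGroup X] [Module L X] [AddCommGroup Y] [Module L Y]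
    (f : X →ₗ[L] Y) : BalancedTensor R L M X →ₗ[R] BalancedTensor R L M Y :=
  Submodule.mapQ _ _
    (TensorProduct.AlgebraTensorModule.lTensor R M (f.toAddMonoidHom.toIntLinearMap)) (by
      rw [balancedRelations, Submodule.span_le]
      rintro _ ⟨m, l, x, rfl⟩
      refine Submodule.subset_span ⟨m, l, f x, ?_⟩
      simp)

theorem balancedMap_ext {X Y : Type u} [AddCommGroup X] [Module L X] [AddCommGroup Y]
    [Module R Y] {f g : BalancedTensor R L M X →ₗ[R] Y}
    (h : ∀ (m : M) (x : X), f (Submodule.Quotient.mk (m ⊗ₜ[ℤ] x)) =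
      g (Submodule.Quotient.mk (m ⊗ₜ[ℤ] x))) : f = g := by
  refine LinearMap.ext fun z => ?_
  obtain ⟨z, rfl⟩ := Submodule.Quotient.mk_surjective _ z
  induction z using TensorProduct.induction_on with
  | zero => simp
  | tmul m x => exact h m x
  | add a b ha hb => rw [Submodule.Quotient.mk_add, map_add, map_add, ha, hb]

/-- The functor `M ⊗_L - : L-Mod ⥤ R-Mod`. -/
def balancedTensorFunctor : ModuleCat.{u} L ⥤ ModuleCat.{u} R where
  obj X := ModuleCat.of R (BalancedTensor R L M X)
  map f := ModuleCat.ofHom (balancedMap R L M f.hom)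
  map_id _ := ModuleCat.hom_ext (balancedMap_ext R L M fun _ _ => rfl)
  map_comp _ _ := ModuleCat.hom_ext (balancedMap_ext R L M fun _ _ => rfl)

instance balancedTensorFunctor.instAdditive : (balancedTensorFunctor R L M).Additive where
  map_add {_ Y f g} := ModuleCat.hom_ext (balancedMap_ext R L M fun m x =>
    congrArg (Submodule.Quotient.mk (p := balancedRelations R L M Y))
      (TensorProduct.tmul_add m (f.hom x) (g.hom x)))

/-- `Tor_i^L(M, X)`, as a left `R`-module: the value at `X` of the `i`-th left derived functor
of `M ⊗_L -`. -/
def balancedTor (i : ℕ) (X : ModuleCat.{u} L) : ModuleCat.{u} R :=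
  ((balancedTensorFunctor R L M).leftDerived i).obj X

end BalancedTensor

/-! ### Gorenstein projective modules -/

section Gorenstein

/-- A complete projective resolution of a left `R`-module `G`: an exact complex of finitely
generated projective modules with `G = ker d¹` that stays exact under `Hom_R(-, R)`. -/
structure CompleteProjectiveResolution (R : Type u) [Ring R]
    (G : Type u) [AddCommGroup G] [Module R G] where
  P : ℤ → ModuleCat.{u} R
  finite : ∀ i, Module.Finite R (P i)
  projective : ∀ i, Module.Projective R (P i)
  d : ∀ i, P i →ₗ[R] P (i + 1)
  exact : ∀ i, Function.Exact (d i) (d (i + 1))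
  exact_dual : ∀ i, Function.Exact
    (fun f : P (i + 1 + 1) →ₗ[R] R => f ∘ₗ d (i + 1))
    (fun f : P (i + 1) →ₗ[R] R => f ∘ₗ d i)
  kerEquiv : G ≃ₗ[R] LinearMap.ker (d 1)

/-- The finitely generated Gorenstein projective left `R`-modules, `R`-Gproj. -/
def Gproj (R : Type u) [Ring R] : ObjectProperty (ModuleCat.{u} R) := fun G =>
  Module.Finite R G ∧ Nonempty (CompleteProjectiveResolution R G)

end Gorenstein

/-! ### Monomorphism categories -/

section Mon

variable (k : Type u) [Field k] (B A : Type u) [Ring B] [Algebra k B] [Ring A] [Algebra k A]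

/-- `Mon(B, A)`: the finitely generated left `A ⊗ B`-modules `X` with
`Tor_i(A ⊗ D(S), X) = 0` over `A ⊗ B`, for all `i ≥ 1` and all simple left `B`-modules `S`. -/
def MonRep : ObjectProperty (ModuleCat.{u} (A ⊗[k] B)) := fun X =>
  Module.Finite (A ⊗[k] B) X ∧
  ∀ (S : Type u) [AddCommGroup S] [Module k S] [Module B S] [IsScalarTower k B S],
    IsSimpleModule B S → ∀ i : ℕ, 1 ≤ i →
      Subsingleton (balancedTor A (A ⊗[k] B) (BimoduleTensor k A (RightDual k S)) i X)

/-- `Mon(B, 𝓛)`: the modules `X` in `Mon(B, A)` with `(A ⊗ V) ⊗ X ∈ 𝓛` (tensor product over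
`A ⊗ B`) for all finitely generated right `B`-modules `V`. -/
def MonRepIn (𝓛 : ObjectProperty (ModuleCat.{u} A)) : ObjectProperty (ModuleCat.{u} (A ⊗[k] B)) :=
  fun X => MonRep k B A X ∧
  ∀ (V : Type u) [AddCommGroup V] [Module k V] [Module Bᵐᵒᵖ V] [IsScalarTower k Bᵐᵒᵖ V],
    Module.Finite Bᵐᵒᵖ V →
      𝓛 ((balancedTensorFunctor A (A ⊗[k] B) (BimoduleTensor k A V)).obj X)

end Mon

/-! ### Filtration categories -/

section Filt

/-- `filt(𝓧)`: the finitely generated modules `X` with a finite filtration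
`0 = X₀ ⊆ X₁ ⊆ ⋯ ⊆ Xₘ = X` whose factors `Xᵢ₊₁ / Xᵢ` all lie in `𝓧`. -/
def filt {R : Type u} [Ring R] (𝓧 : ObjectProperty (ModuleCat.{u} R)) :
    ObjectProperty (ModuleCat.{u} R) := fun X =>
  Module.Finite R X ∧ ∃ (m : ℕ) (F : ℕ → Submodule R X), F 0 = ⊥ ∧ F m = ⊤ ∧
    ∀ i < m, F i ≤ F (i + 1) ∧
      𝓧 (ModuleCat.of R (F (i + 1) ⧸ (F i).submoduleOf (F (i + 1))))

/-- `𝓧 ⊗ 𝓨`: the left `A ⊗ B`-modules isomorphic to `X ⊗ Y` with `X ∈ 𝓧` and `Y ∈ 𝓨`. -/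
def outerTensorClass (k : Type u) [Field k] {A B : Type u} [Ring A] [Algebra k A]
    [Ring B] [Algebra k B] (𝓧 : ObjectProperty (ModuleCat.{u} A))
    (𝓨 : ObjectProperty (ModuleCat.{u} B)) : ObjectProperty (ModuleCat.{u} (A ⊗[k] B)) :=
  fun Z =>
    ∃ (X : Type u) (_ : AddCommGroup X) (_ : Module k X) (_ : Module A X)
      (_ : IsScalarTower k A X)
      (Y : Type u) (_ : AddCommGroup Y) (_ : Module k Y) (_ : Module B Y)
      (_ : IsScalarTower k B Y),
      𝓧 (ModuleCat.of A X) ∧ 𝓨 (ModuleCat.of B Y) ∧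
        Nonempty (Z ≃ₗ[A ⊗[k] B] OuterTensor k X Y)

end Filt

/-! ### Splitting fields and triangular algebras -/

section Triangular

/-- `k` is a splitting field for `B`: every simple left `B`-module has endomorphism
algebra `k`. -/
def IsSplittingFieldFor (k : Type u) [Field k] (B : Type u) [Ring B] [Algebra k B] : Prop :=
  ∀ (S : Type u) [AddCommGroup S] [Module k S] [Module B S] [IsScalarTower k B S],
    IsSimpleModule B S → Function.Bijective (algebraMap k (Module.End B S))

/-- There is an arrow from `S` to `T` in the Ext-quiver of `B`: both modules are simple and
`Ext¹_B(S, T) ≠ 0`. -/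
def ExtArrow (B : Type u) [Ring B] (S T : ModuleCat.{u} B) : Prop :=
  IsSimpleModule B S ∧ IsSimpleModule B T ∧ Nontrivial (Abelian.Ext.{u} S T 1)

/-- `B` is triangular: its Ext-quiver has no oriented cycles (loops count as cycles). The vertices
of that quiver are the isomorphism classes of simple modules; as `Ext¹` only depends on these
classes, oriented cycles may be spelled out with the modules themselves. -/
def IsTriangularAlgebra (B : Type u) [Ring B] : Prop :=
  ∀ S : ModuleCat.{u} B, ¬ Relation.TransGen (ExtArrow B) S S

end Triangular

end

/-! Triangularity and the splitting hypothesis give ordered idempotents e_0, …, e_{n-1} that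
generate B as a two-sided ideal, with e_i B e_i = k e_i and e_i B e_j = 0 for i < j
(`exists_isTriangularFamily`). Everything later uses B only through such a family. It bounds the
projective dimension of every B-module by n, and in a class closed under cosyzygies a uniform bound
forces projectivity (`projective_of_forall_embedding`). Hence Gorenstein projective B-modules are
projective, and Gorenstein projective Λ-modules are projective over B.

The equalities follow from the cycle Mon ⊆ filt ⊆ Λ-Gproj ⊆ Mon.

filt ⊆ Λ-Gproj: for N projective over B, tensoring with N carries complete resolutions over A to
complete resolutions over Λ (`gproj_outerTensor`), and Gorenstein projectives are closed under
extensions (`gproj_of_extension`).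

Λ-Gproj ⊆ Mon: since X is B-projective, its Λ-projective resolutions split over B, which kills Tor.
The functor (A ⊗ V) ⊗_Λ −, in effect V ⊗_B −, keeps complete resolutions exact for the same reason.
Their A-duals stay exact because Hom_A(V ⊗_B X, A) = Hom_Λ(X, A ⊗ D(V)) and D(V) has finite
projective dimension (`exists_extend_outerTensor`).

Mon ⊆ filt: Tor_1(A ⊗ D(S), X) is dual to Ext¹_B(X, S), so X is B-projective
(`projective_right_of_monRep`). Let I_j be the ideal generated by e_0, …, e_{j-1}. The submodules
I_j X filter X, and projectivity identifies the factors with e_j(X/I_j X) ⊗ B e_j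
(`stage_factor_mem`). The left factor is (A ⊗ e_j(B/I_j)) ⊗_Λ X, Gorenstein projective by the
definition of Mon.

Complexes are mostly avoided: a class is shown to be Gorenstein projective by extending it one short
exact sequence at a time in both directions (`GorensteinStable.le_gproj`). -/

noncomputable section

/-! ### Gorenstein projectives through single short exact sequences; closure under extensions -/

section ProjectiveSteps

variable {R : Type u} [Ring R]

theorem exists_comp_eq_of_ker_le {M N W : Type*} [AddCommGroup M] [Module R M] [AddCommGroup N]
    [Module R N] [AddCommGroup W] [Module R W] {p : M →ₗ[R] N} (hp : Function.Surjective p)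
    {f : M →ₗ[R] W} (h : ∀ m, p m = 0 → f m = 0) : ∃ g : N →ₗ[R] W, g ∘ₗ p = f := by
  refine ⟨(LinearMap.ker p).liftQ f h ∘ₗ (p.quotKerEquivOfSurjective hp).symm.toLinearMap, ?_⟩
  ext y
  have : (p.quotKerEquivOfSurjective hp).symm (p y) = Submodule.Quotient.mk y := by
    rw [LinearEquiv.symm_apply_eq]; rfl
  simpa [this] using Submodule.liftQ_apply _ _ _

/-- A short exact sequence `0 → X → P → Y → 0` with `P` finitely generated projective that stays
exact under `Hom_R(-, R)`. -/
structure IsProjStep {X P Y : Type u} [AddCommGroup X] [Module R X] [AddCommGroup P] [Module R P]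
    [AddCommGroup Y] [Module R Y] (i : X →ₗ[R] P) (p : P →ₗ[R] Y) : Prop where
  finite : Module.Finite R P
  projective : Module.Projective R P
  injective : Function.Injective i
  exact : Function.Exact i p
  surjective : Function.Surjective p
  extend : ∀ f : X →ₗ[R] R, ∃ g : P →ₗ[R] R, g ∘ₗ i = f

/-- `X` is the kernel and `Y` the cokernel of some projective step. -/
def ProjStep (X Y : ModuleCat.{u} R) : Prop :=
  ∃ (P : ModuleCat.{u} R) (i : X →ₗ[R] P) (p : P →ₗ[R] Y), IsProjStep i p

/-- A class of finitely generated modules in which projective steps can be continued forever in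
both directions. -/
structure GorensteinStable (𝒢 : ObjectProperty (ModuleCat.{u} R)) : Prop where
  finite : ∀ X, 𝒢 X → Module.Finite R X
  next : ∀ X, 𝒢 X → ∃ Y, 𝒢 Y ∧ ProjStep X Y
  prev : ∀ Y, 𝒢 Y → ∃ X, 𝒢 X ∧ ProjStep X Y

theorem GorensteinStable.exists_chain {𝒢 : ObjectProperty (ModuleCat.{u} R)}
    (h : GorensteinStable 𝒢) {X : ModuleCat.{u} R} (hX : 𝒢 X) :
    ∃ Z : ℤ → ModuleCat.{u} R, Z 1 = X ∧ ∀ i, ProjStep (Z i) (Z (i + 1)) := by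
  choose next hnext using h.next
  choose prev hprev using h.prev
  let S := {X : ModuleCat.{u} R // 𝒢 X}
  let fw : ℕ → S := fun n => Nat.rec ⟨X, hX⟩ (fun _ s => ⟨next s.1 s.2, (hnext s.1 s.2).1⟩) n
  let bw : ℕ → S := fun n => Nat.rec ⟨X, hX⟩ (fun _ s => ⟨prev s.1 s.2, (hprev s.1 s.2).1⟩) n
  -- `Int.negSucc n` is -(n+1), hence `bw (n + 1)`.
  let Z : ℤ → ModuleCat.{u} R := fun i => Int.casesOn i (fun n => (fw n).1) (fun n => (bw (n + 1)).1)
  have hZ : ∀ i, ProjStep (Z i) (Z (i + 1)) := by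
    rintro (n | n)
    · exact (hnext (fw n).1 (fw n).2).2
    · cases n with
      | zero => exact (hprev (bw 0).1 (bw 0).2).2
      | succ n => exact (hprev (bw (n + 1)).1 (bw (n + 1)).2).2
  -- The shift puts X at index 1, as `kerEquiv` asks for the kernel of `d 1`.
  refine ⟨fun i => Z (i - 1), rfl, fun i => ?_⟩
  have := hZ (i - 1)
  rwa [show i - 1 + 1 = i + 1 - 1 by ring] at this

/-- The steps are spliced: P j → Z (j + 1) → P (j + 1) is the differential, so the kernel of `d 1`
is the image of Z 1 = X. -/
theorem GorensteinStable.le_gproj {𝒢 : ObjectProperty (ModuleCat.{u} R)}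
    (h : GorensteinStable 𝒢) : 𝒢 ≤ Gproj R := by
  intro X hX
  refine ⟨h.finite X hX, ?_⟩
  obtain ⟨Z, hZ, hstep⟩ := h.exists_chain hX
  choose P i p hip using hstep
  refine ⟨{
    P := P
    finite := fun j => (hip j).finite
    projective := fun j => (hip j).projective
    d := fun j => i (j + 1) ∘ₗ p j
    exact := fun j => ?_
    exact_dual := fun j => ?_
    kerEquiv := ?_ }⟩
  · intro y
    constructor
    · intro hy
      have : p (j + 1) y = 0 := (hip (j + 1 + 1)).injective (by simpa using hy)
      obtain ⟨z, hz⟩ := ((hip (j + 1)).exact y).1 this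
      obtain ⟨w, rfl⟩ := (hip j).surjective z
      exact ⟨w, hz⟩
    · rintro ⟨w, rfl⟩
      have := ((hip (j + 1)).exact (i (j + 1) (p j w))).2 ⟨_, rfl⟩
      simp [this]
  · intro f
    constructor
    · intro hf
      -- P j maps onto Z (j + 1), so a dual cocycle vanishes there, descends to Z (j + 2), and
      -- extends from it to P (j + 2).
      have hfi : f ∘ₗ i (j + 1) = 0 := by
        ext z
        obtain ⟨w, rfl⟩ := (hip j).surjective z
        exact LinearMap.congr_fun hf w
      obtain ⟨s, hs⟩ : ∃ s : Z (j + 1 + 1) →ₗ[R] R, s ∘ₗ p (j + 1) = f := by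
        refine exists_comp_eq_of_ker_le (hip (j + 1)).surjective fun y hy => ?_
        obtain ⟨z, rfl⟩ := ((hip (j + 1)).exact y).1 hy
        exact LinearMap.congr_fun hfi z
      obtain ⟨g, hg⟩ := (hip (j + 1 + 1)).extend s
      exact ⟨g, by
        change g ∘ₗ (i (j + 1 + 1) ∘ₗ p (j + 1)) = f
        rw [← LinearMap.comp_assoc, hg, hs]⟩
    · rintro ⟨g, rfl⟩
      ext w
      have := ((hip (j + 1)).exact (i (j + 1) (p j w))).2 ⟨_, rfl⟩
      simp [this]
  · have hker : LinearMap.ker (i (1 + 1) ∘ₗ p 1) = LinearMap.range (i 1) := by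
      ext y
      have h1 : p 1 y = 0 ↔ y ∈ Set.range (i 1) := (hip 1).exact y
      have h2 : i (1 + 1) (p 1 y) = 0 ↔ p 1 y = 0 :=
        map_eq_zero_iff (i (1 + 1)) (hip (1 + 1)).injective
      simp only [LinearMap.mem_ker, LinearMap.comp_apply, LinearMap.mem_range]
      exact h2.trans h1
    subst hZ
    exact (LinearEquiv.ofInjective (i 1) (hip 1).injective).trans (LinearEquiv.ofEq _ _ hker.symm)

/-- The kernels of the differentials of complete projective resolutions. -/
def IsCompleteKernel (X : ModuleCat.{u} R) : Prop :=
  ∃ (G : ModuleCat.{u} R) (C : CompleteProjectiveResolution R G) (j : ℤ),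
    Nonempty (X ≃ₗ[R] LinearMap.ker (C.d j))

/-- This is the converse of splicing: a complete resolution breaks up into projective steps between
consecutive kernels. -/
theorem CompleteProjectiveResolution.projStep {G : Type u} [AddCommGroup G] [Module R G]
    (C : CompleteProjectiveResolution R G) (j : ℤ) {X Y : ModuleCat.{u} R}
    (eX : X ≃ₗ[R] LinearMap.ker (C.d j)) (eY : Y ≃ₗ[R] LinearMap.ker (C.d (j + 1))) :
    ProjStep X Y := by
  have hd : ∀ (j : ℤ) y, C.d (j + 1) (C.d j y) = 0 := fun j y => (C.exact j _).2 ⟨y, rfl⟩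
  have hmem : ∀ y, C.d j y ∈ LinearMap.ker (C.d (j + 1)) := hd j
  refine ⟨C.P j, (LinearMap.ker (C.d j)).subtype ∘ₗ eX.toLinearMap,
    eY.symm.toLinearMap ∘ₗ (C.d j).codRestrict _ hmem, C.finite j, C.projective j,
    (Submodule.injective_subtype _).comp eX.injective, ?_, ?_, ?_⟩
  · intro y
    constructor
    · intro hy
      have h0 : (C.d j).codRestrict _ hmem y = 0 := by simpa using hy
      have h1 : C.d j y = 0 := congrArg Subtype.val h0
      exact ⟨eX.symm ⟨y, h1⟩, by simp⟩
    · rintro ⟨x, rfl⟩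
      have h1 : C.d j (eX x : C.P j) = 0 := (eX x).2
      have h0 : (C.d j).codRestrict _ hmem (eX x : C.P j) = 0 := Subtype.ext h1
      simp [h0]
  · refine eY.symm.surjective.comp ?_
    rintro ⟨y, hy⟩
    obtain ⟨x, rfl⟩ := (C.exact j y).1 hy
    exact ⟨x, rfl⟩
  · intro f
    -- Pulled back along P (j - 1) → ker (d j), a form on the kernel becomes a dual cocycle, and
    -- dual exactness provides its extension to P j. Being a cocycle refers to P (j - 2), hence the
    -- two spare degrees.
    obtain ⟨l, rfl⟩ : ∃ l : ℤ, j = l + 1 + 1 := ⟨j - 2, by ring⟩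
    have hmem' : ∀ y, C.d (l + 1) y ∈ LinearMap.ker (C.d (l + 1 + 1)) := hd (l + 1)
    let t : C.P (l + 1) →ₗ[R] R :=
      f ∘ₗ eX.symm.toLinearMap ∘ₗ (C.d (l + 1)).codRestrict _ hmem'
    have ht : t ∘ₗ C.d l = 0 := by
      ext w
      have : (C.d (l + 1)).codRestrict _ hmem' (C.d l w) = 0 := Subtype.ext (hd l w)
      simp [t, this]
    obtain ⟨g, hg⟩ := (C.exact_dual l t).1 ht
    refine ⟨g, ?_⟩
    ext x
    obtain ⟨w, hw⟩ := (C.exact (l + 1) (eX x : C.P (l + 1 + 1))).1 (eX x).2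
    have h1 : g (C.d (l + 1) w) = t w := LinearMap.congr_fun hg w
    have h2 : (C.d (l + 1)).codRestrict _ hmem' w = eX x := Subtype.ext hw
    calc g (eX x : C.P (l + 1 + 1)) = t w := by rw [← hw, h1]
      _ = f x := by simp [t, h2]

theorem gorensteinStable_isCompleteKernel :
    GorensteinStable (R := R) (fun X => IsCompleteKernel X) where
  finite := by
    rintro X ⟨G, C, j, ⟨e⟩⟩
    obtain ⟨l, rfl⟩ : ∃ l : ℤ, j = l + 1 := ⟨j - 1, by ring⟩
    have hmem : ∀ y, C.d l y ∈ LinearMap.ker (C.d (l + 1)) := fun y => (C.exact l _).2 ⟨y, rfl⟩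
    have := C.finite l
    refine Module.Finite.of_surjective (e.symm.toLinearMap ∘ₗ (C.d l).codRestrict _ hmem)
      (e.symm.surjective.comp ?_)
    rintro ⟨y, hy⟩
    obtain ⟨x, rfl⟩ := (C.exact l y).1 hy
    exact ⟨x, rfl⟩
  next := by
    rintro X ⟨G, C, j, ⟨e⟩⟩
    exact ⟨ModuleCat.of R (LinearMap.ker (C.d (j + 1))), ⟨G, C, j + 1, ⟨LinearEquiv.refl _ _⟩⟩,
      C.projStep j e (LinearEquiv.refl _ _)⟩
  prev := by
    rintro X ⟨G, C, j, ⟨e⟩⟩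
    obtain ⟨l, rfl⟩ : ∃ l : ℤ, j = l + 1 := ⟨j - 1, by ring⟩
    exact ⟨ModuleCat.of R (LinearMap.ker (C.d l)), ⟨G, C, l, ⟨LinearEquiv.refl _ _⟩⟩,
      C.projStep l (LinearEquiv.refl _ _) e⟩

theorem gproj_iff_isCompleteKernel (X : ModuleCat.{u} R) : Gproj R X ↔ IsCompleteKernel X :=
  ⟨fun ⟨_, ⟨C⟩⟩ => ⟨X, C, 1, ⟨C.kerEquiv⟩⟩,
    fun h => gorensteinStable_isCompleteKernel.le_gproj X h⟩

theorem gorensteinStable_gproj : GorensteinStable (Gproj R) := by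
  have : Gproj R = fun X => IsCompleteKernel X := funext fun X =>
    propext (gproj_iff_isCompleteKernel X)
  rw [this]
  exact gorensteinStable_isCompleteKernel

theorem gproj_of_linearEquiv {X Y : ModuleCat.{u} R} (e : X ≃ₗ[R] Y) (hX : Gproj R X) :
    Gproj R Y :=
  ⟨have := hX.1; Module.Finite.equiv e, hX.2.map fun C => { C with kerEquiv := e.symm.trans C.kerEquiv }⟩

/-- Maps along `i` into `R` extend, hence so do maps into finitely generated projectives. -/
theorem exists_extend_of_projective {X P W : Type u} [AddCommGroup X] [Module R X]
    [AddCommGroup P] [Module R P] [AddCommGroup W] [Module R W] [Module.Finite R W]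
    [Module.Projective R W] {i : X →ₗ[R] P}
    (hi : ∀ f : X →ₗ[R] R, ∃ g : P →ₗ[R] R, g ∘ₗ i = f) (f : X →ₗ[R] W) :
    ∃ g : P →ₗ[R] W, g ∘ₗ i = f := by
  obtain ⟨n, r, s, hr, -, hrs⟩ := Module.Finite.exists_comp_eq_id_of_projective R W
  choose g hg using fun c => hi (LinearMap.proj c ∘ₗ s ∘ₗ f)
  refine ⟨r ∘ₗ LinearMap.pi g, ?_⟩
  have : LinearMap.pi g ∘ₗ i = s ∘ₗ f := by
    ext x c
    exact LinearMap.congr_fun (hg c) x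
  rw [LinearMap.comp_assoc, this, ← LinearMap.comp_assoc, hrs, LinearMap.id_comp]

/-- A short exact sequence `0 → X → E → Y → 0` stays exact under `Hom(-, W)` for `W` finitely
generated projective if `Y` ends a projective step. -/
theorem exists_extend_of_projStep {X E Z Y W : Type u} [AddCommGroup X] [Module R X]
    [AddCommGroup E] [Module R E] [AddCommGroup Z] [Module R Z] [AddCommGroup Y] [Module R Y]
    [AddCommGroup W] [Module R W] {Q : Type u} [AddCommGroup Q] [Module R Q]
    {a : X →ₗ[R] E} {b : E →ₗ[R] Y} {j : Z →ₗ[R] Q} {q : Q →ₗ[R] Y}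
    (ha : Function.Injective a) (hab : Function.Exact a b) (hb : Function.Surjective b)
    [Module.Projective R Q] (hjq : Function.Exact j q) (hq : Function.Surjective q)
    (hW : ∀ f : Z →ₗ[R] W, ∃ g : Q →ₗ[R] W, g ∘ₗ j = f) (f : X →ₗ[R] W) :
    ∃ g : E →ₗ[R] W, g ∘ₗ a = f := by
  -- The lift t exhibits E as the pushout of j : Z → Q along the induced w : Z → X. A map out of E
  -- is then a pair f, v agreeing on Z.
  obtain ⟨t, ht⟩ := Module.projective_lifting_property b q hb
  have ht' : ∀ z, b (t z) = q z := LinearMap.congr_fun ht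
  have hmem : ∀ z, t (j z) ∈ LinearMap.range a := fun z => (hab _).1 (by
    rw [ht']; exact (hjq _).2 ⟨z, rfl⟩)
  let w : Z →ₗ[R] X := (LinearEquiv.ofInjective a ha).symm.toLinearMap ∘ₗ
    (t ∘ₗ j).codRestrict (LinearMap.range a) hmem
  have hw : ∀ z, a (w z) = t (j z) := fun z =>
    congrArg Subtype.val ((LinearEquiv.ofInjective a ha).apply_symm_apply ⟨t (j z), hmem z⟩)
  obtain ⟨v, hv⟩ := hW (f ∘ₗ w)
  have hv' : ∀ z, v (j z) = f (w z) := LinearMap.congr_fun hv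
  have hsurj : Function.Surjective (a.coprod t) := by
    intro e
    obtain ⟨y, hy⟩ := hq (b e)
    obtain ⟨x, hx⟩ := (hab (e - t y)).1 (by rw [map_sub, ht', hy, sub_self])
    exact ⟨(x, y), by simp [hx]⟩
  obtain ⟨g, hg⟩ := exists_comp_eq_of_ker_le (f := f.coprod v) hsurj (by
    rintro ⟨x, y⟩ h
    simp only [LinearMap.coprod_apply] at h ⊢
    have h1 : q y = 0 := by
      have := congrArg b h
      rwa [map_add, (hab _).2 ⟨x, rfl⟩, zero_add, ht', map_zero] at this
    obtain ⟨z, rfl⟩ := (hjq y).1 h1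
    rw [← hw, ← map_add] at h
    have h2 := ha (h.trans (map_zero a).symm)
    rw [hv', ← map_add, h2, map_zero])
  refine ⟨g, ?_⟩
  ext x
  simpa using LinearMap.congr_fun hg (x, 0)

/-- `E` is an extension of two Gorenstein projective modules. -/
def IsGprojExtension (E : ModuleCat.{u} R) : Prop :=
  ∃ (X Y : ModuleCat.{u} R) (a : X →ₗ[R] E) (b : E →ₗ[R] Y), Gproj R X ∧ Gproj R Y ∧
    Function.Injective a ∧ Function.Exact a b ∧ Function.Surjective b

/-- Horseshoe lemma: P covers X, Q covers Y, and a lift of Q → Y to E makes P × Q cover E, with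
kernel an extension of Y' by X'. A form on that kernel is extended first from X' to P; the remainder
factors through Y' and extends to Q. -/
theorem IsGprojExtension.exists_prev {E : ModuleCat.{u} R} (h : IsGprojExtension E) :
    Module.Finite R E ∧ ∃ D : ModuleCat.{u} R, IsGprojExtension D ∧ ProjStep D E := by
  obtain ⟨X, Y, a, b, hX, hY, ha, hab, hb⟩ := h
  obtain ⟨X', hX', P, i, p, hip⟩ := gorensteinStable_gproj.prev X hX
  obtain ⟨Y', hY', Q, j, q, hjq⟩ := gorensteinStable_gproj.prev Y hY
  have := hip.projective
  have := hjq.projective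
  have := hip.finite
  have := hjq.finite
  obtain ⟨t, ht⟩ := Module.projective_lifting_property b q hb
  have ht' : ∀ z, b (t z) = q z := LinearMap.congr_fun ht
  let π : (P × Q) →ₗ[R] E := (a ∘ₗ p).coprod t
  have hπ : Function.Surjective π := by
    intro e
    obtain ⟨y, hy⟩ := hjq.surjective (b e)
    obtain ⟨x, hx⟩ := (hab (e - t y)).1 (by rw [map_sub, ht', hy, sub_self])
    obtain ⟨z, rfl⟩ := hip.surjective x
    exact ⟨(z, y), by simp [π, hx]⟩
  have hbπ : ∀ z, b (π z) = q z.2 := fun z => by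
    simp [π, ht', (hab _).2 ⟨p z.1, rfl⟩]
  have hmem : ∀ z : LinearMap.ker π, (z : P × Q).2 ∈ LinearMap.range j := fun z =>
    (hjq.exact _).1 (by rw [← hbπ, z.2, map_zero])
  let a' : X' →ₗ[R] LinearMap.ker π := (LinearMap.inl R P Q ∘ₗ i).codRestrict _ fun x => by
    have : p (i x) = 0 := (hip.exact _).2 ⟨x, rfl⟩
    simp [π, this]
  let b' : LinearMap.ker π →ₗ[R] Y' :=
    (LinearEquiv.ofInjective j hjq.injective).symm.toLinearMap ∘ₗ
      (LinearMap.snd R P Q ∘ₗ (LinearMap.ker π).subtype).codRestrict _ hmem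
  have hb' : ∀ z, j (b' z) = (z : P × Q).2 := fun z => congrArg Subtype.val
    ((LinearEquiv.ofInjective j hjq.injective).apply_symm_apply ⟨(z : P × Q).2, hmem z⟩)
  have ha' : ∀ x, (a' x : P × Q) = (i x, 0) := fun x => rfl
  have hinj : Function.Injective a' := fun x y hxy => hip.injective
    (congrArg Prod.fst (congrArg Subtype.val hxy))
  have hex : Function.Exact a' b' := by
    intro z
    constructor
    · intro hz
      have h2 : (z : P × Q).2 = 0 := by rw [← hb', hz, map_zero]
      have h1 : a (p (z : P × Q).1) = 0 := by
        have h3 : a (p (z : P × Q).1) + t (z : P × Q).2 = 0 := z.2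
        rwa [h2, map_zero, add_zero] at h3
      obtain ⟨x, hx⟩ := (hip.exact _).1 (ha (h1.trans (map_zero a).symm))
      exact ⟨x, Subtype.ext (Prod.ext hx h2.symm)⟩
    · rintro ⟨x, rfl⟩
      exact hjq.injective (by rw [hb', ha', map_zero])
  have hsurj : Function.Surjective b' := by
    intro y
    have h0 : b (t (j y)) = 0 := by rw [ht']; exact (hjq.exact _).2 ⟨y, rfl⟩
    obtain ⟨x, hx⟩ := (hab _).1 h0
    obtain ⟨z, rfl⟩ := hip.surjective x
    exact ⟨⟨(-z, j y), by simp [π, hx]⟩, hjq.injective (hb' _)⟩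
  refine ⟨Module.Finite.of_surjective π hπ, ModuleCat.of R (LinearMap.ker π),
    ⟨X', Y', a', b', hX', hY', hinj, hex, hsurj⟩,
    ModuleCat.of R (P × Q), (LinearMap.ker π).subtype, π, inferInstanceAs (Module.Finite R (P × Q)),
    inferInstanceAs (Module.Projective R (P × Q)), Submodule.injective_subtype _,
    LinearMap.exact_subtype_ker_map π, hπ, fun f => ?_⟩
  obtain ⟨g₁, hg₁⟩ := hip.extend (f ∘ₗ a')
  obtain ⟨s, hs⟩ := exists_comp_eq_of_ker_le
    (f := f - g₁ ∘ₗ LinearMap.fst R P Q ∘ₗ (LinearMap.ker π).subtype) hsurj (by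
      intro z hz
      obtain ⟨x, rfl⟩ := (hex z).1 hz
      have : g₁ (i x) = f (a' x) := LinearMap.congr_fun hg₁ x
      simp [ha', this])
  obtain ⟨g₂, hg₂⟩ := hjq.extend s
  refine ⟨g₁.coprod g₂, ?_⟩
  ext z
  have h1 : g₂ (j (b' z)) = s (b' z) := LinearMap.congr_fun hg₂ _
  have h2 : s (b' z) = f z - g₁ (z : P × Q).1 := LinearMap.congr_fun hs z
  have h3 : g₂ (z : P × Q).2 = f z - g₁ (z : P × Q).1 := by rw [← hb', h1, h2]
  change g₁ (z : P × Q).1 + g₂ (z : P × Q).2 = f z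
  rw [h3, add_sub_cancel]

/-- Dual horseshoe. Embedding E into P × Q requires X → P to extend to E. This would follow from
Ext¹(Y, P) = 0; here it comes from a projective step ending in Y, the reason for a third step
besides the two continuing X and Y. -/
theorem IsGprojExtension.exists_next {E : ModuleCat.{u} R} (h : IsGprojExtension E) :
    ∃ D : ModuleCat.{u} R, IsGprojExtension D ∧ ProjStep E D := by
  obtain ⟨X, Y, a, b, hX, hY, ha, hab, hb⟩ := h
  obtain ⟨X', hX', P, i, p, hip⟩ := gorensteinStable_gproj.next X hX
  obtain ⟨Y', hY', Q, j, q, hjq⟩ := gorensteinStable_gproj.next Y hY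
  obtain ⟨Y₀, hY₀, Q₀, j₀, q₀, hjq₀⟩ := gorensteinStable_gproj.prev Y hY
  have := hip.projective
  have := hjq.projective
  have := hip.finite
  have := hjq.finite
  have := hjq₀.projective
  obtain ⟨v, hv⟩ := exists_extend_of_projStep ha hab hb hjq₀.exact hjq₀.surjective
    (exists_extend_of_projective hjq₀.extend) i
  have hv' : ∀ x, v (a x) = i x := LinearMap.congr_fun hv
  let ι : E →ₗ[R] (P × Q) := v.prod (j ∘ₗ b)
  have hι : Function.Injective ι := by
    refine (injective_iff_map_eq_zero ι).2 fun e he => ?_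
    have h2 : j (b e) = 0 := congrArg Prod.snd he
    have h1 : v e = 0 := congrArg Prod.fst he
    obtain ⟨x, rfl⟩ := (hab e).1 (hjq.injective (h2.trans (map_zero j).symm))
    rw [hv'] at h1
    rw [hip.injective (h1.trans (map_zero i).symm), map_zero]
  let D := (P × Q) ⧸ LinearMap.range ι
  let π : (P × Q) →ₗ[R] D := (LinearMap.range ι).mkQ
  have hπ0 : ∀ z, π z = 0 ↔ z ∈ LinearMap.range ι := fun z => Submodule.Quotient.mk_eq_zero _
  have hπ : Function.Surjective π := Submodule.mkQ_surjective _
  obtain ⟨a', ha'⟩ := exists_comp_eq_of_ker_le (f := π ∘ₗ LinearMap.inl R P Q) hip.surjective (by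
    intro z hz
    obtain ⟨x, rfl⟩ := (hip.exact z).1 hz
    exact (hπ0 _).2 ⟨a x, Prod.ext (hv' x) (by simp [ι, (hab _).2 ⟨x, rfl⟩])⟩)
  have ha'' : ∀ z, a' (p z) = π (z, 0) := LinearMap.congr_fun ha'
  obtain ⟨b', hb'⟩ := exists_comp_eq_of_ker_le (f := q ∘ₗ LinearMap.snd R P Q) hπ (by
    intro z hz
    obtain ⟨e, rfl⟩ := (hπ0 z).1 hz
    exact (hjq.exact _).2 ⟨b e, rfl⟩)
  have hb'' : ∀ z, b' (π z) = q z.2 := LinearMap.congr_fun hb'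
  refine ⟨ModuleCat.of R D, ⟨X', Y', a', b', hX', hY', ?_, ?_, ?_⟩, ModuleCat.of R (P × Q), ι, π,
    inferInstanceAs (Module.Finite R (P × Q)), inferInstanceAs (Module.Projective R (P × Q)), hι,
    fun z => hπ0 z, hπ, fun f => ?_⟩
  · refine (injective_iff_map_eq_zero a').2 fun x hx => ?_
    obtain ⟨z, rfl⟩ := hip.surjective x
    rw [ha''] at hx
    obtain ⟨e, he⟩ := (hπ0 _).1 hx
    have h2 : j (b e) = 0 := congrArg Prod.snd he
    have h1 : v e = z := congrArg Prod.fst he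
    obtain ⟨x, rfl⟩ := (hab e).1 (hjq.injective (h2.trans (map_zero j).symm))
    exact (hip.exact z).2 ⟨x, by rw [← h1, hv']⟩
  · intro d
    constructor
    · intro hd
      obtain ⟨z, rfl⟩ := hπ d
      rw [hb''] at hd
      obtain ⟨y, hy⟩ := (hjq.exact _).1 hd
      obtain ⟨e, rfl⟩ := hb y
      refine ⟨p (z.1 - v e), ?_⟩
      rw [ha'', ← sub_eq_zero, ← map_sub]
      exact (hπ0 _).2 ⟨-e, by ext <;> simp [ι, hy]⟩
    · rintro ⟨x, rfl⟩
      obtain ⟨z, rfl⟩ := hip.surjective x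
      rw [ha'', hb'', map_zero]
  · intro y
    obtain ⟨z, rfl⟩ := hjq.surjective y
    exact ⟨π (0, z), hb'' _⟩
  · obtain ⟨g₁, hg₁⟩ := hip.extend (f ∘ₗ a)
    obtain ⟨s, hs⟩ := exists_comp_eq_of_ker_le (f := f - g₁ ∘ₗ v) hb (by
      intro e he
      obtain ⟨x, rfl⟩ := (hab e).1 he
      have : g₁ (i x) = f (a x) := LinearMap.congr_fun hg₁ x
      simp [hv', this])
    obtain ⟨g₂, hg₂⟩ := hjq.extend s
    refine ⟨g₁.coprod g₂, ?_⟩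
    ext e
    have h1 : g₂ (j (b e)) = s (b e) := LinearMap.congr_fun hg₂ _
    have h2 : s (b e) = f e - g₁ (v e) := LinearMap.congr_fun hs e
    change g₁ (v e) + g₂ (j (b e)) = f e
    rw [h1, h2, add_sub_cancel]

/-- The two horseshoes say precisely that the class of extensions of Gorenstein projectives is
stable. -/
theorem gproj_of_extension {X E Y : ModuleCat.{u} R} {a : X →ₗ[R] E} {b : E →ₗ[R] Y}
    (hX : Gproj R X) (hY : Gproj R Y) (ha : Function.Injective a) (hab : Function.Exact a b)
    (hb : Function.Surjective b) : Gproj R E := by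
  have : GorensteinStable (R := R) (fun E => IsGprojExtension E) :=
    ⟨fun _ h => h.exists_prev.1, fun _ h => h.exists_next, fun _ h => h.exists_prev.2⟩
  exact this.le_gproj E ⟨X, Y, a, b, hX, hY, ha, hab, hb⟩

theorem gproj_of_subsingleton (X : ModuleCat.{u} R) [Subsingleton X] : Gproj R X := by
  have : GorensteinStable (R := R) (fun X => Subsingleton X) := by
    refine ⟨fun X _ => inferInstance, fun X h => ?_, fun X h => ?_⟩ <;>
    exact ⟨X, h, X, 0, 0, inferInstance, .of_free, fun _ _ _ => Subsingleton.elim _ _,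
      fun x => ⟨fun _ => ⟨0, Subsingleton.elim _ _⟩, fun _ => Subsingleton.elim _ _⟩,
      fun x => ⟨0, Subsingleton.elim _ _⟩,
      fun f => ⟨0, LinearMap.ext fun x => by rw [Subsingleton.elim x 0, map_zero, map_zero]⟩⟩
  exact this.le_gproj X ‹_›

/-- A module filtered by Gorenstein projective modules is Gorenstein projective. -/
theorem filt_le_gproj {𝒳 : ObjectProperty (ModuleCat.{u} R)} (h : 𝒳 ≤ Gproj R) :
    filt 𝒳 ≤ Gproj R := by
  rintro X ⟨-, m, F, h0, hm, hF⟩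
  have key : ∀ i ≤ m, Gproj R (ModuleCat.of R (F i)) := by
    intro i
    induction i with
    | zero =>
      intro _
      have : Subsingleton (ModuleCat.of R (F 0)) := by
        change Subsingleton (F 0)
        rw [h0]; infer_instance
      exact gproj_of_subsingleton _
    | succ i ih =>
      intro hi
      obtain ⟨hle, hq⟩ := hF i hi
      refine gproj_of_extension (X := ModuleCat.of R (F i)) (E := ModuleCat.of R (F (i + 1)))
        (a := Submodule.inclusion hle) (b := ((F i).submoduleOf (F (i + 1))).mkQ)
        (ih (by lia)) (h _ hq) (Submodule.inclusion_injective hle) ?_ (Submodule.mkQ_surjective _)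
      intro y
      rw [Submodule.mkQ_apply, Submodule.Quotient.mk_eq_zero]
      exact ⟨fun hy => ⟨⟨y, hy⟩, rfl⟩, by rintro ⟨x, rfl⟩; exact x.2⟩
  have := key m le_rfl
  rw [hm] at this
  exact gproj_of_linearEquiv (X := ModuleCat.of R (⊤ : Submodule R X)) Submodule.topEquiv this

end ProjectiveSteps

/-! ### First extension groups and the radical of a module -/

section ExtOne

variable {R : Type u} [Ring R]

theorem shortExact_moduleCat {X P Y : Type u} [AddCommGroup X] [Module R X] [AddCommGroup P]
    [Module R P] [AddCommGroup Y] [Module R Y] {i : X →ₗ[R] P} {p : P →ₗ[R] Y}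
    (hi : Function.Injective i) (hip : Function.Exact i p) (hp : Function.Surjective p) :
    (ShortComplex.mk (ModuleCat.ofHom i) (ModuleCat.ofHom p)
      (ModuleCat.hom_ext hip.linearMap_comp_eq_zero)).ShortExact where
  exact := (ShortComplex.ShortExact.moduleCat_exact_iff_function_exact _).2 hip
  mono_f := (ModuleCat.mono_iff_injective _).2 hi
  epi_g := (ModuleCat.epi_iff_surjective _).2 hp

open Abelian in
theorem exists_extend_of_subsingleton_ext {X P Y W : Type u} [AddCommGroup X] [Module R X]
    [AddCommGroup P] [Module R P] [AddCommGroup Y] [Module R Y] [AddCommGroup W] [Module R W]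
    {i : X →ₗ[R] P} {p : P →ₗ[R] Y}
    (hi : Function.Injective i) (hip : Function.Exact i p) (hp : Function.Surjective p)
    (h : Subsingleton (Ext.{u} (ModuleCat.of R Y) (ModuleCat.of R W) 1)) (f : X →ₗ[R] W) :
    ∃ g : P →ₗ[R] W, g ∘ₗ i = f := by
  obtain ⟨x, hx⟩ := Ext.contravariant_sequence_exact₁ (shortExact_moduleCat hi hip hp) _
    (Ext.mk₀ (ModuleCat.ofHom f)) (add_zero 1) (Subsingleton.elim _ _)
  obtain ⟨g, rfl⟩ := (Ext.mk₀_bijective _ _).2 x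
  rw [Ext.mk₀_comp_mk₀] at hx
  exact ⟨g.hom, congrArg ModuleCat.Hom.hom ((Ext.mk₀_bijective _ _).1 hx)⟩

open Abelian in
theorem subsingleton_ext_of_extend {X P Y W : Type u} [AddCommGroup X] [Module R X]
    [AddCommGroup P] [Module R P] [AddCommGroup Y] [Module R Y] [AddCommGroup W] [Module R W]
    {i : X →ₗ[R] P} {p : P →ₗ[R] Y} [Module.Projective R P]
    (hi : Function.Injective i) (hip : Function.Exact i p) (hp : Function.Surjective p)
    (h : ∀ f : X →ₗ[R] W, ∃ g : P →ₗ[R] W, g ∘ₗ i = f) :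
    Subsingleton (Ext.{u} (ModuleCat.of R Y) (ModuleCat.of R W) 1) := by
  refine subsingleton_of_forall_eq 0 fun x => ?_
  have hP : Projective (ModuleCat.of R P) := inferInstance
  obtain ⟨y, rfl⟩ := Ext.contravariant_sequence_exact₃ (shortExact_moduleCat hi hip hp) _ x
    (Ext.eq_zero_of_projective _) (add_zero 1)
  obtain ⟨f, rfl⟩ := (Ext.mk₀_bijective _ _).2 y
  obtain ⟨g, hg⟩ := h f.hom
  have : f = ModuleCat.ofHom i ≫ ModuleCat.ofHom g := ModuleCat.hom_ext hg.symm
  rw [this, ← Ext.mk₀_comp_mk₀]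
  exact (shortExact_moduleCat hi hip hp).extClass_comp_assoc _

/-- M / JM is a module over the semisimple ring R / J, hence semisimple with zero radical. -/
theorem module_jacobson_le [IsSemiprimaryRing R] (M : Type*) [AddCommGroup M] [Module R M] :
    Module.jacobson R M ≤ Ring.jacobson R • (⊤ : Submodule R M) := by
  refine Module.jacobson_le_of_eq_bot ?_
  have h : Module.IsTorsionBySet R (M ⧸ Ring.jacobson R • (⊤ : Submodule R M)) (Ring.jacobson R) :=
    (Module.isTorsionBySet_quotient_iff _ _).2
      fun m i hi => Submodule.smul_mem_smul hi trivial
  let _ := h.module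
  have := (h.semilinearMap.isSemisimpleModule_iff_of_bijective Function.bijective_id).2
      inferInstance
  exact IsSemisimpleModule.jacobson_eq_bot R _

end ExtOne

/-! ### Basic idempotents and the triangular family -/

section BasicIdempotents

/-- A family of idempotents, one for each isomorphism class of simple modules, described modulo
the Jacobson radical. -/
structure IsBasicFamily {B : Type*} [Ring B] {n : ℕ} (e : Fin n → B) : Prop where
  idem : ∀ i, e i * e i = e i
  notMem : ∀ i, e i ∉ Ring.jacobson B
  mem_of_ne : ∀ i j, i ≠ j → ∀ b, e i * b * e j ∈ Ring.jacobson B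
  generates : ∀ i y, y * e i ∉ Ring.jacobson B → ∃ c, c * (y * e i) - e i ∈ Ring.jacobson B
  full : ∀ I : Ideal B, (∀ i b, e i * b ∈ I) → I = ⊤

/-- By Wedderburn–Artin the ring is a product of matrix rings over division rings, and the first
diagonal matrix unit of each block serves. -/
theorem exists_isBasicFamily_of_isSemisimpleRing (R : Type u) [Ring R] [IsSemisimpleRing R] :
    ∃ (n : ℕ) (e : Fin n → R), IsBasicFamily e := by
  obtain ⟨n, D, d, _, _, hd, ⟨φ⟩⟩ := IsSemisimpleRing.exists_algEquiv_pi_matrix_divisionRing ℕ R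
  have hJ : Ring.jacobson R = ⊥ := IsSemisimpleRing.jacobson_eq_bot R
  let E : ∀ i, Fin (d i) → Fin (d i) → D i → (Π i, Matrix (Fin (d i)) (Fin (d i)) (D i)) :=
    fun i r s x => Pi.single i (Matrix.single r s x)
  have hEE : ∀ i r s t x y, E i r s x * E i s t y = E i r t (x * y) := by
    intro i r s t x y
    simp only [E, ← Pi.single_mul, Matrix.single_mul_single_same]
  have hE1 : ∀ i y, y * E i 0 0 1 = ∑ r, E i r 0 (y i r 0) := by
    intro i y
    funext j
    by_cases hij : i = j
    · subst hij
      ext r s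
      by_cases hs : s = 0
      · subst hs
        simp [E, Matrix.sum_apply, Matrix.single_apply, Finset.sum_apply]
      · have hs' : ¬ 0 = s := fun h => hs h.symm
        simp [E, Matrix.sum_apply, Finset.sum_apply, hs, hs']
    · have : ∀ x, (Pi.single i x : Π i, Matrix (Fin (d i)) (Fin (d i)) (D i)) j = 0 := fun x =>
        Pi.single_eq_of_ne (fun h : j = i => hij h.symm) _
      simp [E, Finset.sum_apply, this]
  refine ⟨n, fun i => φ.symm (E i 0 0 1), fun i => ?_, fun i => ?_, fun i j hij b => ?_,
    fun i y hy => ?_, fun I hI => ?_⟩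
  · rw [← map_mul, hEE, one_mul]
  · rw [hJ, Ideal.mem_bot, EmbeddingLike.map_eq_zero_iff]
    intro h
    have := congrFun (congrFun (congrFun h i) 0) 0
    simp [E] at this
  · rw [hJ, Ideal.mem_bot]
    apply φ.injective
    simp only [map_mul, AlgEquiv.apply_symm_apply, map_zero]
    funext l
    by_cases hl : l = i
    · subst hl
      have : E j 0 0 1 l = 0 := Pi.single_eq_of_ne hij _
      simp [this]
    · have : E i 0 0 1 l = 0 := Pi.single_eq_of_ne hl _
      simp [this]
  · rw [hJ, Ideal.mem_bot] at hy
    have h1 : φ y * E i 0 0 1 ≠ 0 := by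
      intro h
      apply hy
      apply φ.injective
      simpa using h
    -- Some entry in the first column of the i-th block is nonzero; its inverse, placed at position
    -- (0, r), brings y e_i back to e_i.
    obtain ⟨r, hr⟩ : ∃ r, φ y i r 0 ≠ 0 := by
      by_contra! h
      rw [hE1] at h1
      exact h1 (Finset.sum_eq_zero fun r _ => by simp [h r, E])
    refine ⟨φ.symm (E i 0 r (φ y i r 0)⁻¹), ?_⟩
    rw [hJ, Ideal.mem_bot, sub_eq_zero]
    apply φ.injective
    simp only [map_mul, AlgEquiv.apply_symm_apply]
    rw [hE1, Finset.mul_sum, Finset.sum_eq_single r, hEE, inv_mul_cancel₀ hr]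
    · intro s _ hs
      have hs' : r ≠ s := fun h => hs h.symm
      simp [E, ← Pi.single_mul, Matrix.single_mul_single_of_ne _ _ _ _ hs']
    · simp
  · rw [Ideal.eq_top_iff_one]
    have h1 : (1 : Π i, Matrix (Fin (d i)) (Fin (d i)) (D i)) =
        ∑ i, ∑ r, E i r 0 1 * (E i 0 0 1 * E i 0 r 1) := by
      simp only [hEE, one_mul]
      funext j
      rw [Finset.sum_apply, Finset.sum_eq_single j]
      · rw [Finset.sum_apply]
        ext r s
        by_cases hrs : r = s
        · subst hrs
          simp [E, Matrix.sum_apply, Matrix.single_apply]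
        · have : ∀ x : Fin (d j), ¬ (x = r ∧ x = s) := fun x h => hrs (h.1.symm.trans h.2)
          simp [E, Matrix.sum_apply, hrs, this]
      · intro i _ hij
        simp [E, Finset.sum_apply, Pi.single_eq_of_ne hij.symm]
      · simp
    have h2 : (1 : R) = ∑ i, ∑ r, φ.symm (E i r 0 1) * (φ.symm (E i 0 0 1) * φ.symm (E i 0 r 1)) := by
      rw [← map_one φ.symm, h1]
      simp only [map_sum, map_mul]
    rw [h2]
    exact Ideal.sum_mem _ fun i _ => Ideal.sum_mem _ fun r _ => I.mul_mem_left _ (hI _ _)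

theorem isNilpotent_of_mem_jacobson {B : Type u} [Ring B] [IsSemiprimaryRing B] {x : B}
    (hx : x ∈ Ring.jacobson B) : IsNilpotent x := by
  obtain ⟨m, hm⟩ := IsSemiprimaryRing.isNilpotent (R := B)
  exact ⟨m, by simpa [hm] using Ideal.pow_mem_pow hx m⟩

/-- J is nilpotent, so the idempotents of the semisimple ring B / J lift. Only fullness is not a
statement modulo J: there I contains some x with 1 - x in J, and x is a unit because 1 - x is
nilpotent. -/
theorem exists_isBasicFamily (B : Type u) [Ring B] [IsSemiprimaryRing B] :
    ∃ (n : ℕ) (e : Fin n → B), IsBasicFamily e := by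
  let q := Ideal.Quotient.mk (Ring.jacobson B)
  have hq : Function.Surjective q := Ideal.Quotient.mk_surjective
  have hJ : Ring.jacobson (B ⧸ Ring.jacobson B) = ⊥ := IsSemisimpleRing.jacobson_eq_bot _
  have hmem : ∀ x, q x ∈ Ring.jacobson (B ⧸ Ring.jacobson B) ↔ x ∈ Ring.jacobson B := fun x => by
    rw [hJ, Ideal.mem_bot, Ideal.Quotient.eq_zero_iff_mem]
  obtain ⟨n, f, hf⟩ := exists_isBasicFamily_of_isSemisimpleRing (B ⧸ Ring.jacobson B)
  have hnil : ∀ x ∈ RingHom.ker q, IsNilpotent x := fun x hx =>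
    isNilpotent_of_mem_jacobson ((Ideal.Quotient.eq_zero_iff_mem).1 hx)
  choose e he hqe using fun i => exists_isIdempotentElem_eq_of_ker_isNilpotent q hnil (f i)
    (hq (f i)) (hf.idem i)
  refine ⟨n, e, fun i => he i, fun i => ?_, fun i j hij b => ?_, fun i y hy => ?_, fun I hI => ?_⟩
  · rw [← hmem, hqe]
    exact hf.notMem i
  · rw [← hmem, map_mul, map_mul, hqe, hqe]
    exact hf.mem_of_ne i j hij _
  · rw [← hmem, map_mul, hqe] at hy
    obtain ⟨c, hc⟩ := hf.generates i _ hy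
    obtain ⟨c, rfl⟩ := hq c
    refine ⟨c, ?_⟩
    rw [← hmem, map_sub, map_mul, map_mul, hqe]
    exact hc
  · have h := hf.full (I.map q) fun i b => by
      obtain ⟨b, rfl⟩ := hq b
      rw [← hqe, ← map_mul]
      exact Ideal.mem_map_of_mem _ (hI i b)
    obtain ⟨x, hx, hx1⟩ := (Ideal.mem_map_iff_of_surjective q hq).1
      ((Ideal.eq_top_iff_one _).1 h)
    have h1 : 1 - x ∈ Ring.jacobson B := by
      rw [← Ideal.Quotient.eq_zero_iff_mem, map_sub, map_one, sub_eq_zero]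
      exact hx1.symm
    have h2 := (isNilpotent_of_mem_jacobson h1).isUnit_one_sub
    rw [sub_sub_cancel] at h2
    exact I.eq_top_of_isUnit_mem hx h2

variable {B : Type u} [Ring B]

/-- The left ideal of all `b` with `b e` in the Jacobson radical. -/
def radicalAnnihilator (e : B) : Ideal B :=
  Submodule.comap (LinearMap.toSpanSingleton B B e) (Ring.jacobson B)

theorem mem_radicalAnnihilator {e b : B} :
    b ∈ radicalAnnihilator e ↔ b * e ∈ Ring.jacobson B := Iff.rfl

namespace IsBasicFamily

variable {n : ℕ} {e : Fin n → B}

/-- Through b ↦ b e_i the quotient becomes the image of B e_i in B / J, and by `generates` every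
nonzero element of that image generates it. -/
theorem isSimpleModule (he : IsBasicFamily e) (i : Fin n) :
    IsSimpleModule B (B ⧸ radicalAnnihilator (e i)) := by
  rw [isSimpleModule_iff_isCoatom]
  refine ⟨fun h => he.notMem i ?_, fun L hL => ?_⟩
  · have : (1 : B) ∈ radicalAnnihilator (e i) := by rw [h]; trivial
    simpa [mem_radicalAnnihilator] using this
  · obtain ⟨y, hyL, hy⟩ := Set.exists_of_ssubset hL
    obtain ⟨c, hc⟩ := he.generates i y hy
    rw [Ideal.eq_top_iff_one]
    have h1 : c * y - 1 ∈ radicalAnnihilator (e i) := by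
      rwa [mem_radicalAnnihilator, sub_mul, one_mul, mul_assoc]
    have := Submodule.sub_mem L (Submodule.smul_mem L c hyL) (hL.le h1)
    rwa [smul_eq_mul, sub_sub_cancel] at this

/-- Right multiplication by e_i b induces an endomorphism of the i-th simple module, which the
splitting hypothesis makes a scalar c; evaluation at the class of 1 reads it off. -/
theorem exists_sub_smul_mem {k : Type u} [Field k] [Algebra k B]
    (hk : IsSplittingFieldFor k B) (he : IsBasicFamily e) (i : Fin n) (b : B) :
    ∃ c : k, e i * b * e i - c • e i ∈ Ring.jacobson B := by
  let K := radicalAnnihilator (e i)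
  have hK : K ≤ Submodule.comap (LinearMap.toSpanSingleton B B (e i * b)) K := by
    intro y hy
    have h : y * e i * (b * e i) ∈ Ring.jacobson B := Ideal.mul_mem_right _ _ hy
    have h' : y * (e i * b) * e i = y * e i * (b * e i) := by simp only [mul_assoc]
    change y * (e i * b) * e i ∈ Ring.jacobson B
    rwa [h']
  obtain ⟨c, hc⟩ := (hk (B ⧸ K) (he.isSimpleModule i)).2
    (K.mapQ K (LinearMap.toSpanSingleton B B (e i * b)) hK)
  refine ⟨c, ?_⟩
  have h1 := LinearMap.congr_fun hc (Submodule.Quotient.mk 1)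
  have h2 : (Submodule.Quotient.mk (c • 1) : B ⧸ K) = Submodule.Quotient.mk (1 * (e i * b)) := h1
  rw [eq_comm, Submodule.Quotient.eq] at h2
  simpa [K, mem_radicalAnnihilator, sub_mul] using h2

/-- A map f : J → S_i with f(x) ≠ 0, precomposed with b ↦ b e_j, is defined on the kernel of B →
S_j. If Ext¹(S_j, S_i) were zero it would extend to some g on B, and f(x) = g(x) = x g(1) would
vanish since J kills simple modules. -/
theorem extArrow [IsSemiprimaryRing B] (he : IsBasicFamily e) {i j : Fin n} {x : B}
    (hx : x ∈ Ring.jacobson B) (hx2 : x ∉ Ring.jacobson B * Ring.jacobson B)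
    (hix : e i * x = x) (hxj : x * e j = x) :
    ExtArrow B (ModuleCat.of B (B ⧸ radicalAnnihilator (e j)))
      (ModuleCat.of B (B ⧸ radicalAnnihilator (e i))) := by
  refine ⟨he.isSimpleModule j, he.isSimpleModule i, ?_⟩
  rw [← not_subsingleton_iff_nontrivial]
  intro hsub
  let J := Ring.jacobson B
  -- The radical of the module J lies in J², so x avoids some maximal submodule.
  obtain ⟨N, hN, hxN⟩ : ∃ N : Submodule B J, IsCoatom N ∧ (⟨x, hx⟩ : J) ∉ N := by
    by_contra! h
    have h1 : (⟨x, hx⟩ : J) ∈ Module.jacobson B J := by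
      simp only [Module.jacobson, Submodule.mem_sInf]
      exact fun N hN => h N hN
    have h2 := Submodule.mem_map_of_mem (f := J.subtype) (module_jacobson_le J h1)
    rw [Submodule.map_smul'', Submodule.map_top, Submodule.range_subtype] at h2
    exact hx2 h2
  have hT : IsSimpleModule B (J ⧸ N) := isSimpleModule_iff_isCoatom.2 hN
  have hS := he.isSimpleModule i
  let K := radicalAnnihilator (e i)
  have hJT : ∀ r ∈ J, ∀ t : J ⧸ N, r • t = 0 := fun r hr t =>
    Module.mem_annihilator.1 (IsSemisimpleModule.jacobson_le_annihilator B (J ⧸ N) hr) t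
  have hJS : ∀ r ∈ J, ∀ t : B ⧸ K, r • t = 0 := fun r hr t =>
    Module.mem_annihilator.1 (IsSemisimpleModule.jacobson_le_annihilator B (B ⧸ K) hr) t
  let t : J ⧸ N := N.mkQ ⟨x, hx⟩
  have ht : t ≠ 0 := fun h => hxN ((Submodule.Quotient.mk_eq_zero N).1 h)
  have het : e i • t = t := congrArg N.mkQ (Subtype.ext hix)
  -- Since e_i fixes t and J kills J / N, the map b ↦ b t factors through the i-th simple module; by
  -- Schur's lemma it identifies that module with J / N.
  let ψ : (B ⧸ K) →ₗ[B] J ⧸ N := K.liftQ (LinearMap.toSpanSingleton B _ t) (by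
    intro b hb
    rw [LinearMap.mem_ker, LinearMap.toSpanSingleton_apply, ← het, smul_smul]
    exact hJT _ hb t)
  have hψ : ψ ≠ 0 := by
    intro h
    have h1 : ψ (Submodule.Quotient.mk 1) = (1 : B) • t := rfl
    rw [h, one_smul] at h1
    exact ht h1.symm
  let Ψ := LinearEquiv.ofBijective ψ (LinearMap.bijective_of_ne_zero hψ)
  let f : J →ₗ[B] B ⧸ K := Ψ.symm.toLinearMap ∘ₗ N.mkQ
  have hf : f ⟨x, hx⟩ ≠ 0 := fun h => ht (Ψ.symm.injective (h.trans (map_zero _).symm))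
  let Kj := radicalAnnihilator (e j)
  let ρ : Kj →ₗ[B] J := ((LinearMap.toSpanSingleton B B (e j)).comp Kj.subtype).codRestrict J
    fun b => b.2
  obtain ⟨g, hg⟩ := exists_extend_of_subsingleton_ext Kj.injective_subtype
    (LinearMap.exact_subtype_mkQ Kj) (Submodule.mkQ_surjective _) hsub (f ∘ₗ ρ)
  have hxK : x ∈ Kj := by rwa [mem_radicalAnnihilator, hxj]
  have h1 : g x = f (ρ ⟨x, hxK⟩) := LinearMap.congr_fun hg ⟨x, hxK⟩
  have h2 : ρ ⟨x, hxK⟩ = ⟨x, hx⟩ := Subtype.ext hxj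
  have h3 : g x = x • g 1 := by rw [← map_smul, smul_eq_mul, mul_one]
  rw [h2, h3, hJS x hx] at h1
  exact hf h1.symm

/-- Without a path from the `j`-th to the `i`-th simple module, `e i * J * e j = 0`. -/
theorem mul_mul_eq_zero [IsSemiprimaryRing B] (he : IsBasicFamily e) {i j : Fin n}
    (hij : ¬ Relation.TransGen (ExtArrow B) (ModuleCat.of B (B ⧸ radicalAnnihilator (e j)))
      (ModuleCat.of B (B ⧸ radicalAnnihilator (e i)))) {x : B} (hx : x ∈ Ring.jacobson B) :
    e i * x * e j = 0 := by
  let J := Ring.jacobson B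
  -- Membership in every power of J is enough, as J is nilpotent.
  have key : ∀ m : ℕ, ∀ i j : Fin n,
      ¬ Relation.TransGen (ExtArrow B) (ModuleCat.of B (B ⧸ radicalAnnihilator (e j)))
        (ModuleCat.of B (B ⧸ radicalAnnihilator (e i))) →
      ∀ x ∈ J, e i * x * e j ∈ J ^ (m + 1) := by
    intro m
    induction m with
    | zero =>
      intro i j _ x hx
      rw [zero_add, Submodule.pow_one]
      exact Ideal.mul_mem_right _ _ (J.mul_mem_left _ hx)
    | succ m ih =>
      intro i j hij x hx
      have h1 : e i * x * e j ∈ J * J := by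
        by_contra h
        exact hij (.single (he.extArrow (Ideal.mul_mem_right _ _ (J.mul_mem_left _ hx)) h
          (by rw [← mul_assoc, ← mul_assoc, he.idem]) (by rw [mul_assoc, he.idem])))
      have h2 : ∀ z ∈ J * J, e i * z * e j ∈ J ^ (m + 1 + 1) := by
        intro z hz
        induction hz using Submodule.mul_induction_on' with
        | mem_mul_mem y hy z hz =>
          -- Fullness permits inserting some e_l between the two factors from J. Paths from j to l
          -- and from l to i would compose, so at least one is missing; induction puts the
          -- corresponding factor into J^(m+1), and the other one is in J.
          let I : Ideal B :=
            { carrier := {w | ∀ c, e i * (y * (c * w) * z) * e j ∈ J ^ (m + 1 + 1)}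
              add_mem' := fun {a b} ha hb c => by
                have := Submodule.add_mem _ (ha c) (hb c)
                simpa only [mul_add, add_mul] using this
              zero_mem' := fun c => by simp
              smul_mem' := fun r a ha c => by
                have := ha (c * r)
                simpa only [smul_eq_mul, mul_assoc] using this }
          have hI : I = ⊤ := he.full I fun l b c => by
            have h1 : e i * (y * (c * (e l * b)) * z) * e j =
                (e i * (y * c) * e l) * (e l * (b * z) * e j) := by
              simp only [mul_assoc]
              rw [← mul_assoc (e l) (e l), he.idem]
            have hyc : y * c ∈ J := Ideal.mul_mem_right _ _ hy
            have hbz : b * z ∈ J := J.mul_mem_left _ hz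
            rw [h1]
            by_cases hil : Relation.TransGen (ExtArrow B)
                (ModuleCat.of B (B ⧸ radicalAnnihilator (e l)))
                (ModuleCat.of B (B ⧸ radicalAnnihilator (e i)))
            · rw [Ideal.IsTwoSided.pow_succ]
              exact Ideal.mul_mem_mul (Ideal.mul_mem_right _ _ (J.mul_mem_left _ hyc))
                (ih l j (fun hlj => hij (hlj.trans hil)) _ hbz)
            · rw [Submodule.pow_succ]
              exact Ideal.mul_mem_mul (ih i l hil _ hyc)
                (Ideal.mul_mem_right _ _ (J.mul_mem_left _ hbz))
          have h1 : (1 : B) ∈ I := by rw [hI]; trivial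
          simpa using h1 1
        | add y _ z _ hy hz =>
          rw [mul_add, add_mul]
          exact Submodule.add_mem _ hy hz
      have h3 := h2 _ h1
      rwa [← mul_assoc, ← mul_assoc, he.idem, mul_assoc _ (e j), he.idem] at h3
  obtain ⟨m, hm⟩ := IsSemiprimaryRing.isNilpotent (R := B)
  have h1 := Ideal.pow_le_pow_right (I := J) (Nat.le_succ m) (key m i j hij x hx)
  rw [hm] at h1
  exact h1

end IsBasicFamily

/-- A full family of idempotents making `B` triangular with diagonal entries in `k`. -/
structure IsTriangularFamily (k : Type*) [Field k] {B : Type*} [Ring B] [Algebra k B] {n : ℕ}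
    (e : Fin n → B) : Prop where
  idem : ∀ i, e i * e i = e i
  corner : ∀ i b, ∃ c : k, e i * b * e i = c • e i
  upper : ∀ i j, i < j → ∀ b, e i * b * e j = 0
  full : ∀ I : Ideal B, (∀ i b, e i * b ∈ I) → I = ⊤

/-- The basic idempotents are sorted by the number of vertices with a path to the given one, which
increases strictly along paths since there are no cycles. For i before j no path leads from j to i,
so e_i J e_j = 0, and e_i B e_j ⊆ J. The absence of closed paths gives e_i J e_i = 0, which turns
the congruence e_i b e_i ≡ c e_i into an equality. -/
theorem exists_isTriangularFamily (k : Type u) [Field k] (B : Type u) [Ring B] [Algebra k B]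
    [FiniteDimensional k B] (hB : IsTriangularAlgebra B) (hk : IsSplittingFieldFor k B) :
    ∃ (n : ℕ) (e : Fin n → B), IsTriangularFamily k e := by
  classical
  have : IsArtinianRing B := IsArtinianRing.of_finite k B
  obtain ⟨n, e, he⟩ := exists_isBasicFamily B
  let r : Fin n → Fin n → Prop := fun i j => Relation.TransGen (ExtArrow B)
    (ModuleCat.of B (B ⧸ radicalAnnihilator (e i))) (ModuleCat.of B (B ⧸ radicalAnnihilator (e j)))
  have hr : ∀ i, ¬ r i i := fun i => hB _
  have hrt : ∀ i j l, r i j → r j l → r i l := fun i j l h h' => h.trans h'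
  let rank : Fin n → ℕ := fun i => (Finset.univ.filter fun l => r l i).card
  have hrank : ∀ i j, r i j → rank i < rank j := fun i j hij => by
    refine Finset.card_lt_card ((Finset.ssubset_iff_of_subset fun l hl => ?_).2 ⟨i, ?_, ?_⟩)
    · rw [Finset.mem_filter] at hl ⊢
      exact ⟨hl.1, hrt _ _ _ hl.2 hij⟩
    · simpa using hij
    · simpa using hr i
  refine ⟨n, e ∘ Tuple.sort rank, fun i => he.idem _, fun i b => ?_, fun i j hij b => ?_,
    fun I hI => he.full I fun i b => ?_⟩
  · obtain ⟨c, hc⟩ := he.exists_sub_smul_mem hk (Tuple.sort rank i) b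
    refine ⟨c, ?_⟩
    have h := he.mul_mul_eq_zero (hr (Tuple.sort rank i)) hc
    rw [mul_sub, sub_mul, mul_smul_comm, smul_mul_assoc, he.idem, he.idem, mul_assoc, mul_assoc,
      mul_assoc, he.idem, ← mul_assoc, he.idem, ← mul_assoc, sub_eq_zero] at h
    exact h
  · have hne : Tuple.sort rank i ≠ Tuple.sort rank j := fun h =>
      hij.ne ((Tuple.sort rank).injective h)
    have hle : rank (Tuple.sort rank i) ≤ rank (Tuple.sort rank j) :=
      Tuple.monotone_sort rank hij.le
    have h := he.mul_mul_eq_zero (fun h => absurd (hrank _ _ h) hle.not_gt)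
      (he.mem_of_ne _ _ hne b)
    rw [mul_assoc, mul_assoc, mul_assoc, he.idem, ← mul_assoc, he.idem, ← mul_assoc] at h
    exact h
  · have := hI ((Tuple.sort rank).symm i) b
    rwa [Function.comp_apply, Equiv.apply_symm_apply] at this

end BasicIdempotents

/-! ### Finite projective dimension over B and its consequences -/

section GlobalDimension

/-- Induction on the number d of idempotents that may still act nontrivially. If none is left,
fullness gives M = 0. Otherwise copies of the projective module B e_s, with s the first remaining
index, approximate M by a map whose kernel and cokernel are killed by e_s as well. -/
theorem IsTriangularFamily.hasProjectiveDimensionLT_of_smul_eq_zero {k B : Type u} [Field k]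
    [Ring B] [Algebra k B] {n : ℕ} {e : Fin n → B} (he : IsTriangularFamily k e) (d : ℕ) :
    ∀ (j : ℕ) (_ : j + d = n) (M : ModuleCat.{u} B)
      (_ : ∀ i : Fin n, i.1 < j → ∀ m : M, e i • m = 0), HasProjectiveDimensionLT M d := by
  induction d with
  | zero =>
    intro j hj M hM
    have h1 : Subsingleton M := by
      refine subsingleton_of_forall_eq 0 fun m => ?_
      have h : LinearMap.ker (LinearMap.toSpanSingleton B M m) = ⊤ :=
        he.full _ fun i b => by
          rw [LinearMap.mem_ker, LinearMap.toSpanSingleton_apply, mul_smul]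
          exact hM i (by lia) _
      have h1 : (1 : B) ∈ LinearMap.ker (LinearMap.toSpanSingleton B M m) := by rw [h]; trivial
      simpa using h1
    exact (ModuleCat.isZero_of_subsingleton M).hasProjectiveDimensionLT_zero
  | succ d ih =>
    intro j hj M hM
    let s : Fin n := ⟨j, by lia⟩
    let _ : Module k M := Module.compHom M (algebraMap k B)
    have : IsScalarTower k B M := ⟨fun c b m => by
      rw [Algebra.smul_def, mul_smul]; rfl⟩
    let E : Submodule k M := LinearMap.range (Algebra.lsmul k k M (e s))
    have hE : ∀ m ∈ E, e s • m = m := by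
      rintro _ ⟨m, rfl⟩
      change e s • e s • m = e s • m
      rw [smul_smul, he.idem]
    let b := Module.Free.chooseBasis k E
    let ι := Module.Free.ChooseBasisIndex k E
    let Q : Submodule B B := LinearMap.range (LinearMap.toSpanSingleton B B (e s))
    have hQ : ∀ q ∈ Q, q * e s = q := by
      rintro _ ⟨x, rfl⟩
      change x * e s * e s = x * e s
      rw [mul_assoc, he.idem]
    have hQp : Module.Projective B Q :=
      Module.Projective.of_split Q.subtype (LinearMap.toSpanSingleton B B (e s)).rangeRestrict
        (LinearMap.ext fun q => Subtype.ext (hQ q q.2))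
    -- There is one copy of B e_s for each basis vector of E = e_s M. As e_s B e_s = k e_s, the map
    -- π becomes an isomorphism after applying e_s; as e_i B e_s = 0 for i < s, no earlier
    -- idempotent acts on the source.
    let π : (ι →₀ Q) →ₗ[B] M :=
      Finsupp.lsum ℕ fun t => (LinearMap.toSpanSingleton B M (b t : M)) ∘ₗ Q.subtype
    have hπ : ∀ f : ι →₀ Q, π f = f.sum fun t q => (q : B) • (b t : M) := fun f => rfl
    have hker : ∀ i : Fin n, i.1 < j + 1 → ∀ f : LinearMap.ker π, e i • f = 0 := by
      intro i hi f
      apply Subtype.ext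
      ext t
      change e i * (f.1 t : B) = 0
      rcases Nat.lt_succ_iff_lt_or_eq.1 hi with hi | hi
      · rw [← hQ _ (f.1 t).2, ← mul_assoc]
        exact he.upper i s hi _
      · have his : i = s := Fin.ext hi
        rw [his]
        choose c hc using fun t => he.corner s (f.1 t)
        have h1 : e s • π f = 0 := by rw [f.2, smul_zero]
        rw [hπ, Finsupp.smul_sum] at h1
        have h2 : ∑ t ∈ f.1.support, c t • b t = 0 := by
          apply Subtype.ext
          rw [Submodule.coe_zero, ← h1, Finsupp.sum, AddSubmonoidClass.coe_finsetSum]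
          refine Finset.sum_congr rfl fun t _ => ?_
          have h3 : e s * (f.1 t : B) = c t • e s := by rw [← hc, mul_assoc, hQ _ (f.1 t).2]
          rw [smul_smul, h3, smul_assoc, hE _ (b t).2]
          rfl
        by_cases ht : t ∈ f.1.support
        · have h3 := linearIndependent_iff'.1 b.linearIndependent _ _ h2 t ht
          have h4 := hc t
          rwa [h3, zero_smul, mul_assoc, hQ _ (f.1 t).2] at h4
        · rw [Finsupp.notMem_support_iff.1 ht]
          simp
    have hcoker : ∀ i : Fin n, i.1 < j + 1 → ∀ m : M ⧸ LinearMap.range π, e i • m = 0 := by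
      intro i hi m
      obtain ⟨m, rfl⟩ := Submodule.Quotient.mk_surjective _ m
      rw [← Submodule.Quotient.mk_smul, Submodule.Quotient.mk_eq_zero]
      rcases Nat.lt_succ_iff_lt_or_eq.1 hi with hi | hi
      · rw [hM i hi]
        exact Submodule.zero_mem _
      · have his : i = s := Fin.ext hi
        rw [his]
        have hmem : ∀ y : E, (y : M) ∈ LinearMap.range π := by
          intro y
          rw [← b.linearCombination_repr y, Finsupp.linearCombination_apply, Finsupp.sum,
            AddSubmonoidClass.coe_finsetSum]
          refine Submodule.sum_mem _ fun t _ => ⟨Finsupp.single t (b.repr y t • ⟨e s, 1, one_mul _⟩), ?_⟩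
          rw [hπ, Finsupp.sum_single_index (by simp)]
          change (b.repr y t • e s) • (b t : M) = b.repr y t • (b t : M)
          rw [smul_assoc, hE _ (b t).2]
        exact hmem ⟨e s • m, m, rfl⟩
    have hK := ih (j + 1) (by lia) (ModuleCat.of B (LinearMap.ker π)) hker
    have hC := ih (j + 1) (by lia) (ModuleCat.of B (M ⧸ LinearMap.range π)) hcoker
    have hP' : Module.Projective B (ι →₀ Q) := by
      classical exact .of_equiv' (finsuppLequivDFinsupp B).symm
    have hP : Projective (ModuleCat.of B (ι →₀ Q)) := inferInstance
    have hI : HasProjectiveDimensionLT (ModuleCat.of B (LinearMap.range π)) (d + 1) :=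
      (shortExact_moduleCat (i := (LinearMap.ker π).subtype) (p := π.rangeRestrict)
        (Submodule.injective_subtype _)
        (by
          intro x
          rw [← LinearMap.mem_ker, LinearMap.ker_rangeRestrict]
          exact ⟨fun h => ⟨⟨x, h⟩, rfl⟩, by rintro ⟨y, rfl⟩; exact y.2⟩)
        π.surjective_rangeRestrict).hasProjectiveDimensionLT_X₃ d hK
        (hasProjectiveDimensionLT_of_ge _ 1 _ (by lia))
    exact (shortExact_moduleCat (LinearMap.range π).injective_subtype
      (LinearMap.exact_subtype_mkQ _) (Submodule.mkQ_surjective _)).hasProjectiveDimensionLT_X₂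
        (d + 1) hI (hasProjectiveDimensionLT_of_ge _ d _ (by lia))

theorem IsTriangularFamily.hasProjectiveDimensionLT {k B : Type u} [Field k]
    [Ring B] [Algebra k B] {n : ℕ} {e : Fin n → B} (he : IsTriangularFamily k e)
    (M : ModuleCat.{u} B) : HasProjectiveDimensionLT M n :=
  he.hasProjectiveDimensionLT_of_smul_eq_zero n 0 (by lia) M fun i hi => absurd hi (by lia)

/-- If projective dimensions are bounded and every module of a class embeds into a projective
module with cokernel in the class, then the class consists of projective modules. -/
theorem projective_of_forall_embedding {R : Type u} [Ring R] {n : ℕ}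
    (hn : ∀ M : ModuleCat.{u} R, HasProjectiveDimensionLT M n)
    {𝒢 : ObjectProperty (ModuleCat.{u} R)}
    (h : ∀ X, 𝒢 X → ∃ (P Y : ModuleCat.{u} R) (i : X →ₗ[R] P) (p : P →ₗ[R] Y), 𝒢 Y ∧
      Module.Projective R P ∧ Function.Injective i ∧ Function.Exact i p ∧ Function.Surjective p)
    {X : ModuleCat.{u} R} (hX : 𝒢 X) : Module.Projective R X := by
  -- Each passage to the cosyzygy, which stays in the class, improves the uniform bound by one. The
  -- descent stops at `HasProjectiveDimensionLT X 1`, which is projectivity.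
  have key : ∀ m ≤ n, ∀ X, 𝒢 X → HasProjectiveDimensionLT X (n - m + 1) := by
    intro m
    induction m with
    | zero =>
      intro _ X _
      have := hn X
      exact hasProjectiveDimensionLT_of_ge X n _ (by lia)
    | succ m ih =>
      intro hm X hX
      obtain ⟨P, Y, i, p, hY, hP, hi, hip, hp⟩ := h X hX
      have hP' : Projective (ModuleCat.of R P) := inferInstance
      have hY' := ih (by lia) Y hY
      rw [show n - m + 1 = n - (m + 1) + 1 + 1 by lia] at hY'
      exact (shortExact_moduleCat hi hip hp).hasProjectiveDimensionLT_X₁ _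
        (hasProjectiveDimensionLT_of_ge _ 1 _ (by lia)) hY'
  have h1 := key n le_rfl X hX
  rw [Nat.sub_self, zero_add] at h1
  exact (IsProjective.iff_projective X).2 inferInstance

theorem IsTriangularFamily.projective_of_gproj {k B : Type u} [Field k]
    [Ring B] [Algebra k B] {n : ℕ} {e : Fin n → B} (he : IsTriangularFamily k e)
    {X : ModuleCat.{u} B} (hX : Gproj B X) : Module.Projective B X := by
  refine projective_of_forall_embedding he.hasProjectiveDimensionLT (𝒢 := Gproj B) ?_ hX
  intro X hX
  obtain ⟨Y, hY, P, i, p, h⟩ := gorensteinStable_gproj.next X hX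
  exact ⟨P, Y, i, p, hY, h.projective, h.injective, h.exact, h.surjective⟩

end GlobalDimension

/-! ### Restricting Λ-modules to A and to B -/

section RestrictedActions

theorem projective_of_isScalarTower (R : Type*) {S M : Type*} [Ring R] [Ring S] [AddCommGroup M]
    [Module R S] [Module S M] [Module R M] [IsScalarTower R S M] [IsScalarTower R S S]
    [Module.Projective R S] [Module.Projective S M] : Module.Projective R M := by
  classical
  obtain ⟨s, hs⟩ := Module.projective_def'.1 (inferInstance : Module.Projective S M)
  have h : Module.Projective R (M →₀ S) := .of_equiv' (finsuppLequivDFinsupp R).symm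
  refine Module.Projective.of_split (s.restrictScalars R)
    ((Finsupp.linearCombination S id).restrictScalars R) ?_
  ext m
  exact LinearMap.congr_fun hs m

variable {k : Type u} [Field k] {A B : Type u} [Ring A] [Algebra k A] [Ring B] [Algebra k B]

/-- The `k`-action on an `A ⊗ B`-module. -/
instance moduleOfTensorBase (X : ModuleCat.{u} (A ⊗[k] B)) : Module k X :=
  Module.compHom X (algebraMap k (A ⊗[k] B))

/-- The `A`-action on an `A ⊗ B`-module. -/
instance moduleOfTensorLeft (X : ModuleCat.{u} (A ⊗[k] B)) : Module A X :=
  Module.compHom X (Algebra.TensorProduct.includeLeft : A →ₐ[k] A ⊗[k] B).toRingHom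

/-- The `B`-action on an `A ⊗ B`-module. -/
instance moduleOfTensorRight (X : ModuleCat.{u} (A ⊗[k] B)) : Module B X :=
  Module.compHom X (Algebra.TensorProduct.includeRight : B →ₐ[k] A ⊗[k] B).toRingHom

variable (X : ModuleCat.{u} (A ⊗[k] B))

theorem tensorLeft_smul_def (a : A) (x : X) : a • x = (a ⊗ₜ[k] (1 : B)) • x := rfl

theorem tensorRight_smul_def (b : B) (x : X) : b • x = ((1 : A) ⊗ₜ[k] b) • x := rfl

theorem tmul_smul_eq (a : A) (b : B) (x : X) : (a ⊗ₜ[k] b) • x = a • b • x := by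
  rw [tensorLeft_smul_def, tensorRight_smul_def, smul_smul, Algebra.TensorProduct.tmul_mul_tmul,
    mul_one, one_mul]

theorem tmul_smul_eq' (a : A) (b : B) (x : X) : (a ⊗ₜ[k] b) • x = b • a • x := by
  rw [tensorLeft_smul_def, tensorRight_smul_def, smul_smul, Algebra.TensorProduct.tmul_mul_tmul,
    mul_one, one_mul]

instance : IsScalarTower k (A ⊗[k] B) X := ⟨fun c r x => by
  rw [Algebra.smul_def, mul_smul]; rfl⟩

instance : IsScalarTower k A X := ⟨fun c a x => by
  rw [tensorLeft_smul_def, tensorLeft_smul_def, ← smul_assoc, TensorProduct.smul_tmul']⟩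

instance : IsScalarTower k B X := ⟨fun c b x => by
  rw [tensorRight_smul_def, tensorRight_smul_def, ← smul_assoc, TensorProduct.tmul_smul]⟩

instance : SMulCommClass A B X := ⟨fun a b x => by rw [← tmul_smul_eq, tmul_smul_eq']⟩

instance : SMulCommClass B A X := SMulCommClass.symm _ _ _

instance : IsScalarTower A (A ⊗[k] B) X := ⟨fun a r x => by
  rw [tensorLeft_smul_def, smul_smul]
  congr 1
  induction r with
  | zero => simp
  | tmul a' b => simp [TensorProduct.smul_tmul']
  | add r s hr hs => rw [smul_add, mul_add, hr, hs]⟩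

variable {X} {Y : ModuleCat.{u} (A ⊗[k] B)}

/-- An `A ⊗ B`-linear map as an `A`-linear map. -/
def resLeft (f : X →ₗ[A ⊗[k] B] Y) : X →ₗ[A] Y :=
  { f.toAddMonoidHom with map_smul' := fun a x => f.map_smul (a ⊗ₜ 1) x }

/-- An `A ⊗ B`-linear map as a `B`-linear map. -/
def resRight (f : X →ₗ[A ⊗[k] B] Y) : X →ₗ[B] Y :=
  { f.toAddMonoidHom with map_smul' := fun b x => f.map_smul (1 ⊗ₜ b) x }

@[simp]
theorem resRight_apply (f : X →ₗ[A ⊗[k] B] Y) (x : X) : resRight f x = f x := rfl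

theorem projective_left [Module.Projective (A ⊗[k] B) X] : Module.Projective A X :=
  projective_of_isScalarTower A (S := A ⊗[k] B)

theorem finite_left [FiniteDimensional k B] [Module.Finite (A ⊗[k] B) X] : Module.Finite A X :=
  Module.Finite.trans (A ⊗[k] B) X

/-- `A ⊗ B` as a left `B`-module. -/
abbrev moduleRightSelf (k A B : Type u) [Field k] [Ring A] [Algebra k A] [Ring B] [Algebra k B] :
    Module B (A ⊗[k] B) :=
  Module.compHom (A ⊗[k] B) (Algebra.TensorProduct.includeRight : B →ₐ[k] A ⊗[k] B).toRingHom

/-- The swap `B ⊗ A ≃ A ⊗ B` is `B`-linear. -/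
def commRight (k A B : Type u) [Field k] [Ring A] [Algebra k A] [Ring B] [Algebra k B] :
    letI := moduleRightSelf k A B
    B ⊗[k] A ≃ₗ[B] A ⊗[k] B :=
  let _ := moduleRightSelf k A B
  { (TensorProduct.comm k B A).toAddEquiv with
    map_smul' := fun b z => by
      change TensorProduct.comm k B A (b • z) = ((1 : A) ⊗ₜ[k] b) * TensorProduct.comm k B A z
      induction z with
      | zero => simp
      | tmul b' a => simp [TensorProduct.smul_tmul']
      | add r s hr hs => rw [smul_add, map_add, map_add, mul_add, hr, hs] }

theorem projective_right [Module.Projective (A ⊗[k] B) X] : Module.Projective B X := by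
  let _ := moduleRightSelf k A B
  have h1 : IsScalarTower B (A ⊗[k] B) X := ⟨fun b r x => mul_smul ((1 : A) ⊗ₜ[k] b) r x⟩
  have h2 : IsScalarTower B (A ⊗[k] B) (A ⊗[k] B) := ⟨fun b r x => mul_assoc ((1 : A) ⊗ₜ[k] b) r x⟩
  have h3 : Module.Projective B (A ⊗[k] B) := .of_equiv' (commRight k A B)
  exact projective_of_isScalarTower B (S := A ⊗[k] B)

theorem finite_right [FiniteDimensional k A] [Module.Finite (A ⊗[k] B) X] : Module.Finite B X := by
  let _ := moduleRightSelf k A B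
  have h1 : IsScalarTower B (A ⊗[k] B) X := ⟨fun b r x => mul_smul ((1 : A) ⊗ₜ[k] b) r x⟩
  have h3 : Module.Finite B (A ⊗[k] B) := Module.Finite.equiv (commRight k A B)
  exact Module.Finite.trans (A ⊗[k] B) X

end RestrictedActions

/-! ### Lifting and extending maps on outer tensor products -/

section OuterMaps

theorem exists_dual_basis (R N : Type*) [Ring R] [AddCommGroup N] [Module R N] [Module.Finite R N]
    [Module.Projective R N] : ∃ (m : ℕ) (φ : Fin m → N →ₗ[R] R) (x : Fin m → N),
      ∀ n, ∑ c, φ c n • x c = n := by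
  obtain ⟨m, r, s, -, -, hrs⟩ := Module.Finite.exists_comp_eq_id_of_projective R N
  refine ⟨m, fun c => LinearMap.proj c ∘ₗ s, fun c => r (Pi.single c 1), fun n => ?_⟩
  have h := LinearMap.congr_fun hrs n
  rw [LinearMap.comp_apply, pi_eq_sum_univ' (s n), map_sum] at h
  simp only [map_smul] at h
  exact h

variable {k : Type u} [Field k] {A B : Type u} [Ring A] [Algebra k A] [Ring B] [Algebra k B]
  {M M' M'' : Type u} [AddCommGroup M] [Module k M] [Module A M] [IsScalarTower k A M]
  [AddCommGroup M'] [Module k M'] [Module A M'] [IsScalarTower k A M']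
  [AddCommGroup M''] [Module k M''] [Module A M''] [IsScalarTower k A M'']
  {N : Type u} [AddCommGroup N] [Module k N] [Module B N] [IsScalarTower k B N]
  {N' : Type u} [AddCommGroup N'] [Module k N'] [Module B N'] [IsScalarTower k B N']
  {Y : ModuleCat.{u} (A ⊗[k] B)}

/-- The pure tensor `m ⊗ n` in the outer tensor product. -/
def OuterTensor.tmul (k : Type u) [Field k] {M N : Type u} [AddCommGroup M] [Module k M]
    [AddCommGroup N] [Module k N] (m : M) (n : N) : OuterTensor k M N :=
  m ⊗ₜ[k] n

@[elab_as_elim]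
theorem OuterTensor.induction {p : OuterTensor k M N → Prop} (zero : p 0)
    (tmul : ∀ m n, p (OuterTensor.tmul k m n)) (add : ∀ x y, p x → p y → p (x + y))
    (z : OuterTensor k M N) : p z :=
  TensorProduct.induction_on (motive := p) z zero tmul add

/-- A `k`-linear map out of `M ⊗ N` that respects pure tensors is `A ⊗ B`-linear. -/
def OuterTensor.lift {Z : Type u} [AddCommGroup Z] [Module (A ⊗[k] B) Z]
    (f : M ⊗[k] N →+ Z)
    (hf : ∀ (a : A) (b : B) m n, f ((a • m) ⊗ₜ (b • n)) = (a ⊗ₜ[k] b) • f (m ⊗ₜ n)) :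
    OuterTensor k M N →ₗ[A ⊗[k] B] Z :=
  { f with
    map_smul' := fun r z => by
      change f _ = r • f z
      induction r with
      | zero => rw [zero_smul, zero_smul]; exact map_zero f
      | add r s hr hs => rw [add_smul, add_smul, ← hr, ← hs]; exact map_add f _ _
      | tmul a b =>
        induction z using OuterTensor.induction with
        | zero =>
          rw [smul_zero]
          exact (map_zero f).trans (by rw [show f (0 : OuterTensor k M N) = 0 from map_zero f, smul_zero])
        | tmul m n => exact hf a b m n
        | add x y hx hy =>
          rw [smul_add]
          refine (map_add f _ _).trans ?_
          rw [hx, hy, ← smul_add]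
          exact congrArg _ (map_add f _ _).symm }

theorem OuterTensor.hom_ext {Z : Type u} [AddCommGroup Z] [Module (A ⊗[k] B) Z]
    {f g : OuterTensor k M N →ₗ[A ⊗[k] B] Z}
    (h : ∀ m n, f (OuterTensor.tmul k m n) = g (OuterTensor.tmul k m n)) : f = g := by
  ext z
  induction z using OuterTensor.induction with
  | zero => rw [map_zero, map_zero]
  | tmul m n => exact h m n
  | add x y hx hy => rw [map_add, map_add, hx, hy]

/-- `m ⊗ n ↦ φ(n) g(m)`. -/
def outerPairing (g : M →ₗ[A] Y) (φ : N →ₗ[B] B) : OuterTensor k M N →ₗ[A ⊗[k] B] Y :=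
  OuterTensor.lift (TensorProduct.lift (LinearMap.mk₂ k (fun m n => φ n • g m)
    (fun m m' n => by rw [map_add, smul_add])
    (fun c m n => by
      rw [← algebraMap_smul A c m, map_smul, algebraMap_smul, smul_comm])
    (fun m n n' => by rw [map_add, add_smul])
    (fun c m n => by
      rw [← algebraMap_smul B c n, map_smul, algebraMap_smul, smul_assoc]))).toAddMonoidHom
    fun a b m n => by
      simp only [LinearMap.toAddMonoidHom_coe, TensorProduct.lift.tmul, LinearMap.mk₂_apply]
      rw [map_smul, map_smul, smul_eq_mul, mul_smul, tmul_smul_eq', smul_comm a]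

@[simp]
theorem outerPairing_tmul (g : M →ₗ[A] Y) (φ : N →ₗ[B] B) (m : M) (n : N) :
    outerPairing g φ (OuterTensor.tmul k m n) = φ n • g m := rfl

theorem OuterTensor.smul_tmul (a : A) (b : B) (m : M) (n : N) :
    (a ⊗ₜ[k] b) • OuterTensor.tmul k m n = OuterTensor.tmul k (a • m) (b • n) := rfl

/-- `m ↦ f(m ⊗ n)`. -/
def outerCurry (f : OuterTensor k M N →ₗ[A ⊗[k] B] Y) (n : N) : M →ₗ[A] Y where
  toFun m := f (OuterTensor.tmul k m n)
  map_add' m m' := by rw [← map_add]; exact congrArg f (TensorProduct.add_tmul m m' n)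
  map_smul' a m := by
    rw [RingHom.id_apply, tensorLeft_smul_def, ← map_smul, OuterTensor.smul_tmul, one_smul]

/-- A dual basis of N recovers f from the A-linear maps f(− ⊗ x_c). Lifting and extension problems
for M ⊗ N thereby reduce to finitely many problems for M over A. -/
theorem sum_outerPairing_outerCurry (f : OuterTensor k M N →ₗ[A ⊗[k] B] Y) {ι : Type*} [Fintype ι]
    {φ : ι → N →ₗ[B] B} {x : ι → N} (h : ∀ n, ∑ c, φ c n • x c = n) :
    ∑ c, outerPairing (outerCurry f (x c)) (φ c) = f := by
  refine OuterTensor.hom_ext fun m n => ?_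
  have h1 : OuterTensor.tmul k m n = ∑ c, ((1 : A) ⊗ₜ[k] φ c n) • OuterTensor.tmul k m (x c) := by
    simp only [OuterTensor.smul_tmul, one_smul]
    conv_lhs => rw [← h n]
    exact TensorProduct.tmul_sum _ _ _
  conv_rhs => rw [h1, map_sum]
  rw [LinearMap.sum_apply]
  exact Finset.sum_congr rfl fun c _ => by rw [map_smul]; rfl

theorem OuterTensor.exists_comp_eq [Module.Projective A M] [Module.Projective B N]
    [Module.Finite B N] {Y Z : ModuleCat.{u} (A ⊗[k] B)} {p : Y →ₗ[A ⊗[k] B] Z}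
    (hp : Function.Surjective p) (f : OuterTensor k M N →ₗ[A ⊗[k] B] Z) :
    ∃ g : OuterTensor k M N →ₗ[A ⊗[k] B] Y, p ∘ₗ g = f := by
  obtain ⟨m, φ, x, h⟩ := exists_dual_basis B N
  choose g hg using fun c => Module.projective_lifting_property (resLeft p) (outerCurry f (x c)) hp
  refine ⟨∑ c, outerPairing (g c) (φ c), ?_⟩
  rw [← sum_outerPairing_outerCurry f h]
  refine OuterTensor.hom_ext fun m n => ?_
  rw [LinearMap.comp_apply, LinearMap.sum_apply, LinearMap.sum_apply, map_sum]
  refine Finset.sum_congr rfl fun c _ => ?_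
  rw [outerPairing_tmul, outerPairing_tmul, ← hg]
  exact map_smul p ((1 : A) ⊗ₜ[k] φ c n) _

theorem OuterTensor.projective [Module.Projective A M] [Module.Projective B N]
    [Module.Finite B N] : Module.Projective (A ⊗[k] B) (OuterTensor k M N) :=
  Module.Projective.of_lifting_property fun {Y Z} _ _ _ _ p f hp =>
    OuterTensor.exists_comp_eq (Y := ModuleCat.of _ Y) (Z := ModuleCat.of _ Z) (p := p) hp f

instance OuterTensor.instModuleBase : Module k (OuterTensor k M N) :=
  inferInstanceAs (Module k (M ⊗[k] N))

theorem OuterTensor.isScalarTower :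
    IsScalarTower k (A ⊗[k] B) (OuterTensor k M N) := ⟨fun c r z => by
  rw [OuterTensor.smul_def, map_smul]
  rfl⟩

theorem OuterTensor.finite [FiniteDimensional k A] [FiniteDimensional k B] [Module.Finite A M]
    [Module.Finite B N] : Module.Finite (A ⊗[k] B) (OuterTensor k M N) := by
  have h1 : Module.Finite k M := Module.Finite.trans A M
  have h2 : Module.Finite k N := Module.Finite.trans B N
  have h3 : Module.Finite k (OuterTensor k M N) := inferInstanceAs (Module.Finite k (M ⊗[k] N))
  have := OuterTensor.isScalarTower (k := k) (A := A) (B := B) (M := M) (N := N)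
  exact Module.Finite.of_restrictScalars_finite k (A ⊗[k] B) _

/-- The map `f ⊗ g` of outer tensor products. -/
def outerMap (f : M →ₗ[A] M') (g : N →ₗ[B] N') :
    OuterTensor k M N →ₗ[A ⊗[k] B] OuterTensor k M' N' :=
  OuterTensor.lift (Z := OuterTensor k M' N')
    (TensorProduct.map (f.restrictScalars k) (g.restrictScalars k)).toAddMonoidHom
    fun a b m n => by
      change f (a • m) ⊗ₜ[k] g (b • n) = (a • f m) ⊗ₜ[k] (b • g n)
      rw [map_smul, map_smul]

theorem outerMap_tmul (f : M →ₗ[A] M') (g : N →ₗ[B] N') (m : M) (n : N) :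
    outerMap f g (OuterTensor.tmul k m n) = OuterTensor.tmul k (f m) (g n) := rfl

/-- Y is finitely generated projective over A too, because B is finite-dimensional. Each curried map
therefore extends along i, and the dual basis reassembles the extensions. -/
theorem exists_comp_outerMap_eq [FiniteDimensional k B] [Module.Finite B N]
    [Module.Projective B N] [Module.Finite (A ⊗[k] B) Y] [Module.Projective (A ⊗[k] B) Y]
    {i : M →ₗ[A] M'} (hi : ∀ f : M →ₗ[A] A, ∃ g : M' →ₗ[A] A, g ∘ₗ i = f)
    (f : OuterTensor k M N →ₗ[A ⊗[k] B] Y) :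
    ∃ g : OuterTensor k M' N →ₗ[A ⊗[k] B] Y, g ∘ₗ outerMap i LinearMap.id = f := by
  obtain ⟨m, φ, x, hx⟩ := exists_dual_basis B N
  have hp' : Module.Projective A Y := projective_left
  have hf' : Module.Finite A Y := finite_left
  choose g hg using fun c => exists_extend_of_projective hi (outerCurry f (x c))
  refine ⟨∑ c, outerPairing (g c) (φ c), ?_⟩
  conv_rhs => rw [← sum_outerPairing_outerCurry f hx]
  refine OuterTensor.hom_ext fun m n => ?_
  rw [LinearMap.comp_apply, LinearMap.sum_apply, LinearMap.sum_apply]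
  refine Finset.sum_congr rfl fun c _ => ?_
  rw [← hg, outerMap_tmul]
  rfl

variable (N) in
/-- Tensoring a projective step over `A` with a projective `B`-module. -/
theorem IsProjStep.outerMap [FiniteDimensional k A] [FiniteDimensional k B]
    [Module.Finite B N] [Module.Projective B N] {i : M →ₗ[A] M'} {p : M' →ₗ[A] M''}
    (h : IsProjStep i p) : IsProjStep (outerMap (k := k) i (LinearMap.id : N →ₗ[B] N))
      (outerMap (k := k) p (LinearMap.id : N →ₗ[B] N)) := by
  have := h.finite
  have := h.projective
  have hp : Module.Projective (A ⊗[k] B) (ModuleCat.of (A ⊗[k] B) (A ⊗[k] B)) :=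
    inferInstanceAs (Module.Projective _ (A ⊗[k] B))
  have hf : Module.Finite (A ⊗[k] B) (ModuleCat.of (A ⊗[k] B) (A ⊗[k] B)) :=
    inferInstanceAs (Module.Finite _ (A ⊗[k] B))
  exact ⟨OuterTensor.finite, OuterTensor.projective,
    Module.Flat.rTensor_preserves_injective_linearMap (i.restrictScalars k) h.injective,
    rTensor_exact N (f := i.restrictScalars k) (g := p.restrictScalars k) h.exact h.surjective,
    LinearMap.rTensor_surjective N (g := p.restrictScalars k) h.surjective,
    fun f => exists_comp_outerMap_eq (Y := ModuleCat.of (A ⊗[k] B) (A ⊗[k] B)) h.extend f⟩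

end OuterMaps

/-! ### Filtered modules are Gorenstein projective; Gorenstein projectives restrict to projectives
over B -/

section FiltGproj

variable {k : Type u} [Field k] {A B : Type u} [Ring A] [Algebra k A] [Ring B] [Algebra k B]

/-- The `k`-action on a module over a `k`-algebra. -/
abbrev baseModule (k : Type u) [Field k] {A : Type u} [Ring A] [Algebra k A]
    (X : Type u) [AddCommGroup X] [Module A X] : Module k X :=
  Module.compHom X (algebraMap k A)

theorem baseModule_isScalarTower (k : Type u) [Field k] {A : Type u} [Ring A] [Algebra k A]
    (X : Type u) [AddCommGroup X] [Module A X] :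
    letI := baseModule k (A := A) X
    IsScalarTower k A X :=
  letI := baseModule k (A := A) X
  ⟨fun c a x => by rw [Algebra.smul_def, mul_smul]; rfl⟩

/-- Tensoring with N turns projective steps over A into projective steps over A ⊗ B, so the modules
M ⊗ N with M Gorenstein projective form a stable class. -/
theorem gproj_outerTensor [FiniteDimensional k A] [FiniteDimensional k B]
    (N : Type u) [AddCommGroup N] [Module k N] [Module B N] [IsScalarTower k B N]
    [Module.Finite B N] [Module.Projective B N]
    (M : Type u) [AddCommGroup M] [Module k M] [Module A M] [IsScalarTower k A M]
    (hM : Gproj A (ModuleCat.of A M)) :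
    Gproj (A ⊗[k] B) (ModuleCat.of (A ⊗[k] B) (OuterTensor k M N)) := by
  let 𝒢 : ObjectProperty (ModuleCat.{u} (A ⊗[k] B)) := fun Z =>
    ∃ (M : Type u) (_ : AddCommGroup M) (_ : Module k M) (_ : Module A M)
      (_ : IsScalarTower k A M), Gproj A (ModuleCat.of A M) ∧
        Z = ModuleCat.of (A ⊗[k] B) (OuterTensor k M N)
  have h𝒢 : GorensteinStable 𝒢 := by
    refine ⟨?_, ?_, ?_⟩
    · rintro _ ⟨M, _, _, _, _, hM, rfl⟩
      have : Module.Finite A M := hM.1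
      exact OuterTensor.finite
    · rintro _ ⟨M, _, _, _, _, hM, rfl⟩
      obtain ⟨M', hM', P, i, p, h⟩ := gorensteinStable_gproj.next _ hM
      let _ := baseModule k (A := A) P
      let _ := baseModule k (A := A) M'
      have := baseModule_isScalarTower k (A := A) P
      have := baseModule_isScalarTower k (A := A) M'
      exact ⟨ModuleCat.of _ (OuterTensor k M' N), ⟨M', _, _, _, inferInstance, hM', rfl⟩,
        ModuleCat.of _ (OuterTensor k P N), _, _, IsProjStep.outerMap N h⟩
    · rintro _ ⟨M, _, _, _, _, hM, rfl⟩
      obtain ⟨M', hM', P, i, p, h⟩ := gorensteinStable_gproj.prev _ hM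
      let _ := baseModule k (A := A) P
      let _ := baseModule k (A := A) M'
      have := baseModule_isScalarTower k (A := A) P
      have := baseModule_isScalarTower k (A := A) M'
      exact ⟨ModuleCat.of _ (OuterTensor k M' N), ⟨M', _, _, _, inferInstance, hM', rfl⟩,
        ModuleCat.of _ (OuterTensor k P N), _, _, IsProjStep.outerMap N h⟩
  exact h𝒢.le_gproj _ ⟨M, _, _, _, ‹_›, hM, rfl⟩

theorem IsTriangularFamily.filt_le_gproj [FiniteDimensional k A] [FiniteDimensional k B]
    {n : ℕ} {e : Fin n → B} (he : IsTriangularFamily k e) :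
    filt (outerTensorClass k (Gproj A) (Gproj B)) ≤ Gproj (A ⊗[k] B) := by
  refine _root_.filt_le_gproj ?_
  rintro Z ⟨M, _, _, _, _, N, _, _, _, _, hM, hN, ⟨f⟩⟩
  have : Module.Projective B N := he.projective_of_gproj hN
  have : Module.Finite B N := hN.1
  exact gproj_of_linearEquiv (X := ModuleCat.of (A ⊗[k] B) (OuterTensor k M N)) f.symm
    (gproj_outerTensor N M hM)

/-- Gorenstein projective modules over `A ⊗ B` are projective over `B`. -/
theorem IsTriangularFamily.projective_right_of_gproj {n : ℕ} {e : Fin n → B}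
    (he : IsTriangularFamily k e) {X : ModuleCat.{u} (A ⊗[k] B)} (hX : Gproj (A ⊗[k] B) X) :
    Module.Projective B X := by
  refine projective_of_forall_embedding he.hasProjectiveDimensionLT (X := ModuleCat.of B X)
    (𝒢 := fun Z => ∃ X : ModuleCat.{u} (A ⊗[k] B), Gproj (A ⊗[k] B) X ∧ Z = ModuleCat.of B X)
    ?_ ⟨X, hX, rfl⟩
  rintro _ ⟨X, hX, rfl⟩
  obtain ⟨Y, hY, P, i, p, h⟩ := gorensteinStable_gproj.next X hX
  have := h.projective
  exact ⟨ModuleCat.of B P, ModuleCat.of B Y, resRight i, resRight p, ⟨Y, hY, rfl⟩,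
    projective_right, h.injective, h.exact, h.surjective⟩

end FiltGproj

/-! ### Maps out of balanced tensor products -/

section BalancedLift

variable {R L M : Type u} [Ring R] [Ring L] [AddCommGroup M] [Module R M] [Module Lᵐᵒᵖ M]
  {X T : Type u} [AddCommGroup X] [Module L X] [AddCommGroup T]

variable (R L) in
/-- The class of `m ⊗ x` in the balanced tensor product. -/
def balancedMk (m : M) (x : X) : BalancedTensor R L M X :=
  Submodule.Quotient.mk (m ⊗ₜ[ℤ] x)

variable (R) in
theorem balancedMk_op_smul (l : L) (m : M) (x : X) :
    balancedMk R L (MulOpposite.op l • m) x = balancedMk R L m (l • x) :=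
  (Submodule.Quotient.eq _).2 (Submodule.subset_span ⟨m, l, x, rfl⟩)

variable (R L) in
theorem balancedMk_add_left (m m' : M) (x : X) :
    balancedMk R L (m + m') x = balancedMk R L m x + balancedMk R L m' x :=
  congrArg (Submodule.Quotient.mk (p := balancedRelations R L M X)) (TensorProduct.add_tmul m m' x)

variable (R L) in
theorem balancedMk_add_right (m : M) (x x' : X) :
    balancedMk R L m (x + x') = balancedMk R L m x + balancedMk R L m x' :=
  congrArg (Submodule.Quotient.mk (p := balancedRelations R L M X)) (TensorProduct.tmul_add m x x')

theorem smul_balancedMk (r : R) (m : M) (x : X) :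
    r • balancedMk R L m x = balancedMk R L (r • m) x := rfl

@[elab_as_elim]
theorem BalancedTensor.induction {p : BalancedTensor R L M X → Prop} (zero : p 0)
    (mk : ∀ m x, p (balancedMk R L m x)) (add : ∀ y z, p y → p z → p (y + z))
    (z : BalancedTensor R L M X) : p z := by
  obtain ⟨z, rfl⟩ := Submodule.Quotient.mk_surjective _ z
  induction z using TensorProduct.induction_on with
  | zero => exact zero
  | tmul m x => exact mk m x
  | add a b ha hb => exact add _ _ ha hb

variable [SMulCommClass R Lᵐᵒᵖ M]

/-- The additive map out of `M ⊗_L X` given by a balanced biadditive map. -/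
def balancedLift (f : M →+ X →+ T)
    (hf : ∀ (l : L) m x, f (MulOpposite.op l • m) x = f m (l • x)) :
    BalancedTensor R L M X →+ T :=
  let φ : M ⊗[ℤ] X →+ T := TensorProduct.liftAddHom f fun r m x => by
    rw [map_zsmul, map_zsmul, AddMonoidHom.zsmul_apply]
  QuotientAddGroup.lift (balancedRelations R L M X).toAddSubgroup φ (by
    intro z hz
    -- The relations are spanned over R while φ is only additive, so all multiples r z are treated
    -- at once.
    have key : ∀ r : R, φ (r • z) = 0 := by
      change z ∈ Submodule.span R _ at hz
      induction hz using Submodule.span_induction with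
      | mem z hz =>
        obtain ⟨m, l, x, rfl⟩ := hz
        intro r
        rw [smul_sub, map_sub, TensorProduct.smul_tmul', TensorProduct.smul_tmul', smul_comm]
        exact sub_eq_zero.2 (hf l (r • m) x)
      | zero => intro r; rw [smul_zero, map_zero]
      | add y z _ _ hy hz => intro r; rw [smul_add, map_add, hy, hz, add_zero]
      | smul s z _ hz => intro r; rw [smul_smul, hz]
    have := key 1
    rwa [one_smul] at this)

end BalancedLift

/-! ### The functor (A ⊗ V) ⊗ − as a tensor product over B -/

section RightTensor

variable {k : Type u} [Field k] {A B : Type u} [Ring A] [Algebra k A] [Ring B] [Algebra k B]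
  {V : Type u} [AddCommGroup V] [Module k V] [Module Bᵐᵒᵖ V] [IsScalarTower k Bᵐᵒᵖ V]
  {X Y Z : ModuleCat.{u} (A ⊗[k] B)}

variable (V X) in
/-- The `A`-module `(A ⊗ V) ⊗_{A ⊗ B} X`. -/
abbrev RightTensor : Type u := BalancedTensor A (A ⊗[k] B) (BimoduleTensor k A V) X

/-- The class of `(a ⊗ v) ⊗ x`. -/
def rightMk (a : A) (v : V) (x : X) : RightTensor V X :=
  balancedMk A (A ⊗[k] B) (show BimoduleTensor k A V from a ⊗ₜ v) x

/-- The class of `(1 ⊗ v) ⊗ x`. -/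
def rightTmul (v : V) : X →+ RightTensor V X :=
  AddMonoidHom.mk' (rightMk 1 v) fun x y => balancedMk_add_right _ _ _ x y

/-- Moving a across the tensor sign makes the factor A redundant: (A ⊗ V) ⊗_Λ X is V ⊗_B X with A
acting through X, and the symbols `rightTmul v x` generate it. -/
theorem rightMk_eq (a : A) (v : V) (x : X) : rightMk a v x = rightTmul v (a • x) := by
  rw [tensorLeft_smul_def]
  refine Eq.trans ?_ (balancedMk_op_smul A (a ⊗ₜ[k] (1 : B)) _ x)
  rw [BimoduleTensor.op_smul_tmul, one_mul, MulOpposite.op_one, one_smul]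
  rfl

theorem rightTmul_op_smul (b : B) (v : V) (x : X) :
    rightTmul (MulOpposite.op b • v) x = rightTmul v (b • x) := by
  rw [tensorRight_smul_def]
  refine Eq.trans ?_ (balancedMk_op_smul A ((1 : A) ⊗ₜ[k] b) _ x)
  rw [BimoduleTensor.op_smul_tmul, one_mul]
  rfl

theorem rightTmul_add (v w : V) (x : X) :
    rightTmul (v + w) x = rightTmul v x + rightTmul w x := by
  refine Eq.trans ?_ (balancedMk_add_left A (A ⊗[k] B) _ _ x)
  exact congrArg (fun m : BimoduleTensor k A V => balancedMk A (A ⊗[k] B) m x)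
    (TensorProduct.tmul_add (1 : A) v w)

theorem smul_rightTmul (a : A) (v : V) (x : X) : a • rightTmul v x = rightTmul v (a • x) := by
  rw [← rightMk_eq]
  refine (smul_balancedMk a _ x).trans ?_
  rw [BimoduleTensor.smul_tmul, mul_one]
  rfl

@[elab_as_elim]
theorem RightTensor.induction {p : RightTensor V X → Prop} (zero : p 0)
    (mk : ∀ v x, p (rightTmul v x)) (add : ∀ y z, p y → p z → p (y + z))
    (z : RightTensor V X) : p z := by
  induction z using BalancedTensor.induction with
  | zero => exact zero
  | mk m x =>
    refine TensorProduct.induction_on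
      (motive := fun m : A ⊗[k] V => p (balancedMk A (A ⊗[k] B) (show BimoduleTensor k A V from m) x))
      m ?_ ?_ ?_
    · have : balancedMk A (A ⊗[k] B) (0 : BimoduleTensor k A V) x = 0 := by
        have h := balancedMk_add_left A (A ⊗[k] B) (0 : BimoduleTensor k A V) 0 x
        rwa [add_zero, left_eq_add] at h
      exact this ▸ zero
    · intro a v
      exact (congrArg p (rightMk_eq a v x)).mpr (mk v (a • x))
    · intro m n hm hn
      have h := balancedMk_add_left A (A ⊗[k] B) (show BimoduleTensor k A V from m)
        (show BimoduleTensor k A V from n) x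
      exact h ▸ add _ _ hm hn
  | add y z hy hz => exact add _ _ hy hz

theorem smul_eq_op_algebraMap_smul (c : k) (v : V) :
    c • v = MulOpposite.op (algebraMap k B c) • v := by
  rw [← MulOpposite.algebraMap_apply, algebraMap_smul]

section Lift

variable {T : Type u} [AddCommGroup T]

/-- The additive map out of `(A ⊗ V) ⊗ X` given by a `B`-balanced map on `V × X`. -/
def rightLift (f : V →+ X →+ T)
    (hf : ∀ (b : B) v x, f (MulOpposite.op b • v) x = f v (b • x)) : RightTensor V X →+ T :=
  let g : A →+ V →+ X →+ T := AddMonoidHom.mk'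
    (fun a => AddMonoidHom.mk' (fun v => (f v).comp (DistribSMul.toAddMonoidHom X a))
      fun v w => by ext x; simp)
    fun a b => by ext v x; simp [add_smul]
  let G : BimoduleTensor k A V →+ X →+ T := TensorProduct.liftAddHom g fun c a v => by
    ext x
    change f v ((c • a) • x) = f (c • v) (a • x)
    rw [smul_eq_op_algebraMap_smul (B := B), hf, smul_assoc, algebraMap_smul]
  balancedLift G fun l m x => by
    induction l using TensorProduct.induction_on with
    | zero => simp
    | add l l' hl hl' =>
      rw [MulOpposite.op_add, add_smul, add_smul, map_add, map_add, ← hl, ← hl']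
      rfl
    | tmul a b =>
      refine TensorProduct.induction_on
        (motive := fun m : A ⊗[k] V => G (MulOpposite.op (a ⊗ₜ[k] b) •
          (show BimoduleTensor k A V from m)) x = G (show BimoduleTensor k A V from m)
            ((a ⊗ₜ[k] b) • x)) m ?_ ?_ ?_
      · change G (MulOpposite.op (a ⊗ₜ[k] b) • (0 : BimoduleTensor k A V)) x =
          G (0 : BimoduleTensor k A V) _
        rw [smul_zero, map_zero]
        rfl
      · intro a' v
        change f (MulOpposite.op b • v) ((a' * a) • x) = f v (a' • (a ⊗ₜ[k] b) • x)
        rw [hf, tmul_smul_eq', mul_smul, smul_comm b, smul_comm b]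
      · intro m n hm hn
        change G (MulOpposite.op (a ⊗ₜ[k] b) •
          ((show BimoduleTensor k A V from m) + (show BimoduleTensor k A V from n))) x =
          G ((show BimoduleTensor k A V from m) + (show BimoduleTensor k A V from n)) _
        rw [smul_add, map_add, map_add, AddMonoidHom.add_apply, AddMonoidHom.add_apply, hm, hn]

@[simp]
theorem rightLift_tmul (f : V →+ X →+ T)
    (hf : ∀ (b : B) v x, f (MulOpposite.op b • v) x = f v (b • x)) (v : V) (x : X) :
    rightLift f hf (rightTmul v x) = f v x := by
  change f v ((1 : A) • x) = f v x
  rw [one_smul]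

/-- The `A`-linear map out of `(A ⊗ V) ⊗ X` given by a balanced map on `V × X`, linear in `X`. -/
def rightLiftLinear [Module A T] (f : V →+ X →+ T)
    (hf : ∀ (b : B) v x, f (MulOpposite.op b • v) x = f v (b • x))
    (hA : ∀ (a : A) v x, f v (a • x) = a • f v x) : RightTensor V X →ₗ[A] T :=
  { rightLift f hf with
    map_smul' := fun a z => by
      change rightLift f hf (a • z) = a • rightLift f hf z
      induction z using RightTensor.induction with
      | zero => rw [smul_zero, map_zero, smul_zero]
      | mk v x => rw [smul_rightTmul, rightLift_tmul, rightLift_tmul, hA]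
      | add y z hy hz => rw [smul_add, map_add, map_add, smul_add, hy, hz] }

@[simp]
theorem rightLiftLinear_tmul [Module A T] (f : V →+ X →+ T)
    (hf : ∀ (b : B) v x, f (MulOpposite.op b • v) x = f v (b • x))
    (hA : ∀ (a : A) v x, f v (a • x) = a • f v x) (v : V) (x : X) :
    rightLiftLinear f hf hA (rightTmul v x) = f v x :=
  rightLift_tmul f hf v x

end Lift

variable (V) in
/-- The map `(A ⊗ V) ⊗ X → (A ⊗ V) ⊗ Y` induced by a `B`-linear map. -/
def rightMap (f : X →ₗ[B] Y) : RightTensor V X →+ RightTensor V Y :=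
  rightLift (AddMonoidHom.mk' (fun v => (rightTmul v).comp f.toAddMonoidHom)
    fun v w => by ext x; exact rightTmul_add v w _)
    fun b v x => by
      change rightTmul _ (f x) = rightTmul v (f (b • x))
      rw [rightTmul_op_smul, f.map_smul]

@[simp]
theorem rightMap_tmul (f : X →ₗ[B] Y) (v : V) (x : X) :
    rightMap V f (rightTmul v x) = rightTmul v (f x) :=
  rightLift_tmul _ _ v x

theorem rightTensor_hom_ext {T : Type*} [AddCommGroup T] {f g : RightTensor V X →+ T}
    (h : ∀ v x, f (rightTmul v x) = g (rightTmul v x)) : f = g := by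
  ext z
  induction z using RightTensor.induction with
  | zero => rw [map_zero, map_zero]
  | mk v x => exact h v x
  | add y z hy hz => rw [map_add, map_add, hy, hz]

theorem rightMap_comp (g : Y →ₗ[B] Z) (f : X →ₗ[B] Y) :
    rightMap V (g ∘ₗ f) = (rightMap V g).comp (rightMap V f) :=
  rightTensor_hom_ext fun v x => by simp

theorem rightMap_id : rightMap V (LinearMap.id : X →ₗ[B] X) = AddMonoidHom.id _ :=
  rightTensor_hom_ext fun v x => by simp

theorem rightMap_add (f g : X →ₗ[B] Y) : rightMap V (f + g) = rightMap V f + rightMap V g :=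
  rightTensor_hom_ext fun v x => by simp

variable (V) in
/-- The map induced by an `A ⊗ B`-linear map. -/
abbrev rightMapLinear (f : X →ₗ[A ⊗[k] B] Y) : RightTensor V X →ₗ[A] RightTensor V Y :=
  balancedMap A (A ⊗[k] B) (BimoduleTensor k A V) f

theorem rightMapLinear_tmul (f : X →ₗ[A ⊗[k] B] Y) (v : V) (x : X) :
    rightMapLinear V f (rightTmul v x) = rightTmul v (f x) := rfl

/-- The induced map depends only on the underlying B-linear map. Splittings and contractions that
exist over B alone can thus be pushed through the tensor product. -/
theorem rightMapLinear_apply (f : X →ₗ[A ⊗[k] B] Y) (z : RightTensor V X) :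
    rightMapLinear V f z = rightMap V (resRight f) z :=
  DFunLike.congr_fun (rightTensor_hom_ext (f := (rightMapLinear V f).toAddMonoidHom)
    fun v x => by rw [rightMap_tmul]; rfl) z

/-- A short exact sequence of `A ⊗ B`-modules ending in a `B`-projective module stays exact. -/
theorem rightMapLinear_exact {i : X →ₗ[A ⊗[k] B] Y} {p : Y →ₗ[A ⊗[k] B] Z}
    [Module.Projective B Z] (hi : Function.Injective i) (hip : Function.Exact i p)
    (hp : Function.Surjective p) :
    Function.Injective (rightMapLinear V i) ∧
      Function.Exact (rightMapLinear V i) (rightMapLinear V p) ∧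
      Function.Surjective (rightMapLinear V p) := by
  -- The sequence splits over B, and `rightMap` preserves the splitting identities.
  obtain ⟨s, hs⟩ := (resRight p).exists_rightInverse_of_surjective (LinearMap.range_eq_top.2 hp)
  have hps : ∀ z, p (s z) = z := LinearMap.congr_fun hs
  have hmem : ∀ y, (LinearMap.id - s ∘ₗ resRight p : Y →ₗ[B] Y) y ∈ LinearMap.range (resRight i) :=
    fun y => (hip _).1 (by simp [hps])
  let r : Y →ₗ[B] X := (LinearEquiv.ofInjective (resRight i) hi).symm.toLinearMap ∘ₗ
    (LinearMap.id - s ∘ₗ resRight p).codRestrict _ hmem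
  have hir : ∀ y, i (r y) = y - s (p y) := fun y => congrArg Subtype.val
    ((LinearEquiv.ofInjective (resRight i) hi).apply_symm_apply ⟨_, hmem y⟩)
  have hri : ∀ x, r (i x) = x := fun x => hi (by
    rw [hir, (hip _).2 ⟨x, rfl⟩, map_zero, sub_zero])
  have h1 : (rightMap V r).comp (rightMap V (resRight i)) = AddMonoidHom.id _ := by
    rw [← rightMap_comp, ← rightMap_id]
    exact congrArg _ (LinearMap.ext hri)
  have h2 : (rightMap V (resRight p)).comp (rightMap V s) = AddMonoidHom.id _ := by
    rw [← rightMap_comp, ← rightMap_id]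
    exact congrArg _ (LinearMap.ext hps)
  have h3 : (rightMap V (resRight i)).comp (rightMap V r) +
      (rightMap V s).comp (rightMap V (resRight p)) = AddMonoidHom.id _ := by
    rw [← rightMap_comp, ← rightMap_comp, ← rightMap_add, ← rightMap_id]
    exact congrArg _ (LinearMap.ext fun y => by simp [hir])
  refine ⟨fun x y hxy => ?_, fun y => ⟨fun hy => ?_, ?_⟩, fun z => ⟨rightMap V s z, ?_⟩⟩
  · rw [rightMapLinear_apply, rightMapLinear_apply] at hxy
    have h := congrArg (rightMap V r) hxy
    exact (DFunLike.congr_fun h1 x).symm.trans (h.trans (DFunLike.congr_fun h1 y))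
  · rw [rightMapLinear_apply] at hy
    have h := DFunLike.congr_fun h3 y
    refine ⟨rightMap V r y, ?_⟩
    rw [rightMapLinear_apply]
    simpa [hy] using h
  · rintro ⟨x, rfl⟩
    rw [rightMapLinear_apply, rightMapLinear_apply, ← AddMonoidHom.comp_apply, ← rightMap_comp]
    have : resRight p ∘ₗ resRight i = 0 := LinearMap.ext fun x => (hip _).2 ⟨x, rfl⟩
    rw [this]
    have h0 : rightMap V (0 : X →ₗ[B] Z) = 0 := rightTensor_hom_ext fun v x => by simp
    rw [h0]; rfl
  · rw [rightMapLinear_apply]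
    exact DFunLike.congr_fun h2 z

/-- X is finitely generated over A, and elements of B move across to X, so finitely many generators
of V give a surjection from a finite power of X. -/
theorem finite_rightTensor [FiniteDimensional k B] [Module.Finite Bᵐᵒᵖ V]
    [Module.Finite (A ⊗[k] B) X] : Module.Finite A (RightTensor V X) := by
  have h1 : Module.Finite A X := finite_left
  have h2 : Module.Finite k Bᵐᵒᵖ := Module.Finite.equiv (MulOpposite.opLinearEquiv k : B ≃ₗ[k] Bᵐᵒᵖ)
  obtain ⟨S, hS⟩ := (inferInstance : Module.Finite Bᵐᵒᵖ V).fg_top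
  let ψ : (S → X) →ₗ[A] RightTensor V X :=
    { toFun := fun x => ∑ v, rightTmul v.1 (x v)
      map_add' := fun x y => by simp [Finset.sum_add_distrib]
      map_smul' := fun a x => by simp [Finset.smul_sum, smul_rightTmul] }
  refine Module.Finite.of_surjective ψ fun z => ?_
  induction z using RightTensor.induction with
  | zero => exact ⟨0, map_zero ψ⟩
  | add y z hy hz =>
    obtain ⟨y, rfl⟩ := hy
    obtain ⟨z, rfl⟩ := hz
    exact ⟨y + z, map_add ψ y z⟩
  | mk v x =>
    have hv : v ∈ Submodule.span Bᵐᵒᵖ (S : Set V) := by rw [hS]; trivial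
    induction hv using Submodule.span_induction generalizing x with
    | mem v hv =>
      classical
      refine ⟨Pi.single ⟨v, hv⟩ x, ?_⟩
      change ∑ w : S, rightTmul w.1 ((Pi.single ⟨v, hv⟩ x : S → X) w) = _
      rw [Finset.sum_eq_single ⟨v, hv⟩]
      · rw [Pi.single_eq_same]
      · intro w _ hw
        rw [Pi.single_eq_of_ne hw, map_zero]
      · simp
    | zero =>
      refine ⟨0, ?_⟩
      have h := rightTmul_add (0 : V) 0 x
      rw [add_zero, left_eq_add] at h
      rw [h, map_zero]
    | add v w _ _ hv hw =>
      obtain ⟨y, hy⟩ := hv x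
      obtain ⟨z, hz⟩ := hw x
      exact ⟨y + z, by rw [map_add, hy, hz, rightTmul_add]⟩
    | smul b v _ hv =>
      obtain ⟨y, hy⟩ := hv (b.unop • x)
      exact ⟨y, by rw [hy, ← rightTmul_op_smul, MulOpposite.op_unop]⟩

end RightTensor

/-! ### The dual of a right module -/

section LeftDual

variable (k : Type u) [Field k] {B : Type u} [Ring B] [Algebra k B]
  (V : Type u) [AddCommGroup V] [Module k V]

/-- The `k`-dual of a right `B`-module, with its left `B`-action `(b f)(v) = f (v b)`. -/
def LeftDual : Type u := V →ₗ[k] k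

instance LeftDual.instAddCommGroup : AddCommGroup (LeftDual k V) :=
  inferInstanceAs (AddCommGroup (V →ₗ[k] k))

instance LeftDual.instModule : Module k (LeftDual k V) :=
  inferInstanceAs (Module k (V →ₗ[k] k))

/-- An element of the dual as a linear form. -/
def LeftDual.eval (f : LeftDual k V) : V →ₗ[k] k := f

variable [Module Bᵐᵒᵖ V] [IsScalarTower k Bᵐᵒᵖ V]

instance LeftDual.instModuleLeft : Module B (LeftDual k V) where
  smul b f := (f.eval k V).comp (Algebra.lsmul k k V (MulOpposite.op b))
  one_smul f := LinearMap.ext fun v => congrArg (f.eval k V) (one_smul Bᵐᵒᵖ v)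
  mul_smul a b f := LinearMap.ext fun v =>
    congrArg (f.eval k V) (mul_smul (MulOpposite.op b) (MulOpposite.op a) v)
  smul_zero _ := rfl
  smul_add _ _ _ := rfl
  add_smul a b f := LinearMap.ext fun v =>
    (congrArg (f.eval k V) (add_smul (MulOpposite.op a) (MulOpposite.op b) v)).trans
      (map_add (f.eval k V) _ _)
  zero_smul f := LinearMap.ext fun v =>
    (congrArg (f.eval k V) (zero_smul Bᵐᵒᵖ v)).trans (map_zero (f.eval k V))

theorem LeftDual.smul_apply (b : B) (f : LeftDual k V) (v : V) :
    (b • f).eval k V v = f.eval k V (MulOpposite.op b • v) := rfl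

instance LeftDual.instIsScalarTower : IsScalarTower k B (LeftDual k V) where
  smul_assoc c b f := LinearMap.ext fun v =>
    (congrArg (f.eval k V) (smul_assoc c (MulOpposite.op b) v)).trans (map_smul (f.eval k V) c _)

end LeftDual

/-! ### The adjunction between (A ⊗ V) ⊗ − and − ⊗ D(V) -/

section Adjunction

variable {k : Type u} [Field k] {A B : Type u} [Ring A] [Algebra k A] [Ring B] [Algebra k B]
  {V : Type u} [AddCommGroup V] [Module k V] [Module Bᵐᵒᵖ V] [IsScalarTower k Bᵐᵒᵖ V]
  {X P : ModuleCat.{u} (A ⊗[k] B)} {Y Z : Type u} [AddCommGroup Y] [Module k Y] [Module A Y]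
  [IsScalarTower k A Y] [AddCommGroup Z] [Module k Z] [Module A Z] [IsScalarTower k A Z]

/-- Evaluation `y ⊗ φ ↦ φ(v) y`. -/
def outerEval (v : V) : OuterTensor k Y (LeftDual k V) →+ Y :=
  (TensorProduct.lift (LinearMap.mk₂ k (fun (y : Y) (φ : LeftDual k V) => φ.eval k V v • y)
    (fun _ _ _ => smul_add _ _ _) (fun _ _ _ => smul_comm _ _ _) (fun _ _ _ => add_smul _ _ _)
    (fun c y φ => mul_smul c (φ.eval k V v) y))).toAddMonoidHom

theorem outerEval_tmul (v : V) (y : Y) (φ : LeftDual k V) :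
    outerEval v (OuterTensor.tmul k y φ) = φ.eval k V v • y := rfl

theorem outerEval_add (v w : V) (z : OuterTensor k Y (LeftDual k V)) :
    outerEval (v + w) z = outerEval v z + outerEval w z := by
  induction z using OuterTensor.induction with
  | zero => simp only [map_zero, add_zero]
  | tmul y φ => rw [outerEval_tmul, outerEval_tmul, outerEval_tmul, map_add, add_smul]
  | add y z hy hz => rw [map_add, map_add, map_add, hy, hz]; abel

theorem outerEval_smul (a : A) (b : B) (v : V) (z : OuterTensor k Y (LeftDual k V)) :
    outerEval v ((a ⊗ₜ[k] b) • z) = a • outerEval (MulOpposite.op b • v) z := by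
  induction z using OuterTensor.induction with
  | zero => simp only [smul_zero, map_zero]
  | tmul y φ =>
    rw [OuterTensor.smul_tmul, outerEval_tmul, outerEval_tmul, LeftDual.smul_apply, smul_comm]
  | add y z hy hz => rw [smul_add, map_add, map_add, smul_add, hy, hz]

theorem outerEval_outerMap (p : Y →ₗ[A] Z) (v : V) (z : OuterTensor k Y (LeftDual k V)) :
    outerEval v (outerMap p (LinearMap.id : LeftDual k V →ₗ[B] LeftDual k V) z) =
      p (outerEval v z) := by
  induction z using OuterTensor.induction with
  | zero => simp only [map_zero]
  | tmul y φ =>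
    rw [outerMap_tmul, outerEval_tmul, outerEval_tmul, ← algebraMap_smul A, ← algebraMap_smul A,
      map_smul]
    rfl
  | add y z hy hz => rw [map_add, map_add, map_add, map_add, hy, hz]

/-- Expansion in the dual basis of D(V). It shows that the evaluations at vectors of V separate the
elements of Y ⊗ D(V). -/
theorem sum_outerEval {ι : Type*} [Fintype ι] (b : Module.Basis ι k V)
    (z : OuterTensor k Y (LeftDual k V)) :
    ∑ s, OuterTensor.tmul k (outerEval (b s) z) (b.coord s : LeftDual k V) = z := by
  have hadd : ∀ (y y' : Y) (φ : LeftDual k V), OuterTensor.tmul k (y + y') φ =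
      OuterTensor.tmul k y φ + OuterTensor.tmul k y' φ := TensorProduct.add_tmul
  induction z using OuterTensor.induction with
  | zero =>
    refine Finset.sum_eq_zero fun s _ => ?_
    rw [map_zero]
    exact TensorProduct.zero_tmul _ _
  | tmul y φ =>
    have h : φ = ∑ s, φ.eval k V (b s) • (b.coord s : LeftDual k V) :=
      (b.sum_dual_apply_smul_coord φ).symm
    conv_rhs => rw [h]
    refine Eq.trans ?_ (TensorProduct.tmul_sum y Finset.univ _).symm
    exact Finset.sum_congr rfl fun s _ => TensorProduct.smul_tmul _ _ _
  | add y z hy hz =>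
    refine Eq.trans ?_ (congrArg₂ (· + ·) hy hz)
    refine Eq.trans (Finset.sum_congr rfl fun s _ => ?_) Finset.sum_add_distrib
    rw [map_add]
    exact hadd _ _ _

theorem outerEval_ext [FiniteDimensional k V] {y z : OuterTensor k Y (LeftDual k V)}
    (h : ∀ v, outerEval v y = outerEval v z) : y = z := by
  rw [← sum_outerEval (Module.finBasis k V) y, ← sum_outerEval (Module.finBasis k V) z]
  exact Finset.sum_congr rfl fun s _ => by rw [h]

theorem rightTmul_base_smul (c : k) (v : V) (x : X) :
    rightTmul (c • v) x = algebraMap k A c • rightTmul v x := by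
  rw [smul_eq_op_algebraMap_smul (B := B), rightTmul_op_smul, smul_rightTmul, algebraMap_smul,
    algebraMap_smul]

/-- The maps `(A ⊗ V) ⊗ X → Y` correspond to maps `X → Y ⊗ D(V)`. -/
theorem exists_outerEval_eq [FiniteDimensional k V] (f : RightTensor V X →ₗ[A] Y) :
    ∃ g : X →ₗ[A ⊗[k] B] OuterTensor k Y (LeftDual k V),
      ∀ v x, outerEval v (g x) = f (rightTmul v x) := by
  let b := Module.finBasis k V
  let g : X → OuterTensor k Y (LeftDual k V) := fun x =>
    ∑ s, OuterTensor.tmul k (f (rightTmul (b s) x)) (b.coord s : LeftDual k V)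
  have hg : ∀ v x, outerEval v (g x) = f (rightTmul v x) := by
    intro v x
    let φ : V →ₗ[k] Y :=
      { toFun := fun v => f (rightTmul v x)
        map_add' := fun v w => by rw [rightTmul_add, map_add]
        map_smul' := fun c v => by
          rw [rightTmul_base_smul, map_smul, algebraMap_smul, RingHom.id_apply] }
    rw [map_sum]
    change _ = φ v
    conv_rhs => rw [← b.sum_repr v, map_sum]
    refine Finset.sum_congr rfl fun s _ => ?_
    rw [map_smul]
    rfl
  refine ⟨{ toFun := g, map_add' := fun x y => outerEval_ext fun v => ?_,
            map_smul' := fun r x => ?_ }, hg⟩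
  · simp only [map_add, hg]
  · rw [RingHom.id_apply]
    induction r using TensorProduct.induction_on with
    | zero =>
      rw [zero_smul, zero_smul]
      exact outerEval_ext fun v => by simp only [hg, map_zero]
    | tmul a b =>
      refine outerEval_ext fun v => ?_
      rw [hg, outerEval_smul, hg, rightTmul_op_smul, tmul_smul_eq, ← smul_rightTmul, map_smul]
    | add r s hr hs =>
      rw [add_smul, add_smul, ← hr, ← hs]
      exact outerEval_ext fun v => by simp only [hg, map_add]

theorem exists_eq_outerEval (g : X →ₗ[A ⊗[k] B] OuterTensor k Y (LeftDual k V)) :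
    ∃ f : RightTensor V X →ₗ[A] Y, ∀ v x, f (rightTmul v x) = outerEval v (g x) := by
  refine ⟨rightLiftLinear (AddMonoidHom.mk' (fun v => (outerEval v).comp g.toAddMonoidHom)
    fun v w => by ext x; exact outerEval_add v w _) ?_ ?_, fun v x => rightLiftLinear_tmul _ _ _ v x⟩
  · intro b v x
    change outerEval _ (g x) = outerEval v (g (b • x))
    rw [tensorRight_smul_def, map_smul, outerEval_smul, one_smul]
  · intro a v x
    change outerEval v (g (a • x)) = a • outerEval v (g x)
    rw [tensorLeft_smul_def, map_smul, outerEval_smul, MulOpposite.op_one, one_smul]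

theorem rightTensor_hom_ext_linear {T : Type u} [AddCommGroup T] [Module A T]
    {f g : RightTensor V X →ₗ[A] T}
    (h : ∀ v x, f (rightTmul v x) = g (rightTmul v x)) : f = g :=
  LinearMap.ext fun z => DFunLike.congr_fun
    (rightTensor_hom_ext (f := f.toAddMonoidHom) (g := g.toAddMonoidHom) h) z

/-- A left adjoint of an exact functor preserves projectives: the lifting problem is transposed to
the surjection Y ⊗ D(V) → Z ⊗ D(V), solved over Λ, and transposed back. -/
theorem projective_rightTensor [FiniteDimensional k V] [Module.Projective (A ⊗[k] B) P] :
    Module.Projective A (RightTensor V P) := by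
  refine Module.Projective.of_lifting_property fun {Y Z} _ _ _ _ p f hp => ?_
  let _ := baseModule k (A := A) Y
  let _ := baseModule k (A := A) Z
  have := baseModule_isScalarTower k (A := A) Y
  have := baseModule_isScalarTower k (A := A) Z
  obtain ⟨g, hg⟩ := exists_outerEval_eq f
  obtain ⟨h, hh⟩ := Module.projective_lifting_property
    (outerMap (k := k) p (LinearMap.id : LeftDual k V →ₗ[B] LeftDual k V)) g
    (LinearMap.rTensor_surjective (LeftDual k V) (g := p.restrictScalars k) hp)
  obtain ⟨f', hf'⟩ := exists_eq_outerEval h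
  refine ⟨f', rightTensor_hom_ext_linear fun v x => ?_⟩
  rw [LinearMap.comp_apply, hf', ← hg, ← hh, LinearMap.comp_apply, outerEval_outerMap]

end Adjunction

/-! ### Gorenstein projectivity of (A ⊗ V) ⊗ X -/

section GprojMon

variable {k : Type u} [Field k] {A B : Type u} [Ring A] [Algebra k A] [Ring B] [Algebra k B]

/-- Maps from Gorenstein projective modules into `M ⊗ U` extend along projective steps when `M` is
projective and `U` has finite projective dimension. -/
theorem exists_extend_outerTensor [FiniteDimensional k A] [FiniteDimensional k B]
    {M : Type u} [AddCommGroup M] [Module k M] [Module A M] [IsScalarTower k A M]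
    [Module.Finite A M] [Module.Projective A M] (d : ℕ) :
    ∀ (U : Type u) [AddCommGroup U] [Module k U] [Module B U] [IsScalarTower k B U]
      [Module.Finite B U], HasProjectiveDimensionLT (ModuleCat.of B U) (d + 1) →
    ∀ (X P Y : ModuleCat.{u} (A ⊗[k] B)) (i : X →ₗ[A ⊗[k] B] P) (p : P →ₗ[A ⊗[k] B] Y),
      Gproj (A ⊗[k] B) X → IsProjStep i p → ∀ f : X →ₗ[A ⊗[k] B] OuterTensor k M U,
        ∃ g : P →ₗ[A ⊗[k] B] OuterTensor k M U, g ∘ₗ i = f := by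
  induction d with
  | zero =>
    intro U _ _ _ _ _ hU X P Y i p hX h f
    rw [zero_add] at hU
    have : Module.Projective B U := (IsProjective.iff_projective (ModuleCat.of B U)).2 inferInstance
    have h1 : Module.Projective (A ⊗[k] B) (OuterTensor k M U) := OuterTensor.projective
    have h2 : Module.Finite (A ⊗[k] B) (OuterTensor k M U) := OuterTensor.finite
    exact exists_extend_of_projective h.extend f
  | succ d ih =>
    intro U _ _ _ _ _ hU X P Y i p hX h f
    obtain ⟨m, π, hπ⟩ := Module.Finite.exists_fin' B U
    let K := LinearMap.ker π
    have : IsNoetherianRing B := IsNoetherianRing.of_finite k B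
    have hex : Function.Exact K.subtype π := LinearMap.exact_subtype_ker_map π
    have hFp : Projective (ModuleCat.of B (Fin m → B)) := inferInstance
    have hK := (shortExact_moduleCat K.injective_subtype hex hπ).hasProjectiveDimensionLT_X₁ (d + 1)
      (hasProjectiveDimensionLT_of_ge _ 1 _ (by lia)) hU
    let a : OuterTensor k M K →ₗ[A ⊗[k] B] OuterTensor k M (Fin m → B) :=
      outerMap LinearMap.id K.subtype
    let b : OuterTensor k M (Fin m → B) →ₗ[A ⊗[k] B] OuterTensor k M U := outerMap LinearMap.id π
    have hb : Function.Surjective b :=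
      LinearMap.lTensor_surjective M (g := π.restrictScalars k) hπ
    have hab : Function.Exact a b :=
      lTensor_exact M (f := K.subtype.restrictScalars k) (g := π.restrictScalars k) hex hπ
    have ha : Function.Injective a := Module.Flat.lTensor_preserves_injective_linearMap
      (K.subtype.restrictScalars k) K.injective_subtype
    have h1 : Module.Projective (A ⊗[k] B) (OuterTensor k M (Fin m → B)) := OuterTensor.projective
    have h2 : Module.Finite (A ⊗[k] B) (OuterTensor k M (Fin m → B)) := OuterTensor.finite
    -- The point is to lift f through b to a map w out of X. A lift s of f ∘ q to Q sends X' into M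
    -- ⊗ K; by induction this restriction extends to t' on Q, and s - a ∘ t' descends to X. Then w
    -- extends along i because its target is projective.
    obtain ⟨X', hX', Q, j, q, hjq⟩ := gorensteinStable_gproj.prev X hX
    have := hjq.projective
    obtain ⟨s, hs⟩ := Module.projective_lifting_property b (f ∘ₗ q) hb
    have hs' : ∀ y, b (s y) = f (q y) := LinearMap.congr_fun hs
    have hmem : ∀ z, s (j z) ∈ LinearMap.range a := fun z => (hab _).1 (by
      rw [hs', (hjq.exact _).2 ⟨z, rfl⟩, map_zero])
    let t : X' →ₗ[A ⊗[k] B] OuterTensor k M K :=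
      (LinearEquiv.ofInjective a ha).symm.toLinearMap ∘ₗ (s ∘ₗ j).codRestrict _ hmem
    have ht : ∀ z, a (t z) = s (j z) := fun z => congrArg Subtype.val
      ((LinearEquiv.ofInjective a ha).apply_symm_apply ⟨_, hmem z⟩)
    obtain ⟨t', ht'⟩ := ih K hK X' Q X j q hX' hjq t
    obtain ⟨w, hw⟩ := exists_comp_eq_of_ker_le (f := s - a ∘ₗ t') hjq.surjective (by
      intro y hy
      obtain ⟨z, rfl⟩ := (hjq.exact y).1 hy
      have : t' (j z) = t z := LinearMap.congr_fun ht' z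
      simp [this, ht])
    obtain ⟨g, hg⟩ := exists_extend_of_projective h.extend w
    refine ⟨b ∘ₗ g, ?_⟩
    rw [LinearMap.comp_assoc, hg]
    ext x
    obtain ⟨y, rfl⟩ := hjq.surjective x
    have h3 : w (q y) = s y - a (t' y) := LinearMap.congr_fun hw y
    rw [LinearMap.comp_apply, h3, map_sub, hs', (hab _).2 ⟨_, rfl⟩, sub_zero]

variable {n : ℕ} {e : Fin n → B}

/-- Projective steps between Gorenstein projectives are preserved: exactness holds because the last
term is B-projective, and a form into A transposes to a map into A ⊗ D(V), which extends because
D(V) has finite projective dimension. -/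
theorem IsTriangularFamily.gproj_rightTensor [FiniteDimensional k A] [FiniteDimensional k B]
    (he : IsTriangularFamily k e) (V : Type u) [AddCommGroup V] [Module k V] [Module Bᵐᵒᵖ V]
    [IsScalarTower k Bᵐᵒᵖ V] [Module.Finite Bᵐᵒᵖ V] {X : ModuleCat.{u} (A ⊗[k] B)}
    (hX : Gproj (A ⊗[k] B) X) : Gproj A (ModuleCat.of A (RightTensor V X)) := by
  have h2 : Module.Finite k Bᵐᵒᵖ := Module.Finite.equiv (MulOpposite.opLinearEquiv k : B ≃ₗ[k] Bᵐᵒᵖ)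
  have hV : FiniteDimensional k V := Module.Finite.trans Bᵐᵒᵖ V
  have hDk : Module.Finite k (LeftDual k V) := inferInstanceAs (Module.Finite k (V →ₗ[k] k))
  have hD : Module.Finite B (LeftDual k V) := Module.Finite.of_restrictScalars_finite k B _
  have step : ∀ {X P Y : ModuleCat.{u} (A ⊗[k] B)} (i : X →ₗ[A ⊗[k] B] P) (p : P →ₗ[A ⊗[k] B] Y),
      Gproj _ X → Gproj _ Y → IsProjStep i p →
        IsProjStep (rightMapLinear V i) (rightMapLinear V p) := by
    intro X P Y i p hX hY h
    have := h.finite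
    have := h.projective
    have := he.projective_right_of_gproj hY
    obtain ⟨h1, h2, h3⟩ := rightMapLinear_exact (V := V) h.injective h.exact h.surjective
    refine ⟨finite_rightTensor, projective_rightTensor, h1, h2, h3, fun f => ?_⟩
    obtain ⟨f', hf'⟩ := exists_outerEval_eq f
    have hpd := he.hasProjectiveDimensionLT (ModuleCat.of B (LeftDual k V))
    obtain ⟨g', hg'⟩ := exists_extend_outerTensor n (LeftDual k V)
      (hasProjectiveDimensionLT_of_ge _ n _ (by lia))
      X P Y i p hX h f'
    obtain ⟨g, hg⟩ := exists_eq_outerEval g'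
    refine ⟨g, rightTensor_hom_ext_linear fun v x => ?_⟩
    rw [LinearMap.comp_apply, rightMapLinear_tmul, hg, ← hf', ← hg', LinearMap.comp_apply]
  have : GorensteinStable (R := A) (fun Z => ∃ X : ModuleCat.{u} (A ⊗[k] B), Gproj _ X ∧
      Z = ModuleCat.of A (RightTensor V X)) := by
    refine ⟨?_, ?_, ?_⟩
    · rintro _ ⟨X, hX, rfl⟩
      have := hX.1
      exact finite_rightTensor
    · rintro _ ⟨X, hX, rfl⟩
      obtain ⟨Y, hY, P, i, p, h⟩ := gorensteinStable_gproj.next X hX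
      exact ⟨_, ⟨Y, hY, rfl⟩, ModuleCat.of A (RightTensor V P), _, _, step i p hX hY h⟩
    · rintro _ ⟨X, hX, rfl⟩
      obtain ⟨Y, hY, P, i, p, h⟩ := gorensteinStable_gproj.prev X hX
      exact ⟨_, ⟨Y, hY, rfl⟩, ModuleCat.of A (RightTensor V P), _, _, step i p hY hX h⟩
  exact this.le_gproj _ ⟨X, hX, rfl⟩

end GprojMon

/-! ### Vanishing of Tor for modules projective over B -/

section TorVanishing

variable {k : Type u} [Field k] {A B : Type u} [Ring A] [Algebra k A] [Ring B] [Algebra k B]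
  {V : Type u} [AddCommGroup V] [Module k V] [Module Bᵐᵒᵖ V] [IsScalarTower k Bᵐᵒᵖ V]

/-- `Tor` vanishes in degree `i + 1` exactly when `(A ⊗ V) ⊗ -` is exact at degree `i + 1` of a
projective resolution. -/
theorem subsingleton_balancedTor_iff {X : ModuleCat.{u} (A ⊗[k] B)} (Q : ProjectiveResolution X)
    (i : ℕ) :
    Subsingleton (balancedTor A (A ⊗[k] B) (BimoduleTensor k A V) (i + 1) X) ↔
      Function.Exact (rightMapLinear V (Q.complex.d (i + 2) (i + 1)).hom)
        (rightMapLinear V (Q.complex.d (i + 1) i).hom) := by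
  let F := balancedTensorFunctor A (A ⊗[k] B) (BimoduleTensor k A V)
  let C := (F.mapHomologicalComplex _).obj Q.complex
  have e : balancedTor A (A ⊗[k] B) (BimoduleTensor k A V) (i + 1) X ≅ C.homology (i + 1) :=
    Q.isoLeftDerivedObj F (i + 1)
  rw [← ModuleCat.isZero_iff_subsingleton, e.isZero_iff,
    ← HomologicalComplex.exactAt_iff_isZero_homology,
    HomologicalComplex.exactAt_iff' C (i + 2) (i + 1) i (by simp) (by simp)]
  exact ShortComplex.ShortExact.moduleCat_exact_iff_function_exact _

/-- A projective resolution of a projective module is contractible. Maps l with d l d = d are built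
upwards from a section of ε, each one being the correction that makes the next homotopy identity
hold. -/
theorem exists_contraction {R : Type u} [Ring R] {Q : ℕ → Type u} [∀ i, AddCommGroup (Q i)]
    [∀ i, Module R (Q i)] [∀ i, Module.Projective R (Q i)] {X : Type u} [AddCommGroup X]
    [Module R X] [Module.Projective R X] {d : ∀ i, Q (i + 1) →ₗ[R] Q i} {ε : Q 0 →ₗ[R] X}
    (hε : Function.Surjective ε) (h0 : Function.Exact (d 0) ε)
    (h : ∀ i, Function.Exact (d (i + 1)) (d i)) (i : ℕ) :
    ∃ (l : Q i →ₗ[R] Q (i + 1)) (l' : Q (i + 1) →ₗ[R] Q (i + 2)),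
      d (i + 1) ∘ₗ l' + l ∘ₗ d i = LinearMap.id := by
  have lift : ∀ (i : ℕ) (g : Q (i + 1) →ₗ[R] Q (i + 1)), d i ∘ₗ g = 0 →
      ∃ l' : Q (i + 1) →ₗ[R] Q (i + 2), d (i + 1) ∘ₗ l' = g := by
    intro i g hg
    obtain ⟨l', hl'⟩ := Module.projective_lifting_property (d (i + 1)).rangeRestrict
      (g.codRestrict _ fun x => (h i _).1 (LinearMap.congr_fun hg x))
      (d (i + 1)).surjective_rangeRestrict
    exact ⟨l', LinearMap.ext fun x => congrArg Subtype.val (LinearMap.congr_fun hl' x)⟩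
  have step : ∀ i (l : Q i →ₗ[R] Q (i + 1)), d i ∘ₗ l ∘ₗ d i = d i →
      ∃ l' : Q (i + 1) →ₗ[R] Q (i + 2), d (i + 1) ∘ₗ l' + l ∘ₗ d i = LinearMap.id := by
    intro i l hl
    obtain ⟨l', hl'⟩ := lift i (LinearMap.id - l ∘ₗ d i) (by
      rw [LinearMap.comp_sub, hl, LinearMap.comp_id, sub_self])
    exact ⟨l', by rw [hl', sub_add_cancel]⟩
  have key : ∀ i, ∃ l : Q i →ₗ[R] Q (i + 1), d i ∘ₗ l ∘ₗ d i = d i := by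
    intro i
    induction i with
    | zero =>
      obtain ⟨s, hs⟩ := ε.exists_rightInverse_of_surjective (LinearMap.range_eq_top.2 hε)
      have hs' : ∀ x, ε (s x) = x := LinearMap.congr_fun hs
      obtain ⟨l, hl⟩ := Module.projective_lifting_property (d 0).rangeRestrict
        ((LinearMap.id - s ∘ₗ ε : Q 0 →ₗ[R] Q 0).codRestrict _ fun x => (h0 _).1 (by simp [hs']))
        (d 0).surjective_rangeRestrict
      refine ⟨l, LinearMap.ext fun x => ?_⟩
      have h1 : d 0 (l (d 0 x)) = d 0 x - s (ε (d 0 x)) :=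
        congrArg Subtype.val (LinearMap.congr_fun hl (d 0 x))
      rw [LinearMap.comp_apply, LinearMap.comp_apply, h1, (h0 _).2 ⟨x, rfl⟩, map_zero, sub_zero]
    | succ i ih =>
      obtain ⟨l, hl⟩ := ih
      obtain ⟨l', hl'⟩ := step i l hl
      refine ⟨l', LinearMap.ext fun x => ?_⟩
      have h1 := LinearMap.congr_fun hl' (d (i + 1) x)
      rw [LinearMap.add_apply, LinearMap.comp_apply, LinearMap.comp_apply, (h i _).2 ⟨x, rfl⟩,
        map_zero, add_zero] at h1
      exact h1
  obtain ⟨l, hl⟩ := key i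
  obtain ⟨l', hl'⟩ := step i l hl
  exact ⟨l, l', hl'⟩

theorem projectiveResolution_exact {R : Type u} [Ring R] {X : ModuleCat.{u} R}
    (Q : ProjectiveResolution X) :
    Function.Surjective (Q.π.f 0).hom ∧
      Function.Exact (Q.complex.d 1 0).hom (Q.π.f 0).hom ∧
      ∀ i, Function.Exact (Q.complex.d (i + 2) (i + 1)).hom (Q.complex.d (i + 1) i).hom :=
  ⟨(ModuleCat.epi_iff_surjective _).1 inferInstance,
    (ShortComplex.ShortExact.moduleCat_exact_iff_function_exact _).1 Q.exact₀,
    fun i => (ShortComplex.ShortExact.moduleCat_exact_iff_function_exact _).1 (Q.exact_succ i)⟩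

/-- A Λ-projective resolution of X is also a B-projective one, so it contracts over B, and
`rightMap` carries the contraction along. -/
theorem subsingleton_balancedTor_of_projective {X : ModuleCat.{u} (A ⊗[k] B)}
    [hX : Module.Projective B X] (i : ℕ) :
    Subsingleton (balancedTor A (A ⊗[k] B) (BimoduleTensor k A V) (i + 1) X) := by
  let Q := projectiveResolution X
  rw [subsingleton_balancedTor_iff Q]
  obtain ⟨h1, h2, h3⟩ := projectiveResolution_exact Q
  have hQ : ∀ i, Module.Projective B (Q.complex.X i) := fun i => by
    have : Module.Projective (A ⊗[k] B) (Q.complex.X i) :=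
      (IsProjective.iff_projective _).2 (Q.projective i)
    exact projective_right
  obtain ⟨l, l', hl⟩ := exists_contraction (R := B) (Q := fun i => Q.complex.X i)
    (d := fun i => resRight (Q.complex.d (i + 1) i).hom) (ε := resRight (Y := X) (Q.π.f 0).hom) h1 h2 h3 i
  have hT := congrArg (rightMap V) hl
  rw [rightMap_add, rightMap_comp, rightMap_comp, rightMap_id] at hT
  intro z
  constructor
  · intro hz
    refine ⟨rightMap V l' z, ?_⟩
    have h4 := DFunLike.congr_fun hT z
    rw [rightMapLinear_apply] at hz ⊢
    simpa [hz] using h4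
  · rintro ⟨y, rfl⟩
    rw [rightMapLinear_apply, rightMapLinear_apply, ← AddMonoidHom.comp_apply, ← rightMap_comp]
    have h5 : resRight (Q.complex.d (i + 1) i).hom ∘ₗ resRight (Q.complex.d (i + 2) (i + 1)).hom = 0 :=
      LinearMap.ext fun x => (h3 i _).2 ⟨x, rfl⟩
    have h0 : ∀ {X Y : ModuleCat.{u} (A ⊗[k] B)}, rightMap V (0 : X →ₗ[B] Y) = 0 :=
      rightTensor_hom_ext fun v x => by simp
    rw [h5, h0]
    rfl

theorem IsTriangularFamily.gproj_le_monRepIn [FiniteDimensional k A] [FiniteDimensional k B]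
    {n : ℕ} {e : Fin n → B} (he : IsTriangularFamily k e) :
    Gproj (A ⊗[k] B) ≤ MonRepIn k B A (Gproj A) := by
  intro X hX
  have := he.projective_right_of_gproj hX
  refine ⟨⟨hX.1, fun S _ _ _ _ _ i hi => ?_⟩, fun V _ _ _ _ hV => he.gproj_rightTensor V hX⟩
  obtain ⟨i, rfl⟩ : ∃ j, i = j + 1 := ⟨i - 1, by lia⟩
  exact subsingleton_balancedTor_of_projective i

end TorVanishing

/-! ### From vanishing Tor to projectivity over B -/

section ExtVanishing

-- Dévissage along a composition series, using exactness of Ext in the middle term.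
open Abelian in
theorem subsingleton_ext_of_isFiniteLength {R : Type u} [Ring R] {X : ModuleCat.{u} R} {n : ℕ}
    (h : ∀ (S : Type u) [AddCommGroup S] [Module R S], IsSimpleModule R S →
      Subsingleton (Ext.{u} X (ModuleCat.of R S) n))
    {W : Type u} [AddCommGroup W] [Module R W] (hW : IsFiniteLength R W) :
    Subsingleton (Ext.{u} X (ModuleCat.of R W) n) := by
  induction hW with
  | @of_subsingleton M _ _ _ =>
    have hM : Limits.IsZero (ModuleCat.of R M) := ModuleCat.isZero_iff_subsingleton.2 ‹_›
    refine subsingleton_of_forall_eq 0 fun x => ?_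
    rw [← Ext.comp_mk₀_id x, hM.eq_of_src (𝟙 _) 0, Ext.mk₀_zero, Ext.comp_zero]
  | @of_simple_quotient M _ _ N hS _ ih =>
    refine subsingleton_of_forall_eq 0 fun x => ?_
    have hS' := h (M ⧸ N) hS
    have hex : Function.Exact N.subtype N.mkQ := LinearMap.exact_subtype_mkQ N
    obtain ⟨y, rfl⟩ := Ext.covariant_sequence_exact₂ X
      (shortExact_moduleCat N.injective_subtype hex N.mkQ_surjective) x (Subsingleton.elim _ _)
    rw [Subsingleton.elim y 0, Ext.zero_comp]

open Abelian in
/-- A finite module without extensions by simple modules is projective. -/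
theorem projective_of_subsingleton_ext_simple {R : Type u} [Ring R] [IsArtinianRing R]
    {X : ModuleCat.{u} R} [Module.Finite R X]
    (h : ∀ (S : Type u) [AddCommGroup S] [Module R S], IsSimpleModule R S →
      Subsingleton (Ext.{u} X (ModuleCat.of R S) 1)) : Module.Projective R X := by
  obtain ⟨m, π, hπ⟩ := Module.Finite.exists_fin' R X
  have hK : IsFiniteLength R (LinearMap.ker π) := isFiniteLength_iff_isNoetherian_isArtinian.2
    ⟨inferInstance, inferInstance⟩
  -- The kernel of the free cover has finite length, so its identity extends to a retraction and the
  -- cover splits.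
  obtain ⟨g, hg⟩ := exists_extend_of_subsingleton_ext (LinearMap.ker π).injective_subtype
    (LinearMap.exact_subtype_ker_map π) hπ (subsingleton_ext_of_isFiniteLength h hK) LinearMap.id
  obtain ⟨s, hs⟩ := exists_comp_eq_of_ker_le (f := LinearMap.id - (LinearMap.ker π).subtype ∘ₗ g) hπ
    fun y hy => by
      have h1 : g y = ⟨y, hy⟩ := LinearMap.congr_fun hg ⟨y, hy⟩
      simp [h1]
  refine Module.Projective.of_split s π (LinearMap.ext fun x => ?_)
  obtain ⟨y, rfl⟩ := hπ x
  have h1 : s (π y) = y - g y := LinearMap.congr_fun hs y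
  rw [LinearMap.comp_apply, h1, map_sub, LinearMap.mem_ker.1 (g y).2, sub_zero]
  rfl

variable {k : Type u} [Field k] {A B : Type u} [Ring A] [Algebra k A] [Ring B] [Algebra k B]
  {X Y Z : ModuleCat.{u} (A ⊗[k] B)}
  {S : Type u} [AddCommGroup S] [Module k S] [Module B S] [IsScalarTower k B S]

theorem exists_linearMap_comp_eq_of_ker_le {K U W T : Type*} [Field K] [AddCommGroup U] [Module K U]
    [AddCommGroup W] [Module K W] [AddCommGroup T] [Module K T] (p : U →ₗ[K] W) (f : U →ₗ[K] T)
    (h : ∀ u, p u = 0 → f u = 0) : ∃ g : W →ₗ[K] T, g ∘ₗ p = f := by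
  obtain ⟨g, hg⟩ := exists_comp_eq_of_ker_le p.surjective_rangeRestrict
    fun u hu => h u (congrArg Subtype.val hu)
  obtain ⟨g', hg'⟩ := LinearMap.exists_extend g
  exact ⟨g', by rw [← hg, ← hg']; rfl⟩

theorem RightDual.ext_eval {s t : S} (h : ∀ v : RightDual k S, v.eval k S s = v.eval k S t) :
    s = t := by
  rw [← sub_eq_zero, ← Module.forall_dual_apply_eq_zero_iff k]
  intro v
  rw [map_sub, sub_eq_zero]
  exact h v

/-- `B`-linear maps to a finite dimensional module `S` are the linear forms on `(A ⊗ D(S)) ⊗ X`. -/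
theorem exists_eval_eq [FiniteDimensional k S] (g : RightTensor (RightDual k S) X →+ k)
    (hg : ∀ (c : k) z, g (algebraMap k A c • z) = c * g z) :
    ∃ f : X →ₗ[B] S, ∀ v x, v.eval k S (f x) = g (rightTmul v x) := by
  let f : X → S := fun x => (Module.evalEquiv k S).symm
    { toFun := fun v => g (rightTmul (show RightDual k S from v) x)
      map_add' := fun v w => by rw [← map_add, ← rightTmul_add]; rfl
      map_smul' := fun c v => by
        rw [RingHom.id_apply, smul_eq_mul, ← hg, ← rightTmul_base_smul]; rfl }
  have hf : ∀ (v : RightDual k S) x, v.eval k S (f x) = g (rightTmul v x) := fun v x =>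
    Module.apply_evalEquiv_symm_apply k S (v.eval k S) _
  refine ⟨{ toFun := f, map_add' := fun x y => RightDual.ext_eval (k := k) fun v => ?_,
            map_smul' := fun b x => RightDual.ext_eval (k := k) fun v => ?_ }, hf⟩
  · rw [map_add, hf, hf, hf, map_add, map_add]
  · rw [hf, RingHom.id_apply, ← rightTmul_op_smul, ← hf]
    rfl

/-- Exactness of `(A ⊗ D(S)) ⊗ -` lets maps into `S` extend. -/
theorem exists_eq_comp_of_exact [FiniteDimensional k S] {d : X →ₗ[A ⊗[k] B] Y}
    {d' : Y →ₗ[A ⊗[k] B] Z}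
    (h : Function.Exact (rightMapLinear (RightDual k S) d) (rightMapLinear (RightDual k S) d'))
    (f : Y →ₗ[B] S) (hf : ∀ x, f (d x) = 0) : ∃ g : Z →ₗ[B] S, ∀ y, g (d' y) = f y := by
  let _ := baseModule k (A := A) (RightTensor (RightDual k S) Y)
  let _ := baseModule k (A := A) (RightTensor (RightDual k S) Z)
  have := baseModule_isScalarTower k (A := A) (RightTensor (RightDual k S) Y)
  have := baseModule_isScalarTower k (A := A) (RightTensor (RightDual k S) Z)
  -- Under duality f is the form v ⊗ y ↦ v(f y). It vanishes on the image of d, which is the kernel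
  -- of d', so over k it factors through d'; dualizing back gives g.
  let θ : RightTensor (RightDual k S) Y →+ k := rightLift
    (AddMonoidHom.mk' (fun v => (v.eval k S).toAddMonoidHom.comp f.toAddMonoidHom)
      fun v w => rfl)
    fun b v y => by
      change v.eval k S (b • f y) = v.eval k S (f (b • y))
      rw [f.map_smul]
  have hθ : ∀ v y, θ (rightTmul v y) = v.eval k S (f y) := rightLift_tmul _ _
  let θ' : RightTensor (RightDual k S) Y →ₗ[k] k :=
    { θ with
      map_smul' := fun c z => by
        change θ (algebraMap k A c • z) = c * θ z
        induction z using RightTensor.induction with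
        | zero => rw [smul_zero, map_zero, mul_zero]
        | mk v y =>
          rw [smul_rightTmul, algebraMap_smul, hθ, hθ, ← algebraMap_smul B, map_smul,
            algebraMap_smul, map_smul, smul_eq_mul]
        | add y z hy hz => rw [smul_add, map_add, map_add, mul_add, hy, hz] }
  obtain ⟨g, hg⟩ := exists_linearMap_comp_eq_of_ker_le
    ((rightMapLinear (RightDual k S) d').restrictScalars k) θ' (by
      intro z hz
      obtain ⟨z, rfl⟩ := (h z).1 hz
      change θ _ = 0
      clear hz
      induction z using RightTensor.induction with
      | zero => rw [map_zero, map_zero]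
      | mk v x => rw [rightMapLinear_tmul, hθ, hf, map_zero]
      | add y z hy hz => rw [map_add, map_add, hy, hz, add_zero])
  have hg' : ∀ v y, g (rightTmul v (d' y)) = v.eval k S (f y) := fun v y =>
    (LinearMap.congr_fun hg (rightTmul v y)).trans (hθ v y)
  obtain ⟨f', hf'⟩ := exists_eval_eq g.toAddMonoidHom fun c z => g.map_smul c z
  exact ⟨f', fun y => RightDual.ext_eval (k := k) fun v => (hf' v _).trans (hg' v y)⟩

/-- Hom_B(−, S) is the k-dual of (A ⊗ D(S)) ⊗_Λ −, so Tor_1 = 0 makes every map from the first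
syzygy of X to S extend. Thus Ext¹_B(X, S) = 0 for all simple S, and X is projective over B. -/
theorem projective_right_of_monRep [FiniteDimensional k A] [FiniteDimensional k B]
    (hX : MonRep k B A X) : Module.Projective B X := by
  have := hX.1
  have hfin : Module.Finite B X := finite_right
  have : IsArtinianRing B := IsArtinianRing.of_finite k B
  refine projective_of_subsingleton_ext_simple (X := ModuleCat.of B X) fun S _ _ hS => ?_
  let _ := baseModule k (A := B) S
  have := baseModule_isScalarTower k (A := B) S
  have : FiniteDimensional k S := Module.Finite.trans B S
  let Q := projectiveResolution X
  obtain ⟨h1, h2, h3⟩ := projectiveResolution_exact Q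
  have hQ : Module.Projective B (Q.complex.X 0) := by
    have : Module.Projective (A ⊗[k] B) (Q.complex.X 0) :=
      (IsProjective.iff_projective _).2 (Q.projective 0)
    exact projective_right
  let ε : Q.complex.X 0 →ₗ[B] X := resRight (Y := X) (Q.π.f 0).hom
  have hd : ∀ x, ε ((Q.complex.d 1 0).hom x) = 0 := fun x => (h2 _).2 ⟨x, rfl⟩
  refine subsingleton_ext_of_extend (LinearMap.ker ε).injective_subtype
    (LinearMap.exact_subtype_ker_map ε) h1 fun f => ?_
  obtain ⟨g, hg⟩ := exists_eq_comp_of_exact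
    ((subsingleton_balancedTor_iff Q 0).1 (hX.2 S hS 1 le_rfl))
    (f ∘ₗ (resRight (Q.complex.d 1 0).hom).codRestrict (LinearMap.ker ε) hd) fun x => by
      rw [LinearMap.comp_apply, ← map_zero f]
      exact congrArg f (Subtype.ext ((h3 0 _).2 ⟨x, rfl⟩))
  refine ⟨g, LinearMap.ext fun x => ?_⟩
  obtain ⟨y, hy⟩ := (h2 x.1).1 x.2
  have hx : x = ⟨(Q.complex.d 1 0).hom y, hd y⟩ := Subtype.ext hy.symm
  rw [hx]
  exact hg y

end ExtVanishing

/-! ### Projective modules are Gorenstein projective -/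

section ProjectiveGproj

theorem gproj_of_projective {R : Type u} [Ring R] {P : ModuleCat.{u} R} [hf : Module.Finite R P]
    [hp : Module.Projective R P] : Gproj R P := by
  have h0 : ∀ {X Y : ModuleCat.{u} R}, Subsingleton Y → Function.Surjective (0 : X →ₗ[R] Y) :=
    fun h _ => ⟨0, Subsingleton.elim _ _⟩
  have : GorensteinStable (R := R) fun P => Module.Finite R P ∧ Module.Projective R P := by
    refine ⟨fun P h => h.1, ?_, ?_⟩
    · rintro P ⟨hf, hp⟩
      exact ⟨ModuleCat.of R PUnit, ⟨inferInstance, inferInstance⟩, P, LinearMap.id, 0, hf, hp,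
        Function.injective_id, fun x => ⟨fun _ => ⟨x, rfl⟩, fun _ => rfl⟩,
        fun _ => ⟨0, Subsingleton.elim _ _⟩, fun f => ⟨f, rfl⟩⟩
    · rintro P ⟨hf, hp⟩
      exact ⟨ModuleCat.of R PUnit, ⟨inferInstance, inferInstance⟩, P, 0, LinearMap.id, hf, hp,
        fun _ _ _ => Subsingleton.elim _ _,
        fun x => ⟨fun h => ⟨0, h.symm⟩, by rintro ⟨y, rfl⟩; rfl⟩, Function.surjective_id,
        fun f => ⟨0, LinearMap.ext fun x => by
          rw [Subsingleton.elim x 0, map_zero, map_zero]⟩⟩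
  exact this.le_gproj P ⟨hf, hp⟩

end ProjectiveGproj

/-! ### The chain of idempotent-generated ideals -/

section Stages

variable {B : Type u} [Ring B] {n : ℕ} (e : Fin n → B)

/-- The ideal generated by the first `j` idempotents. -/
def stageIdeal (j : ℕ) : Ideal B :=
  Ideal.span {y | ∃ i : Fin n, i.1 < j ∧ ∃ b, y = e i * b}

variable {e}

theorem mul_mem_stageIdeal {j : ℕ} {i : Fin n} (hi : i.1 < j) (b c : B) :
    b * (e i * c) ∈ stageIdeal e j :=
  Ideal.mul_mem_left _ _ (Submodule.subset_span ⟨i, hi, c, rfl⟩)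

theorem stageIdeal_mul_mem {j : ℕ} {y : B} (hy : y ∈ stageIdeal e j) (c : B) :
    y * c ∈ stageIdeal e j := by
  induction hy using Submodule.span_induction with
  | mem y hy =>
    obtain ⟨i, hi, b, rfl⟩ := hy
    rw [mul_assoc]
    exact Submodule.subset_span ⟨i, hi, _, rfl⟩
  | zero => rw [zero_mul]; exact Submodule.zero_mem _
  | add y z _ _ hy hz => rw [add_mul]; exact Submodule.add_mem _ hy hz
  | smul b y _ hy => rw [smul_eq_mul, mul_assoc]; exact Ideal.mul_mem_left _ _ hy

variable {k : Type u} [Field k] [Algebra k B]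

theorem IsTriangularFamily.stageIdeal_mul_eq_zero (he : IsTriangularFamily k e) (j : Fin n) {y : B}
    (hy : y ∈ stageIdeal e j) (c : B) : y * (c * e j) = 0 := by
  induction hy using Submodule.span_induction with
  | mem y hy =>
    obtain ⟨i, hi, b, rfl⟩ := hy
    rw [← mul_assoc, mul_assoc (e i)]
    exact he.upper i j hi _
  | zero => rw [zero_mul]
  | add y z _ _ hy hz => rw [add_mul, hy, hz, add_zero]
  | smul b y _ hy => rw [smul_eq_mul, mul_assoc, hy, mul_zero]

/-- Independent elements of `B e_j` stay independent over `e_j B` modulo the `j`-th ideal. -/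
theorem IsTriangularFamily.mem_stageIdeal_of_sum_mem (he : IsTriangularFamily k e) (j : Fin n)
    {ι : Type*} {b : ι → B} (hb : LinearIndependent k b) (hbe : ∀ t, b t * e j = b t) {s : Finset ι} {y : ι → B}
    (hy : ∑ t ∈ s, b t * (e j * y t) ∈ stageIdeal e j) (t : ι) (ht : t ∈ s) :
    e j * y t ∈ stageIdeal e j := by
  -- Right multiplication by c e_j kills the j-th ideal and turns e_j y_t into a scalar multiple r_t
  -- e_j. The relation becomes Σ r_t b_t = 0, and independence applies.
  have h0 : ∀ c, e j * y t * (c * e j) = 0 := by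
    intro c
    choose r hr using fun t => he.corner j (y t * c)
    have h1 : ∑ t ∈ s, r t • b t = 0 := by
      rw [← he.stageIdeal_mul_eq_zero j hy c, Finset.sum_mul]
      refine Finset.sum_congr rfl fun t _ => ?_
      rw [← hbe t, ← mul_smul_comm, ← hr]
      simp only [mul_assoc, hbe]
    have h2 := linearIndependent_iff'.1 hb s r h1 t ht
    have h3 := hr t
    rw [h2, zero_smul] at h3
    rw [← h3]
    simp only [mul_assoc]
  let I : Ideal B :=
    { carrier := {z | ∀ c, e j * y t * (c * z) ∈ stageIdeal e j}
      add_mem' := fun hx hy c => by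
        rw [mul_add, mul_add]
        exact add_mem (hx c) (hy c)
      zero_mem' := fun c => by
        rw [mul_zero, mul_zero]
        exact Submodule.zero_mem _
      smul_mem' := fun d z hz c => by
        rw [smul_eq_mul, ← mul_assoc c]
        exact hz _ }
  -- By fullness it suffices to follow e_j y_t by each e_i: before j the product lies in the ideal,
  -- at j it vanishes by `h0`, and after j it vanishes by triangularity.
  have hI : (1 : B) ∈ I := by
    rw [he.full I fun i x c => ?_]
    · trivial
    · rcases lt_trichotomy i j with hij | rfl | hij
      · rw [← mul_assoc]
        exact mul_mem_stageIdeal hij _ _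
      · rw [← mul_assoc c, ← mul_assoc, h0, zero_mul]
        exact Submodule.zero_mem _
      · have h1 := he.upper j i hij (y t * c)
        have h2 : e j * y t * (c * (e i * x)) = e j * (y t * c) * e i * x := by
          simp only [mul_assoc]
        rw [h2, h1, zero_mul]
        exact Submodule.zero_mem _
  simpa using hI 1

end Stages

/-! ### The induced filtration of a Λ-module -/

section StageModules

variable {k : Type u} [Field k] {A B : Type u} [Ring A] [Algebra k A] [Ring B] [Algebra k B]
  {n : ℕ} (e : Fin n → B) (X : ModuleCat.{u} (A ⊗[k] B))

/-- The submodule generated by the images of the first `j` idempotents. -/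
def stage (j : ℕ) : Submodule (A ⊗[k] B) X :=
  Submodule.span _ {z | ∃ i : Fin n, i.1 < j ∧ ∃ x : X, z = e i • x}

/-- The elements of `B` killed by `b ↦ e_j b` modulo the `j`-th ideal, as a right ideal. -/
def stageRelations (j : Fin n) : Submodule Bᵐᵒᵖ Bᵐᵒᵖ where
  carrier := {y | e j * y.unop ∈ stageIdeal e j}
  add_mem' {y z} hy hz := by
    change e j * (y.unop + z.unop) ∈ stageIdeal e j
    rw [mul_add]
    exact add_mem hy hz
  zero_mem' := by
    change e j * 0 ∈ stageIdeal e j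
    rw [mul_zero]
    exact Submodule.zero_mem _
  smul_mem' c y hy := by
    change e j * (y.unop * c.unop) ∈ stageIdeal e j
    rw [← mul_assoc]
    exact stageIdeal_mul_mem hy _

/-- The right `B`-module `e_j (B / I_j)`. -/
abbrev StageCorner (j : Fin n) : Type u := Bᵐᵒᵖ ⧸ stageRelations e j

variable {e X}

theorem smul_mem_stage {j : ℕ} {i : Fin n} (hi : i.1 < j) (b : B) (x : X) :
    b • e i • x ∈ stage e X j :=
  (stage e X j).smul_mem ((1 : A) ⊗ₜ[k] b) (Submodule.subset_span ⟨i, hi, x, rfl⟩)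

theorem smul_mem_stage_of_mem_stageIdeal {j : ℕ} {y : B} (hy : y ∈ stageIdeal e j) (x : X) :
    y • x ∈ stage e X j := by
  induction hy using Submodule.span_induction with
  | mem y hy =>
    obtain ⟨i, hi, b, rfl⟩ := hy
    rw [mul_smul]
    exact Submodule.subset_span ⟨i, hi, _, rfl⟩
  | zero => rw [zero_smul]; exact Submodule.zero_mem _
  | add y z _ _ hy hz => rw [add_smul]; exact Submodule.add_mem _ hy hz
  | smul b y _ hy =>
    rw [smul_assoc]
    exact (stage e X j).smul_mem ((1 : A) ⊗ₜ[k] b) hy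

theorem map_stage_mem (φ : X →ₗ[B] B) {j : ℕ} {x : X} (hx : x ∈ stage e X j) :
    φ x ∈ stageIdeal e j := by
  -- φ is only B-linear, whereas the stage is spanned over A ⊗ B; the induction therefore carries an
  -- arbitrary a.
  have key : ∀ a : A, φ (a • x) ∈ stageIdeal e j := by
    induction hx using Submodule.span_induction with
    | mem x hx =>
      obtain ⟨i, hi, x, rfl⟩ := hx
      intro a
      rw [smul_comm, map_smul]
      exact Submodule.subset_span ⟨i, hi, _, rfl⟩
    | zero => intro a; rw [smul_zero, map_zero]; exact Submodule.zero_mem _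
    | add y z _ _ hy hz => intro a; rw [smul_add, map_add]; exact Submodule.add_mem _ (hy a) (hz a)
    | smul r x _ hx =>
      induction r using TensorProduct.induction_on with
      | zero => intro a; rw [zero_smul, smul_zero, map_zero]; exact Submodule.zero_mem _
      | tmul a' b =>
        intro a
        rw [tmul_smul_eq', smul_comm a, map_smul, smul_smul]
        exact Ideal.mul_mem_left _ _ (hx _)
      | add r s hr hs =>
        intro a
        rw [add_smul, smul_add, map_add]
        exact Submodule.add_mem _ (hr a) (hs a)
  simpa using key 1

/-- The coordinate forms of a dual basis of X over B transport the relation to B, where it is a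
statement about ideals. This is where projectivity of X over B enters. -/
theorem IsTriangularFamily.mem_stage_of_sum_mem (he : IsTriangularFamily k e)
    [Module.Finite B X] [Module.Projective B X] (j : Fin n) {ι : Type*} {b : ι → B}
    (hb : LinearIndependent k b) (hbe : ∀ t, b t * e j = b t) {s : Finset ι} {x : ι → X}
    (hx : ∑ t ∈ s, b t • e j • x t ∈ stage e X j) (t : ι) (ht : t ∈ s) :
    e j • x t ∈ stage e X j := by
  obtain ⟨m, φ, y, hy⟩ := exists_dual_basis B X
  rw [← hy (e j • x t)]
  refine Submodule.sum_mem _ fun c _ => smul_mem_stage_of_mem_stageIdeal ?_ _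
  rw [map_smul]
  refine he.mem_stageIdeal_of_sum_mem j hb hbe (s := s) (y := fun t => φ c (x t)) ?_ t ht
  have h := map_stage_mem (φ c) hx
  rw [map_sum] at h
  simpa only [map_smul, smul_eq_mul] using h

/-- An idempotent e_i with i < j moves across the tensor sign and annihilates e_j (B / I_j). -/
theorem rightTmul_eq_zero_of_mem_stage (j : Fin n) {x : X} (hx : x ∈ stage e X j)
    (v : StageCorner e j) : rightTmul v x = 0 := by
  induction hx using Submodule.span_induction generalizing v with
  | mem x hx =>
    obtain ⟨i, hi, x, rfl⟩ := hx
    obtain ⟨b, rfl⟩ := Submodule.Quotient.mk_surjective _ v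
    have h : MulOpposite.op (e i) • (Submodule.Quotient.mk b : StageCorner e j) = 0 := by
      rw [← Submodule.Quotient.mk_smul, Submodule.Quotient.mk_eq_zero]
      change e j * (b.unop * e i) ∈ stageIdeal e j
      have := mul_mem_stageIdeal (e := e) hi (e j * b.unop) (1 : B)
      rwa [mul_one, mul_assoc] at this
    rw [← rightTmul_op_smul, h]
    have h0 := rightTmul_add (0 : StageCorner e j) 0 x
    rwa [add_zero, left_eq_add] at h0
  | zero => rw [map_zero]
  | add y z _ _ hy hz => rw [map_add, hy, hz, add_zero]
  | smul r x _ hx =>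
    induction r using TensorProduct.induction_on generalizing v with
    | zero => rw [zero_smul, map_zero]
    | tmul a b => rw [tmul_smul_eq, ← smul_rightTmul, ← rightTmul_op_smul, hx, smul_zero]
    | add r s hr hs => rw [add_smul, map_add, hr, hs, add_zero]

end StageModules

/-! ### The filtration factors as outer tensor products -/

section StageFactors

variable {k : Type u} [Field k] {A B : Type u} [Ring A] [Algebra k A] [Ring B] [Algebra k B]
  {n : ℕ} {e : Fin n → B} {X Z : ModuleCat.{u} (A ⊗[k] B)} {j : Fin n} {π : X →ₗ[A ⊗[k] B] Z}

/-- The pairing `([b], x) ↦ π(e_j b x)` for a map `π` that kills the `j`-th stage. -/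
def stagePairing (h : ∀ x ∈ stage e X j, π x = 0) : StageCorner e j →+ X →+ Z :=
  QuotientAddGroup.lift (stageRelations e j).toAddSubgroup
    (AddMonoidHom.mk' (fun y : Bᵐᵒᵖ => π.toAddMonoidHom.comp
        (DistribSMul.toAddMonoidHom X (e j * y.unop)))
      fun y z => by
        ext x
        change π ((e j * (y.unop + z.unop)) • x) = π ((e j * y.unop) • x) + π ((e j * z.unop) • x)
        rw [mul_add, add_smul, map_add])
    fun y hy => by
      ext x
      exact h _ (smul_mem_stage_of_mem_stageIdeal hy x)

theorem stagePairing_mk (h : ∀ x ∈ stage e X j, π x = 0) (b : Bᵐᵒᵖ) (x : X) :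
    stagePairing h (Submodule.Quotient.mk b) x = π ((e j * b.unop) • x) := rfl

/-- The map `(A ⊗ e_j (B / I_j)) ⊗ X → Z` induced by `π`. -/
def stageMap (h : ∀ x ∈ stage e X j, π x = 0) : RightTensor (StageCorner e j) X →ₗ[A] Z :=
  rightLiftLinear (stagePairing h)
    (fun b v x => by
      obtain ⟨c, rfl⟩ := Submodule.Quotient.mk_surjective _ v
      rw [← Submodule.Quotient.mk_smul, stagePairing_mk, stagePairing_mk, smul_smul, mul_assoc]
      rfl)
    (fun a v x => by
      obtain ⟨c, rfl⟩ := Submodule.Quotient.mk_surjective _ v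
      rw [stagePairing_mk, stagePairing_mk, smul_comm]
      exact (resLeft π).map_smul a _)

variable (e j) in
/-- The class of `1` in `e_j (B / I_j)`. -/
def StageCorner.one : StageCorner e j := Submodule.Quotient.mk 1

theorem stageMap_one (h : ∀ x ∈ stage e X j, π x = 0) (x : X) :
    stageMap h (rightTmul (StageCorner.one e j) x) = π (e j • x) := by
  refine (rightLiftLinear_tmul _ _ _ _ _).trans ?_
  refine (stagePairing_mk h 1 x).trans ?_
  rw [MulOpposite.unop_one, mul_one]

/-- The corner is a cyclic right module generated by the class of 1, so every element is a single
symbol. -/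
theorem exists_eq_rightTmul_one (z : RightTensor (StageCorner e j) X) :
    ∃ x, z = rightTmul (StageCorner.one e j) x := by
  induction z using RightTensor.induction with
  | zero => exact ⟨0, (map_zero _).symm⟩
  | mk v x =>
    obtain ⟨c, rfl⟩ := Submodule.Quotient.mk_surjective _ v
    refine ⟨c.unop • x, ?_⟩
    rw [← rightTmul_op_smul, StageCorner.one, ← Submodule.Quotient.mk_smul, MulOpposite.op_unop,
      smul_eq_mul, mul_one]
  | add y z hy hz =>
    obtain ⟨x, rfl⟩ := hy
    obtain ⟨x', rfl⟩ := hz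
    exact ⟨x + x', (map_add _ _ _).symm⟩

/-- The principal left ideal `B b`. -/
abbrev principalLeft (b : B) : Submodule B B := LinearMap.range (LinearMap.toSpanSingleton B B b)

theorem mul_of_mem_principalLeft {b : B} (hb : b * b = b) {q : B} (hq : q ∈ principalLeft b) :
    q * b = q := by
  obtain ⟨x, rfl⟩ := hq
  change x * b * b = x * b
  rw [mul_assoc, hb]

theorem projective_principalLeft {b : B} (hb : b * b = b) :
    Module.Projective B (principalLeft b) :=
  Module.Projective.of_split (principalLeft b).subtype
    (LinearMap.toSpanSingleton B B b).rangeRestrict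
    (LinearMap.ext fun q => Subtype.ext (mul_of_mem_principalLeft hb q.2))

variable [Module k (RightTensor (StageCorner e j) X)]
  [IsScalarTower k A (RightTensor (StageCorner e j) X)]

/-- The map `m ⊗ b ↦ b m` on `(A ⊗ e_j (B / I_j)) ⊗ X ⊗ B e_j`. -/
def stageTensorMap (h : ∀ x ∈ stage e X j, π x = 0) :
    OuterTensor k (RightTensor (StageCorner e j) X) (principalLeft (e j)) →ₗ[A ⊗[k] B] Z :=
  OuterTensor.lift (TensorProduct.lift (LinearMap.mk₂ k
    (fun (m : RightTensor (StageCorner e j) X) (b : principalLeft (e j)) => (b : B) • stageMap h m)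
    (fun m m' b => by rw [map_add, smul_add])
    (fun c m b => by
      rw [← algebraMap_smul A c m, map_smul, algebraMap_smul, smul_comm])
    (fun m b b' => by rw [Submodule.coe_add, add_smul])
    (fun c m b => by
      change (c • (b : B)) • stageMap h m = _
      rw [smul_assoc]))).toAddMonoidHom
    fun a b m q => by
      simp only [LinearMap.toAddMonoidHom_coe, TensorProduct.lift.tmul, LinearMap.mk₂_apply]
      rw [map_smul, Submodule.coe_smul, smul_eq_mul, mul_smul, tmul_smul_eq', smul_comm a]

theorem stageTensorMap_tmul (h : ∀ x ∈ stage e X j, π x = 0)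
    (m : RightTensor (StageCorner e j) X) (b : principalLeft (e j)) :
    stageTensorMap h (OuterTensor.tmul k m b) = (b : B) • stageMap h m := rfl

theorem stageTensorMap_tmul_one (h : ∀ x ∈ stage e X j, π x = 0)
    (x : X) (b : principalLeft (e j)) :
    stageTensorMap h (OuterTensor.tmul k (rightTmul (StageCorner.one e j) x) b) =
      π ((b : B) • e j • x) := by
  rw [stageTensorMap_tmul, stageMap_one]
  exact ((resRight π).map_smul _ _).symm

theorem range_stageTensorMap (he : IsTriangularFamily k e) (h : ∀ x ∈ stage e X j, π x = 0) :
    LinearMap.range (stageTensorMap h) = (stage e X (j + 1)).map π := by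
  apply le_antisymm
  · rintro _ ⟨z, rfl⟩
    induction z using OuterTensor.induction with
    | zero => rw [map_zero]; exact Submodule.zero_mem _
    | tmul m b =>
      obtain ⟨x, rfl⟩ := exists_eq_rightTmul_one m
      rw [stageTensorMap_tmul_one]
      exact ⟨_, smul_mem_stage (Nat.lt_succ_self _) _ _, rfl⟩
    | add y z hy hz => rw [map_add]; exact Submodule.add_mem _ hy hz
  · rw [stage, Submodule.map_span, Submodule.span_le]
    rintro _ ⟨_, ⟨i, hi, x, rfl⟩, rfl⟩
    rcases Nat.lt_succ_iff_lt_or_eq.1 hi with hi | hi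
    · have h1 : π (e i • x) = 0 := h _ (Submodule.subset_span ⟨i, hi, x, rfl⟩)
      rw [h1]
      exact Submodule.zero_mem _
    · obtain rfl : i = j := Fin.ext hi
      refine ⟨OuterTensor.tmul k (rightTmul (StageCorner.one e i) x) ⟨e i, 1, one_mul _⟩, ?_⟩
      rw [stageTensorMap_tmul_one, smul_smul, he.idem]

/-- In a basis (b_t) of B e_j, a kernel element Σ m_t ⊗ b_t with m_t represented by x_t gives Σ b_t
e_j x_t in the stage. Then each e_j x_t lies in the stage, which forces m_t = 0. -/
theorem injective_stageTensorMap (he : IsTriangularFamily k e) [Module.Finite B X]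
    [Module.Projective B X] (h : ∀ x, x ∈ stage e X j ↔ π x = 0) :
    Function.Injective (stageTensorMap fun x hx => (h x).1 hx) := by
  -- The class of 1 is fixed by e_j, so 1 ⊗ x depends only on e_j x.
  have hone : MulOpposite.op (e j) • StageCorner.one e j = StageCorner.one e j := by
    rw [StageCorner.one, ← Submodule.Quotient.mk_smul, Submodule.Quotient.eq]
    change e j * (1 * e j - 1) ∈ stageIdeal e j
    rw [one_mul, mul_sub, he.idem, mul_one, sub_self]
    exact Submodule.zero_mem _
  rw [injective_iff_map_eq_zero]
  intro z hz
  let b := Module.Free.chooseBasis k (principalLeft (e j))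
  obtain ⟨m, hm⟩ := TensorProduct.eq_repr_basis_right b z
  choose x hx using fun t => exists_eq_rightTmul_one (m t)
  have h1 : (m.support.sum fun t => OuterTensor.tmul k (m t) (b t)) = z := hm
  rw [← h1, map_sum] at hz
  rw [← h1]
  have hb : LinearIndependent k fun t => (b t : B) := b.linearIndependent.map'
    ((principalLeft (e j)).subtype.restrictScalars k) (LinearMap.ker_eq_bot.2 Subtype.val_injective)
  have h2 : ∑ t ∈ m.support, (b t : B) • e j • x t ∈ stage e X j := by
    rw [h, map_sum, ← hz]
    refine Finset.sum_congr rfl fun t _ => ?_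
    rw [hx t, stageTensorMap_tmul_one]
  refine Finset.sum_eq_zero fun t ht => ?_
  have h3 := he.mem_stage_of_sum_mem j hb (fun t => mul_of_mem_principalLeft (he.idem j) (b t).2)
    h2 t ht
  have h4 : m t = 0 := by
    rw [hx t, ← hone, rightTmul_op_smul]
    exact rightTmul_eq_zero_of_mem_stage j h3 _
  rw [h4]
  exact TensorProduct.zero_tmul _ _

end StageFactors

/-! ### Modules in the monomorphism category are filtered -/

section MonFilt

variable {k : Type u} [Field k] {A B : Type u} [Ring A] [Algebra k A] [Ring B] [Algebra k B]
  {n : ℕ} {e : Fin n → B} {X : ModuleCat.{u} (A ⊗[k] B)}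

theorem stage_mono {i j : ℕ} (hij : i ≤ j) : stage e X i ≤ stage e X j :=
  Submodule.span_mono fun _ ⟨l, hl, h⟩ => ⟨l, hl.trans_le hij, h⟩

theorem IsTriangularFamily.stage_eq_top (he : IsTriangularFamily k e) : stage e X n = ⊤ := by
  rw [eq_top_iff]
  rintro x -
  let I : Ideal B :=
    { carrier := {b | b • x ∈ stage e X n}
      add_mem' := fun {b c} hb hc => by
        change (b + c) • x ∈ stage e X n
        rw [add_smul]
        exact add_mem hb hc
      zero_mem' := by
        change (0 : B) • x ∈ stage e X n
        rw [zero_smul]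
        exact Submodule.zero_mem _
      smul_mem' := fun b c hc => by
        change (b * c) • x ∈ stage e X n
        rw [mul_smul]
        exact (stage e X n).smul_mem ((1 : A) ⊗ₜ[k] b) hc }
  have hI : (1 : B) ∈ I := by
    rw [he.full I fun i b => ?_]
    · trivial
    · change (e i * b) • x ∈ stage e X n
      rw [mul_smul]
      exact Submodule.subset_span ⟨i, i.2, _, rfl⟩
  have h1 : (1 : B) • x ∈ stage e X n := hI
  rwa [one_smul] at h1

/-- `stageTensorMap` into X / I_j X is injective with image I_{j+1} X / I_j X. Its left factor is
Gorenstein projective by the Mon condition for V = e_j (B / I_j), its right factor B e_j because it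
is projective. -/
theorem IsTriangularFamily.stage_factor_mem [FiniteDimensional k A] [FiniteDimensional k B]
    (he : IsTriangularFamily k e) (hX : MonRepIn k B A (Gproj A) X) (j : Fin n) :
    outerTensorClass k (Gproj A) (Gproj B) (ModuleCat.of (A ⊗[k] B)
      (stage e X (j + 1) ⧸ (stage e X j).submoduleOf (stage e X (j + 1)))) := by
  have := hX.1.1
  have h1 : Module.Finite B X := finite_right
  have h2 : Module.Projective B X := projective_right_of_monRep hX.1
  let Z : ModuleCat.{u} (A ⊗[k] B) := ModuleCat.of (A ⊗[k] B) (X ⧸ stage e X j)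
  let π : X →ₗ[A ⊗[k] B] Z := (stage e X j).mkQ
  have hπ : ∀ x, x ∈ stage e X j ↔ π x = 0 := fun x => (Submodule.Quotient.mk_eq_zero _).symm
  let _ := baseModule k (A := A) (RightTensor (StageCorner e j) X)
  have := baseModule_isScalarTower k (A := A) (RightTensor (StageCorner e j) X)
  have h3 : Module.Finite B (principalLeft (e j)) := Module.Finite.range _
  have h4 := projective_principalLeft (he.idem j)
  refine ⟨RightTensor (StageCorner e j) X, inferInstance, inferInstance, inferInstance, inferInstance,
    principalLeft (e j), inferInstance, inferInstance, inferInstance, inferInstance,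
    hX.2 (StageCorner e j) inferInstance,
    gproj_of_projective (P := ModuleCat.of B (principalLeft (e j))) (hf := h3) (hp := h4), ⟨?_⟩⟩
  let f : stage e X (j + 1) →ₗ[A ⊗[k] B] Z := π ∘ₗ (stage e X (j + 1)).subtype
  have hf : (stage e X j).submoduleOf (stage e X (j + 1)) = LinearMap.ker f :=
    Submodule.ext fun x => hπ x
  have hr : LinearMap.range f = LinearMap.range (stageTensorMap fun x hx => (hπ x).1 hx) := by
    rw [range_stageTensorMap he, LinearMap.range_comp, Submodule.range_subtype]
  exact (Submodule.quotEquivOfEq _ _ hf).trans <| f.quotKerEquivRange.trans <|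
    (LinearEquiv.ofEq _ _ hr).trans (LinearEquiv.ofInjective _ (injective_stageTensorMap he hπ)).symm

theorem IsTriangularFamily.monRepIn_le_filt [FiniteDimensional k A] [FiniteDimensional k B]
    (he : IsTriangularFamily k e) :
    MonRepIn k B A (Gproj A) ≤ filt (outerTensorClass k (Gproj A) (Gproj B)) := fun X hX =>
  ⟨hX.1.1, n, stage e X, by
    rw [stage, Submodule.span_eq_bot]
    rintro _ ⟨i, hi, -⟩
    exact absurd hi (Nat.not_lt_zero _), he.stage_eq_top,
    fun i hi => ⟨stage_mono i.le_succ, he.stage_factor_mem hX ⟨i, hi⟩⟩⟩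

end MonFilt

end

theorem mainTheorem4 (k : Type u) [Field k]
    (A : Type u) [Ring A] [Algebra k A] [FiniteDimensional k A]
    (B : Type u) [Ring B] [Algebra k B] [FiniteDimensional k B]
    (hB : IsTriangularAlgebra B) (hk : IsSplittingFieldFor k B) :
    MonRepIn k B A (Gproj A) = Gproj (A ⊗[k] B) ∧
      Gproj (A ⊗[k] B) = filt (outerTensorClass k (Gproj A) (Gproj B)) := by
  obtain ⟨n, e, he⟩ := exists_isTriangularFamily k B hB hk
  have h1 := he.monRepIn_le_filt (A := A)
  have h2 := he.filt_le_gproj (A := A)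
  have h3 := he.gproj_le_monRepIn (A := A)
  exact ⟨le_antisymm (h1.trans h2) h3, le_antisymm (h3.trans h1) h2⟩
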